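/- A solid partition $\pi=\{\pi_{ijk}\}_{i,j,k\ge 1}$ is a family of non-negative integers with $\pi_{ijk}\ge\pi_{i+1,j,k}$, $\pi_{ijk}\ge\pi_{i,j+1,k}$, $\pi_{ijk}\ge\pi_{i,j,k+1}$ for all $i,j,k\ge1$ and finite size $|\pi|=\sum_{i,j,k}\pi_{ijk}$. Put $$Z_\pi=\sum_{i,j,k\ge1}\sum_{l=1}^{\pi_{ijk}}t_1^{i-1}t_2^{j-1}t_3^{k-1}t_4^{l-1},\qquad \mathsf V_\pi=Z_\pi+\frac{\overline{Z}_\pi}{t_1t_2t_3t_4}-\frac{Z_\pi\overline{Z}_\pi(1-t_1)(1-t_2)(1-t_3)(1-t_4)}{t_1t_2t_3t_4}$$ in $\mathbb Z[t_1^{\pm1},t_2^{\pm1},t_3^{\pm1},t_4^{\pm1}]$, where $\overline{t^w}=t^{-w}$. Let $T=\{t\in(\mathbb C^*)^4: t_1t_2t_3t_4=1\}$ and let $$K=\frac{\mathbb Q(\lambda_1,\lambda_2,\lambda_3,\lambda_4)}{(\lambda_1+\lambda_2+\lambda_3+\lambda_4)}$$ be the fraction field of $\mathbb Q[\lambda_1,\lambda_2,\lambda_3,\lambda_4]/(\lambda_1+\lambda_2+\lambda_3+\lambda_4)\cong\mathbb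 Q[\lambda_1,\lambda_2,\lambda_3]$. For a virtual character $W=\sum_w m_w t^w$ of $T$ (finite sum over the distinct characters $w\in\mathbb Z^4/\mathbb Z(1,1,1,1)$ of $T$, with $m_w\in\mathbb Z$) let $e_T(W)=\prod_w(w_1\lambda_1+w_2\lambda_2+w_3\lambda_3+w_4\lambda_4)^{m_w}\in K$. Regard $\mathsf V_\pi$ as a character of $T$ (that is, set $t_1t_2t_3t_4=1$) and let $\mathsf w_\pi\in K$ be a square root of $(-1)^{|\pi|}e_T(-\mathsf V_\pi)$; it is defined only up to sign. Let $d_1,d_2,d_3,d_4$ be formal variables and set $$L_\pi(d_1,d_2,d_3,d_4)=\prod_{i,j,k\ge1}\prod_{l=1}^{\pi_{ijk}}\big((d_1+i-1)\lambda_1+(d_2+j-1)\lambda_2+(d_3+k-1)\lambda_3+(d_4+l-1)\lambda_4\big).$$ Let $M(q)=\prod_{n\ge1}(1-q^n)^{-n}$ be the MacMahon function. **Theorem.** For every solid partition $\pi$ with $|\pi|\le6$ the element $(-1)^{|\pi|}e_T(-\mathsf V_\pi)$ is a square in $K$, so that $\mathsf w_\pi$ exists in $K$. Moreover, there is a choice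 of the signs of the $\mathsf w_\pi$ such that the identity $$\sum_{\pi}L_\pi(d_1,d_2,d_3,d_4)\,\mathsf w_\pi\,q^{|\pi|}=M(-q)^{\frac{(d_1\lambda_1+d_2\lambda_2+d_3\lambda_3+d_4\lambda_4)(-\lambda_1\lambda_2\lambda_3-\lambda_1\lambda_2\lambda_4-\lambda_1\lambda_3\lambda_4-\lambda_2\lambda_3\lambda_4)}{\lambda_1\lambda_2\lambda_3\lambda_4}}$$ holds modulo $q^7$ in $K(d_1,d_2,d_3,d_4)[\![q]\!]$, the sum being over all solid partitions, and this choice of signs is unique for the solid partitions of size at most $6$. Here $f^c=\sum_{k\ge0}\binom{c}{k}(f-1)^k$ for a power series $f$ in $q$ with constant term $1$. -/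

import Mathlib

open scoped BigOperators

/-- A solid partition, with the indices `i, j, k` shifted to start at `0`: a family of natural
numbers `parts (i, j, k)`, weakly decreasing in each index, of finite total sum (equivalently, of
finite support). -/
@[ext]
structure SolidPartition where
  parts : ℕ × ℕ × ℕ →₀ ℕ
  anti₁ : ∀ i j k, parts (i + 1, j, k) ≤ parts (i, j, k)
  anti₂ : ∀ i j k, parts (i, j + 1, k) ≤ parts (i, j, k)
  anti₃ : ∀ i j k, parts (i, j, k + 1) ≤ parts (i, j, k)

namespace SolidPartition

/-- The size `|π| = ∑ π_{ijk}`. -/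
def size (π : SolidPartition) : ℕ := π.parts.sum fun _ m => m

theorem lt_size_of_chain (π : SolidPartition) (g : ℕ → ℕ × ℕ × ℕ) (hg : Function.Injective g)
    (hanti : ∀ a, π.parts (g (a + 1)) ≤ π.parts (g a)) (a : ℕ) (ha : π.parts (g a) ≠ 0) :
    a < π.size := by
  have hmono : Antitone fun b => π.parts (g b) := antitone_nat_of_succ_le hanti
  have hpos : ∀ b ∈ Finset.range (a + 1), 1 ≤ π.parts (g b) := fun b hb =>
    (Nat.one_le_iff_ne_zero.mpr ha).trans (hmono (by simpa [Nat.lt_succ_iff] using hb))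
  have hsub : (Finset.range (a + 1)).image g ⊆ π.parts.support := by
    intro p hp
    obtain ⟨b, hb, rfl⟩ := Finset.mem_image.mp hp
    exact Finsupp.mem_support_iff.mpr (Nat.one_le_iff_ne_zero.mp (hpos b hb))
  have h1 : a + 1 ≤ ∑ p ∈ (Finset.range (a + 1)).image g, π.parts p := by
    rw [Finset.sum_image fun x _ y _ h => hg h]
    simpa using Finset.card_nsmul_le_sum (Finset.range (a + 1)) _ 1 hpos
  exact h1.trans (Finset.sum_le_sum_of_subset hsub)

/-- There are finitely many solid partitions of a given size. -/
theorem finite_size_eq (n : ℕ) : Finite {π : SolidPartition // π.size = n} := by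
  let B : Finset (ℕ × ℕ × ℕ) := Finset.range n ×ˢ Finset.range n ×ˢ Finset.range n
  have key : ∀ π : {π : SolidPartition // π.size = n},
      π.1.parts ∈ Finset.finsuppAntidiag B n := by
    rintro ⟨π, rfl⟩
    have hsub : π.parts.support ⊆ B := by
      rintro ⟨i, j, k⟩ h
      have h' := Finsupp.mem_support_iff.mp h
      have h1 := π.lt_size_of_chain (fun a => (a, j, k)) (fun x y h => by simpa using h)
        (fun a => π.anti₁ a j k) i h'
      have h2 := π.lt_size_of_chain (fun a => (i, a, k)) (fun x y h => by simpa using h)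
        (fun a => π.anti₂ i a k) j h'
      have h3 := π.lt_size_of_chain (fun a => (i, j, a)) (fun x y h => by simpa using h)
        (fun a => π.anti₃ i j a) k h'
      simp [B, h1, h2, h3]
    rw [Finset.mem_finsuppAntidiag]
    refine ⟨?_, hsub⟩
    exact (Finset.sum_subset hsub fun p _ hp => Finsupp.notMem_support_iff.mp hp).symm
  refine Finite.of_injective
    (fun π => (⟨π.1.parts, key π⟩ : {f // f ∈ Finset.finsuppAntidiag B n})) ?_
  intro π ρ h
  exact Subtype.ext (SolidPartition.ext (congrArg Subtype.val h))

noncomputable instance (n : ℕ) : Fintype {π : SolidPartition // π.size = n} :=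
  @Fintype.ofFinite _ (finite_size_eq n)

end SolidPartition

/-- Characters of `(ℂ^*)^4`: the Laurent polynomial ring `ℤ[t₁^±, t₂^±, t₃^±, t₄^±]`. -/
abbrev Laurent4 : Type := AddMonoidAlgebra ℤ (Fin 4 → ℤ)

/-- Characters of the torus `T = {t₁ t₂ t₃ t₄ = 1}`, whose character lattice `ℤ⁴ / ℤ(1,1,1,1)` is
identified with `ℤ³` by eliminating `t₄ = (t₁ t₂ t₃)⁻¹`. -/
abbrev Laurent3 : Type := AddMonoidAlgebra ℤ (Fin 3 → ℤ)

namespace Laurent4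

/-- The monomial `t^w`. -/
noncomputable def mono (w : Fin 4 → ℤ) : Laurent4 := AddMonoidAlgebra.single w 1

/-- The involution `t^w ↦ t^{-w}`. -/
noncomputable def bar (f : Laurent4) : Laurent4 := AddMonoidAlgebra.mapDomain (fun w => -w) f

/-- Specialization `t₁ t₂ t₃ t₄ = 1`, i.e. restriction of characters to `T`. -/
noncomputable def toT (f : Laurent4) : Laurent3 :=
  AddMonoidAlgebra.mapDomain (fun w (i : Fin 3) => w i.castSucc - w 3) f

end Laurent4

/-- The field `ℚ(λ₁, λ₂, λ₃, λ₄) / (λ₁ + λ₂ + λ₃ + λ₄)`, i.e. the fraction field of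
`ℚ[λ₁, λ₂, λ₃, λ₄] / (λ₁ + λ₂ + λ₃ + λ₄) ≅ ℚ[λ₁, λ₂, λ₃]`. -/
abbrev LamField : Type := FractionRing (MvPolynomial (Fin 3) ℚ)

/-- The classes `λ₁, λ₂, λ₃` and `λ₄ = -(λ₁ + λ₂ + λ₃)`. -/
noncomputable def lam : Fin 4 → LamField :=
  Fin.snoc (fun i : Fin 3 => algebraMap (MvPolynomial (Fin 3) ℚ) LamField (MvPolynomial.X i))
    (-∑ i : Fin 3, algebraMap (MvPolynomial (Fin 3) ℚ) LamField (MvPolynomial.X i))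

/-- The field `(ℚ(λ₁, λ₂, λ₃, λ₄) / (λ₁ + λ₂ + λ₃ + λ₄))(d₁, d₂, d₃, d₄)`. -/
abbrev LamDField : Type := FractionRing (MvPolynomial (Fin 4) LamField)

/-- `λ_i` as an element of the larger field. -/
noncomputable def lamD (i : Fin 4) : LamDField := algebraMap LamField LamDField (lam i)

/-- The variable `d_i`. -/
noncomputable def dvar (i : Fin 4) : LamDField :=
  algebraMap (MvPolynomial (Fin 4) LamField) LamDField (MvPolynomial.X i)

/-- The equivariant Euler class of a virtual `T`-representation `∑ m_w t^w`, namely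
`∏ c₁(t^w)^{m_w}` with `c₁(t^w) = w₁ λ₁ + w₂ λ₂ + w₃ λ₃`. In particular it vanishes if the
trivial weight has positive multiplicity. -/
noncomputable def eulerT (W : Laurent3) : LamField :=
  W.coeff.prod fun w m => (∑ i : Fin 3, (w i : LamField) * lam i.castSucc) ^ m

namespace SolidPartition

/-- The weights of the boxes of `π`: the vectors `(i-1, j-1, k-1, l-1)` with `1 ≤ l ≤ π_{ijk}`. -/
def box (p : ℕ × ℕ × ℕ) (l : ℕ) : Fin 4 → ℤ := ![(p.1 : ℤ), (p.2.1 : ℤ), (p.2.2 : ℤ), (l : ℤ)]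

/-- The character `Z_π = ∑_{i,j,k} ∑_{l=1}^{π_{ijk}} t₁^{i-1} t₂^{j-1} t₃^{k-1} t₄^{l-1}`. -/
noncomputable def charZ (π : SolidPartition) : Laurent4 :=
  π.parts.sum fun p m => ∑ l ∈ Finset.range m, Laurent4.mono (box p l)

/-- The equivariant vertex
`V_π = Z + Z̄ / (t₁t₂t₃t₄) - Z Z̄ (1-t₁)(1-t₂)(1-t₃)(1-t₄) / (t₁t₂t₃t₄)`. -/
noncomputable def vertex (π : SolidPartition) : Laurent4 :=
  π.charZ + π.charZ.bar * Laurent4.mono (fun _ => -1)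
    - π.charZ * π.charZ.bar * (∏ i : Fin 4, (1 - Laurent4.mono (Pi.single i 1)))
      * Laurent4.mono (fun _ => -1)

/-- The class `(-1)^{|π|} e_T(-V_π)`, whose square roots are the two values `± w_π`. -/
noncomputable def weightSq (π : SolidPartition) : LamField :=
  (-1) ^ π.size * eulerT (-(π.vertex.toT))

/-- The insertion `L_π(d₁,d₂,d₃,d₄)`: the Euler class of
`∑_{i,j,k} ∑_{l=1}^{π_{ijk}} t₁^{d₁+i-1} t₂^{d₂+j-1} t₃^{d₃+k-1} t₄^{d₄+l-1}`. -/
noncomputable def insertion (π : SolidPartition) : LamDField :=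
  π.parts.prod fun p m => ∏ l ∈ Finset.range m,
    ∑ i : Fin 4, (dvar i + (box p l i : LamDField)) * lamD i

/-- The series `∑_π L_π(d₁,d₂,d₃,d₄) w_π q^{|π|}` over all solid partitions, for given weights. -/
noncomputable def genSeries (w : SolidPartition → LamField) : PowerSeries LamDField :=
  PowerSeries.mk fun n => ∑ π : {π : SolidPartition // π.size = n},
    π.1.insertion * algebraMap LamField LamDField (w π.1)

end SolidPartition

/-- The MacMahon function `M(q) = ∏_{m ≥ 1} (1 - q^m)^{-m}`; the factors with `m > n` do not
affect the coefficient of `q^n`. -/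
noncomputable def macMahon (F : Type*) [Field F] : PowerSeries F :=
  PowerSeries.mk fun n => PowerSeries.coeff n
    (∏ m ∈ Finset.Icc 1 n, ((1 - PowerSeries.X ^ m : PowerSeries F)⁻¹) ^ m)

/-- The power `f^c = ∑_k (c choose k) (f - 1)^k` of a power series `f` with constant term `1`, for
an exponent `c` in a field of characteristic zero; the terms with `k > n` do not affect the
coefficient of `q^n`. -/
noncomputable def seriesPow {F : Type*} [Field F] (f : PowerSeries F) (c : F) : PowerSeries F :=
  PowerSeries.mk fun n => ∑ k ∈ Finset.range (n + 1),
    ((∏ i ∈ Finset.range k, (c - (i : F))) / (k.factorial : F)) * PowerSeries.coeff n ((f - 1) ^ k)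

/-- The exponent
`(d₁λ₁+d₂λ₂+d₃λ₃+d₄λ₄)(-λ₁λ₂λ₃-λ₁λ₂λ₄-λ₁λ₃λ₄-λ₂λ₃λ₄) / (λ₁λ₂λ₃λ₄)`. -/
noncomputable def macMahonExponent : LamDField :=
  (dvar 0 * lamD 0 + dvar 1 * lamD 1 + dvar 2 * lamD 2 + dvar 3 * lamD 3)
    * (-(lamD 0 * lamD 1 * lamD 2) - lamD 0 * lamD 1 * lamD 3 - lamD 0 * lamD 2 * lamD 3
        - lamD 1 * lamD 2 * lamD 3)
    / (lamD 0 * lamD 1 * lamD 2 * lamD 3)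

/-- The series `M(-q)^c`, where `c` is the exponent above. -/
noncomputable def macMahonSide : PowerSeries LamDField :=
  seriesPow (PowerSeries.evalNegHom (macMahon LamDField)) macMahonExponent

/-- The signs `ε`, applied to the weights `w`, make the identity
`∑_π L_π w_π q^{|π|} = M(-q)^c` true modulo `q^N`. -/
def SignsWork (N : ℕ) (w : SolidPartition → LamField) (ε : SolidPartition → ℤˣ) : Prop :=
  (PowerSeries.X : PowerSeries LamDField) ^ N ∣
    SolidPartition.genSeries (fun π => ((ε π : ℤ) : LamField) * w π) - macMahonSide

/-! Square roots. Put P = (1-t₁⁻¹)(1-t₂⁻¹)(1-t₃⁻¹). On T the product (1-t₁)(1-t₂)(1-t₃)(1-t₄) equals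
P + P̄, so -V_π = W + W̄ with W = -Z + P Z Z̄ (`restrict_prod`, `IsSmall.neg_vertex`). Dualizing
multiplies an Euler class by (-1)^rank, and W has rank -|π|. Since W contains no trivial weight
(checked for |π| ≤ 6), (-1)^|π| e_T(-V_π) = e_T(W)² (`eulerT_add_dual`). The root used is (-1)^μ
e_T(W), where μ is |π| plus the number of boxes (a,a,a,l) with a < l.

Identity. Let x, y, z = λ₁, λ₂, λ₃ and s = ∑ d_i λ_i. Both L_π w_π and the exponent -r, with r =
s(x+y)(x+z)(y+z)/(xyz(x+y+z)), are up to sign products of powers of integer linear forms in x, y, z,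
s. For 1 ≤ n ≤ 6 the coefficient of q^n, times n!, becomes the vanishing of a finite sum of such
products. Its numerator N over a common denominator is a homogeneous integer polynomial, and N = 0
is reduced to integer arithmetic in two ways: - An integer polynomial vanishes if it vanishes at an
integer exceeding its ℓ¹ norm (`eq_zero_of_eval_eq_zero`). This replaces y by a large B and s by a
still larger S, with z = 1 by homogeneity. - N(x, B, 1, s) has degree less than D in x, and it is
shown to vanish at D distinct zeros of linear forms ax + by + cz occurring in the sum. At such a
zero every term that keeps a positive power of the form drops out, so only the few surviving terms
have to cancel (`survivors_spec`). `Bounded.numer_eq_zero` combines both.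

Uniqueness. If another choice of signs also satisfied the identity in degree n, half the difference
would be a relation ∑ δ_π X_π = 0 with δ_π ∈ {0, 1, -1}, where the X_π are products of linear forms.
Clear denominators and evaluate at an integer point. If a number M divides all values but one, the
δ_π of the exceptional term is 0, and that term can be removed. Repeating this at suitable points
removes all terms (`strip_spec`, `eq_zero_of_checkRows`).

The finite computations are Boolean functions evaluated by the kernel, each with a soundness proof.
Sums over solid partitions become sums over lists of boxes by `sum_solidPartition`. -/

namespace VertexTable

/-! ### Lists by recursors, which the kernel reduces quickly -/

section Lists
variable {α β : Type}

noncomputable def foldR (f : α → β → β) (b : β) (l : List α) : β :=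
  List.rec (motive := fun _ => β) b (fun a _ ih => f a ih) l

noncomputable def mapR (f : α → β) (l : List α) : List β := foldR (fun a acc => f a :: acc) [] l

noncomputable def app (l l' : List α) : List α := foldR List.cons l' l

noncomputable def filterR (p : α → Bool) (l : List α) : List α :=
  foldR (fun a acc => cond (p a) (a :: acc) acc) [] l

noncomputable def len (l : List α) : ℕ := foldR (fun _ n => Nat.succ n) 0 l

noncomputable def all (p : α → Bool) (l : List α) : Bool :=
  foldR (fun a acc => cond (p a) acc false) true l

noncomputable def pairwiseR (r : α → α → Bool) (l : List α) : Bool :=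
  List.rec (motive := fun _ => Bool) true (fun a t ih => cond (all (r a) t) ih false) l

/-- Evaluates a numeral before it is passed on. -/
noncomputable def force (n : ℕ) (f : ℕ → β) : β :=
  Nat.rec (motive := fun _ => β) (f 0) (fun m _ => f (Nat.succ m)) n

end Lists

/-! ### Enumeration of solid partitions

The box `(i, j, k, l)` is encoded as `i + 8 j + 64 k + 512 l`. -/

noncomputable def mem (k : ℕ) (l : List ℕ) : Bool :=
  foldR (fun a ih => cond (Nat.beq a k) true ih) false l

noncomputable def supported (b : ℕ) (acc : List ℕ) : Bool :=
  (Nat.beq (b % 8) 0 || mem (b - 1) acc) && (Nat.beq (b / 8 % 8) 0 || mem (b - 8) acc) &&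
  (Nat.beq (b / 64 % 8) 0 || mem (b - 64) acc) && (Nat.beq (b / 512) 0 || mem (b - 512) acc)

/-- A box is admitted only when the boxes directly below it are present, and these have smaller
codes. Running through increasing candidates from the empty list, each solid partition with n boxes
among the candidates arises exactly once, as its decreasing list of codes. -/
noncomputable def enum (bs : List ℕ) : List ℕ → ℕ → List (List ℕ) :=
  List.rec (motive := fun _ => List ℕ → ℕ → List (List ℕ))
    (fun acc n => Nat.casesOn (motive := fun _ => List (List ℕ)) n [acc] (fun _ => []))
    (fun b _ ih acc n => Nat.casesOn (motive := fun _ => List (List ℕ)) n [acc] (fun m =>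
      app (cond (supported b acc) (ih (b :: acc) m) []) (ih acc (Nat.succ m)))) bs

/-- The boxes of degree at most `5`. -/
noncomputable def cand : List ℕ :=
  (List.range 2561).filter fun k => Nat.ble (k % 8 + k / 8 % 8 + k / 64 % 8 + k / 512) 5

/-! ### Characters

The weight `(a, b, c)` of `T` is encoded as `16912 + 1024 a + 32 b + c`, so that the digits in base
`32` are `a + 16`, `b + 16`, `c + 16`. A character is a list of weights with multiplicities. -/

abbrev VL := List (ℕ × ℤ)

/-- Eliminating t₄ gives the box (i, j, k, l) the weight (i - l, j - l, k - l); 1057 = 1024 + 32 + 1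
lowers all three digits by one. -/
noncomputable def wt (b : ℕ) : ℕ :=
  Nat.sub (16912 + (b % 8) * 1024 + (b / 8 % 8) * 32 + (b / 64 % 8)) ((b / 512) * 1057)

noncomputable def consNZ (k : ℕ) (e : ℤ) (l : VL) : VL :=
  Int.casesOn (motive := fun _ => VL) e
    (fun n => Nat.casesOn (motive := fun _ => VL) n l (fun _ => (k, e) :: l))
    (fun _ => (k, e) :: l)

/-- A merge of lists sorted by code, dropping cancelled entries. Sortedness only serves to bring
equal codes together; the additivity proved in `vsum_madd` holds for arbitrary lists. -/
noncomputable def madd (l : VL) : VL → VL :=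
  List.rec (motive := fun _ => VL → VL) (fun l' => l') (fun p t ih l' =>
    List.rec (motive := fun _ => VL) (p :: t) (fun q u ihu =>
      cond (Nat.ble p.1 q.1)
        (cond (Nat.beq p.1 q.1) (consNZ p.1 (Int.add p.2 q.2) (ih u)) (p :: ih (q :: u)))
        (q :: ihu)) l') l

noncomputable def shift (z : ℕ) (l : VL) : VL :=
  mapR (fun p => (Nat.sub (Nat.add p.1 z) 16912, p.2)) l

/-- `(1 - t₁⁻¹)(1 - t₂⁻¹)(1 - t₃⁻¹)`. -/
def pbar : VL :=
  [(15855, -1), (15856, 1), (15887, 1), (15888, -1), (16879, 1), (16880, -1), (16911, -1),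
    (16912, 1)]

/-- The factor (1 - t₁⁻¹)(1 - t₂⁻¹)(1 - t₃⁻¹) Z̄, isolated so that multiplying by Z takes one shift
per box. Since 33824 = 2 · 16912, subtraction from it negates a weight. -/
noncomputable def yL (A : List ℕ) : VL :=
  foldR (fun b acc => madd (shift (Nat.sub 33824 (wt b)) pbar) acc) [] A

/-- The character `-v = - Z + (1 - t₁⁻¹)(1 - t₂⁻¹)(1 - t₃⁻¹) Z Z̄`, for which `v + v̄` is the
vertex. -/
noncomputable def wL (A : List ℕ) : VL :=
  foldR (fun b acc => madd ((wt b, -1) :: []) (madd (shift (wt b) (yL A)) acc)) [] A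

/-- The code 16912 is the trivial weight. Its absence from W makes all first Chern classes in the
Euler class nonzero. -/
noncomputable def checkFixed (n : ℕ) : Bool :=
  all (fun A => all (fun p => Bool.not (Nat.beq p.1 16912)) (wL A)) (enum cand [] n)

/-! ### Products of linear forms

A linear form `a x + b y + c z + d s` with `d ∈ {0, 1}` is encoded as the code of `(a, b, c)`,
increased by `32768` if `d = 0`. A list of codes with multiplicities stands for a product of powers
of linear forms. -/

noncomputable def dig (n : ℕ) : ℤ := Int.subNatNat (Nat.mod n 32) 16

noncomputable def content (k : ℕ) : ℕ :=
  Nat.gcd (Int.natAbs (dig (Nat.div k 1024)))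
    (Nat.gcd (Int.natAbs (dig (Nat.div k 32))) (Int.natAbs (dig k)))

/-- Multiplies by a power of a linear form without `s`, split into its content and its primitive
part. The content `g` is written as the quotient of the forms `g z` and `z`. -/
noncomputable def insPos (k : ℕ) (e : ℤ) (acc : VL) : VL :=
  (fun g => cond (Nat.beq g 1) (madd [(Nat.add k 32768, e)] acc)
    (madd [(Nat.add (Nat.div (Nat.sub k 16912) g) 49680, e)]
      (madd [(Nat.add g 49680, e)] (madd [(49681, Int.neg e)] acc)))) (content k)

/-- A code of at most 16912 belongs to a form whose first nonzero coefficient is negative (or to the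
zero form); it is replaced by the opposite form, and `negDeg` records the sign. Together with the
splitting of contents in `insPos`, proportional forms share one primitive form, which keeps the
common denominator small. -/
noncomputable def canon (l : VL) : VL :=
  foldR (fun p acc => cond (Nat.ble p.1 16912) (insPos (Nat.sub 33824 p.1) p.2 acc)
    (insPos p.1 p.2 acc)) [] l

noncomputable def negDeg (l : VL) : ℕ :=
  foldR (fun p acc => cond (Nat.ble p.1 16912) (Nat.add (Int.natAbs p.2) acc) acc) 0 l

noncomputable def sL (A : List ℕ) (l : VL) : VL :=
  foldR (fun b acc => madd [(wt b, 1)] acc) l A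

noncomputable def diag (b : ℕ) : Bool :=
  Nat.beq (b % 8) (b / 8 % 8) && Nat.beq (b % 8) (b / 64 % 8) && Nat.blt (b % 8) (b / 512)

/-- The sign rule: one for each box and one more for each box (a, a, a, l) with a < l. That this is
the correct sign is not derived from geometry; it is a consequence of the checked identities. -/
noncomputable def mu (A : List ℕ) : ℕ :=
  foldR (fun b acc => cond (diag b) (acc + 2) (acc + 1)) 0 A

noncomputable def sgn (n : ℕ) : ℤ := cond (Nat.beq (Nat.mod n 2) 0) 1 (-1)

/-- The identity map; it turns the entries into numerals before the row is used many times. -/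
noncomputable def forceVL (l : VL) : VL :=
  foldR (fun p acc => force p.1 fun k =>
    Int.casesOn (motive := fun _ => VL) p.2 (fun n => force n fun n => (k, Int.ofNat n) :: acc)
      (fun n => force n fun n => (k, Int.negSucc n) :: acc)) [] l

noncomputable def prodL (A : List ℕ) : VL := forceVL (sL A (canon (wL A)))

abbrev Row := ℤ × VL

noncomputable def term (f : ℤ) (A : List ℕ) : Row :=
  (Int.mul f (sgn (Nat.add (mu A) (negDeg (wL A)))), prodL A)

/-- The `k`-th power of `s (x + y) (x + z) (y + z) / (x y z (x + y + z))`. -/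
def rhsList (k : ℤ) : VL :=
  [(16912, k), (49681, -k), (49712, -k), (49713, k), (50704, -k), (50705, k), (50736, k),
    (50737, -k)]

noncomputable def rhsRows (l : List ℤ) : ℤ → List Row :=
  List.rec (motive := fun _ => ℤ → List Row) (fun _ => [])
    (fun c _ ih k => (c, rhsList k) :: ih (Int.add k 1)) l

noncomputable def boxRows (n : ℕ) : List Row :=
  mapR (term (Int.ofNat n.factorial)) (enum cand [] n)

/-! ### Common denominators -/

/-- Forms occurring only in numerators are listed too, with exponent 0, since their zeros can also
serve as zeros of the total numerator. Nothing is proved about the result: that it clears all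
denominators is tested by `dense`. -/
noncomputable def lcmM (l : VL) : List (ℕ × ℕ) → List (ℕ × ℕ) :=
  List.rec (motive := fun _ => List (ℕ × ℕ) → List (ℕ × ℕ)) (fun l' => l') (fun p _ ih l' =>
    List.rec (motive := fun _ => List (ℕ × ℕ)) ((p.1, Int.toNat (Int.neg p.2)) :: ih [])
      (fun q u ihu => cond (Nat.ble p.1 q.1)
        (cond (Nat.beq p.1 q.1) ((p.1, max (Int.toNat (Int.neg p.2)) q.2) :: ih u)
          ((p.1, Int.toNat (Int.neg p.2)) :: ih (q :: u))) (q :: ihu)) l') l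

noncomputable def lcmL (rs : List Row) : List (ℕ × ℕ) := foldR (fun t acc => lcmM t.2 acc) [] rs

/-- The exponents of the forms of `G` in the product of `l` with the common denominator `G`. -/
noncomputable def dense (G : List (ℕ × ℕ)) : VL → Option (List ℕ) :=
  List.rec (motive := fun _ => VL → Option (List ℕ))
    (fun l => List.casesOn (motive := fun _ => Option (List ℕ)) l (some []) (fun _ _ => none))
    (fun g _ ih l => List.casesOn (motive := fun _ => Option (List ℕ)) l
      (Option.map (List.cons g.2) (ih [])) (fun p t =>
        cond (Nat.beq g.1 p.1)
          (Int.casesOn (motive := fun _ => Option (List ℕ)) (Int.add (Int.ofNat g.2) p.2)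
            (fun n => Option.map (List.cons n) (ih t)) (fun _ => none))
          (Option.map (List.cons g.2) (ih (p :: t))))) G

noncomputable def zipSum (G : List (ℕ × ℕ)) : (ℕ → Bool) → List ℕ → ℕ := fun f =>
  List.rec (motive := fun _ => List ℕ → ℕ) (fun _ => 0) (fun g _ ih es =>
    List.casesOn (motive := fun _ => ℕ) es 0
      (fun e es' => cond (f g.1) (Nat.add e (ih es')) (ih es'))) G

/-- `v ^ e * acc` -/
noncomputable def pw (v acc e : ℕ) : ℕ :=
  Nat.rec (motive := fun _ => ℕ) acc (fun _ a => Nat.mul v a) e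

noncomputable def zipProd (G : List (ℕ × ℕ)) : (ℕ → ℕ) → List ℕ → ℕ := fun v =>
  List.rec (motive := fun _ => List ℕ → ℕ) (fun _ => 1) (fun g _ ih es =>
    List.casesOn (motive := fun _ => ℕ) es 1 (fun e es' => pw (v g.1) (ih es') e)) G

noncomputable def l1 (k : ℕ) : ℕ :=
  Nat.add (cond (Nat.blt k 32768) 1 0) (Nat.add (Int.natAbs (dig (Nat.div k 1024)))
    (Nat.add (Int.natAbs (dig (Nat.div k 32))) (Int.natAbs (dig k))))

noncomputable def hasX (k : ℕ) : Bool := Bool.not (Nat.beq (Nat.mod (Nat.div k 1024) 32) 16)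

/-- A bound for the sum of the absolute values of the coefficients of the numerator. -/
noncomputable def height (G : List (ℕ × ℕ)) (rs : List Row) : ℕ :=
  foldR (fun r acc => Option.casesOn (motive := fun _ => ℕ) (dense G r.2) acc
    (fun es => Nat.add (Nat.mul (Int.natAbs r.1) (zipProd G l1 es)) acc)) 0 rs

noncomputable def covered (G : List (ℕ × ℕ)) (d D : ℕ) (rs : List Row) : Bool :=
  all (fun r => Option.casesOn (motive := fun _ => Bool) (dense G r.2) false
    (fun es => Nat.beq (zipSum G (fun _ => true) es) d && Nat.blt (zipSum G hasX es) D)) rs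

/-! ### Evaluation -/

/-- A point `(xp - xn, y, z, s)`. -/
structure Pt where
  xp : ℕ
  xn : ℕ
  y : ℕ
  z : ℕ
  s : ℕ

/-- To stay in ℕ, the value of a form is split as `evP - evN`. The digits are stored with offset 16,
and the contributions of this offset are moved to the other side. -/
noncomputable def evP (P : Pt) (k : ℕ) : ℕ :=
  Nat.add (cond (Nat.blt k 32768) P.s 0)
    (Nat.add (Nat.add (Nat.mul (Nat.mod (Nat.div k 1024) 32) P.xp) (Nat.mul 16 P.xn))
      (Nat.add (Nat.mul (Nat.mod (Nat.div k 32) 32) P.y) (Nat.mul (Nat.mod k 32) P.z)))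

noncomputable def evN (P : Pt) (k : ℕ) : ℕ :=
  Nat.add (Nat.add (Nat.mul (Nat.mod (Nat.div k 1024) 32) P.xn) (Nat.mul 16 P.xp))
    (Nat.mul 16 (Nat.add P.y P.z))

noncomputable def evAbs (P : Pt) (k : ℕ) : ℕ :=
  Nat.add (Nat.sub (evP P k) (evN P k)) (Nat.sub (evN P k) (evP P k))

noncomputable def evNeg (P : Pt) (k : ℕ) : Bool := Nat.blt (evP P k) (evN P k)

noncomputable def numOf (v : ℕ → ℕ) (l : VL) : ℕ :=
  foldR (fun p acc => Int.casesOn (motive := fun _ => ℕ) p.2 (fun n => pw (v p.1) acc n)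
    (fun _ => acc)) 1 l

noncomputable def denOf (v : ℕ → ℕ) (l : VL) : ℕ :=
  foldR (fun p acc => Int.casesOn (motive := fun _ => ℕ) p.2 (fun _ => acc)
    (fun n => pw (v p.1) acc (Nat.succ n))) 1 l

noncomputable def parOf (ng : ℕ → Bool) (l : VL) : ℕ :=
  foldR (fun p acc => cond (ng p.1) (Nat.add (Int.natAbs p.2) acc) acc) 0 l

noncomputable def lcmVal (v : ℕ → ℕ) (G : List (ℕ × ℕ)) : ℕ :=
  foldR (fun g acc => pw (v g.1) acc g.2) 1 G

/-- The division is exact if L is the value of a common denominator accepted by `dense` and no form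
in the denominator of the row vanishes; see `quo_eq`. -/
noncomputable def quo (L : ℕ) (v : ℕ → ℕ) (l : VL) : ℕ :=
  Nat.div (Nat.mul L (numOf v l)) (denOf v l)

noncomputable def isNeg (c : ℤ) : Bool :=
  Int.casesOn (motive := fun _ => Bool) c (fun _ => false) (fun _ => true)

noncomputable def oddR (n : ℕ) : Bool := Nat.beq (Nat.mod n 2) 1

/-- The sum of the absolute values of the negative terms (for `b = false`) or of the other terms
(for `b = true`). -/
noncomputable def signedSum (b : Bool) (L : ℕ) (v : ℕ → ℕ) (ng : ℕ → Bool) (rs : List Row) : ℕ :=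
  foldR (fun r acc => cond (Bool.xor b (Bool.xor (oddR (parOf ng r.2)) (isNeg r.1)))
    (Nat.add (Nat.mul (Int.natAbs r.1) (quo L v r.2)) acc) acc) 0 rs

noncomputable def vanish (L : ℕ) (v : ℕ → ℕ) (ng : ℕ → Bool) (rs : List Row) : Bool :=
  all (fun r => Nat.blt 0 (denOf v r.2)) rs &&
    Nat.beq (signedSum true L v ng rs) (signedSum false L v ng rs)

/-! ### Vanishing at the zeros of the linear forms -/

/-- Coefficient, full list, and the part of the list not yet reached while walking through the
common denominator. The head of the tail shows the exponent of the current form without a search. -/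
abbrev TailRow := ℤ × VL × VL

/-- The rows in which the exponent of the form `g` is `0` after multiplication with the common
denominator; the rows with a positive exponent vanish at the zero of `g`. -/
noncomputable def survivors (g : ℕ × ℕ) (rs : List TailRow) : List Row :=
  foldR (fun r acc => List.casesOn (motive := fun _ => List Row) r.2.2
    (Nat.casesOn (motive := fun _ => List Row) g.2 ((r.1, r.2.1) :: acc) (fun _ => acc))
    (fun p _ => cond (Nat.beq g.1 p.1)
      (Nat.casesOn (motive := fun _ => List Row) (Int.natAbs (Int.add (Int.ofNat g.2) p.2))
        ((r.1, r.2.1) :: acc) (fun _ => acc))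
      (Nat.casesOn (motive := fun _ => List Row) g.2 ((r.1, r.2.1) :: acc) (fun _ => acc)))) [] rs

noncomputable def advance (g : ℕ) (rs : List TailRow) : List TailRow :=
  mapR (fun r => (r.1, r.2.1, List.casesOn (motive := fun _ => VL) r.2.2 []
    (fun p t => cond (Nat.beq g p.1) t (p :: t)))) rs

/-- The zero `x = -(b B + c) / a`, `y = B`, `z = 1` of a linear form, multiplied by `a`. -/
noncomputable def rootPt (B S k : ℕ) : Pt where
  -- The digits in `xn` carry the offset 16, which 16 (B + 1) compensates, so that `xp - xn` is -(b
  -- B + c).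
  xp := Nat.mul 16 (Nat.add B 1)
  xn := Nat.add (Nat.mul (Nat.mod (Nat.div k 32) 32) B) (Nat.mod k 32)
  y := Nat.mul (Nat.sub (Nat.mod (Nat.div k 1024) 32) 16) B
  z := Nat.sub (Nat.mod (Nat.div k 1024) 32) 16
  s := S

noncomputable def isX (k : ℕ) : Bool := Nat.blt 16 (Nat.mod (Nat.div k 1024) 32) && Nat.ble 32768 k

/-- The value 1 stands in for the form k, which vanishes at the point. Surviving rows have exponent
0 at k after multiplication with the common denominator, so the substitute does not matter, and it
keeps the denominators nonzero. -/
noncomputable def except (k : ℕ) (v : ℕ → ℕ) (k' : ℕ) : ℕ := cond (Nat.beq k' k) 1 (v k')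

noncomputable def vanishAt (P : Pt) (k : ℕ) (G : List (ℕ × ℕ)) (rs : List Row) : Bool :=
  vanish (lcmVal (except k (evAbs P)) G) (except k (evAbs P)) (evNeg P) rs

/-- The forms with code in `[lo, hi)` at whose zeros the numerator has been found to vanish; zeros
with more than `τ` nonzero terms are not tried. -/
noncomputable def roots (τ lo hi B S : ℕ) (G suf : List (ℕ × ℕ)) : List TailRow → List ℕ :=
  List.rec (motive := fun _ => List TailRow → List ℕ) (fun _ => []) (fun g _ ih rs =>
    cond (Nat.ble lo g.1 && Nat.blt g.1 hi && isX g.1 &&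
        Nat.ble (len (survivors g rs)) τ && vanishAt (rootPt B S g.1) g.1 G (survivors g rs))
      (g.1 :: ih (advance g.1 rs)) (ih (advance g.1 rs))) suf

/-- The fractions (xp - xn) / z are compared by cross multiplication, with the subtracted terms
moved to the other side. -/
noncomputable def distinctRoots (B : ℕ) (ks : List ℕ) : Bool :=
  pairwiseR (fun k k' => Bool.not (Nat.beq
    (Nat.add (Nat.mul (rootPt B 0 k).z (rootPt B 0 k').xn)
      (Nat.mul (rootPt B 0 k').z (rootPt B 0 k).xp))
    (Nat.add (Nat.mul (rootPt B 0 k').z (rootPt B 0 k).xn)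
      (Nat.mul (rootPt B 0 k).z (rootPt B 0 k').xp)))) ks

noncomputable def nonzeroForm (k : ℕ) : Bool :=
  Nat.blt k 32768 || Bool.not (Nat.beq (Nat.mod k 32768) 16912)

/-- Checks the hypotheses under which the sum of the rows vanishes as soon as its numerator vanishes
at `D` zeros of linear forms. -/
noncomputable def checkBounds (d D B S : ℕ) (G : List (ℕ × ℕ)) (rs : List Row) : Bool :=
  pairwiseR (fun g h => Nat.blt g.1 h.1) G && all (fun g => nonzeroForm g.1) G &&
    covered G d D rs && Nat.blt (height G rs) B &&
    Nat.blt (Nat.mul (height G rs) (Nat.pow (Nat.mul 32 B) d)) S &&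
    distinctRoots B (filterR isX (mapR Prod.fst G))

noncomputable def allRows (n : ℕ) (cs : List ℤ) : List Row := app (rhsRows cs 1) (boxRows n)

noncomputable def checkTable (n : ℕ) (cs : List ℤ) (d D B S : ℕ) : Bool :=
  checkBounds d D B S (lcmL (allRows n cs)) (allRows n cs)

noncomputable def checkRoots (n : ℕ) (cs : List ℤ) (τ lo hi c B S : ℕ) : Bool :=
  Nat.ble c (len (roots τ lo hi B S (lcmL (allRows n cs)) (lcmL (allRows n cs))
    (mapR (fun r => (r.1, r.2, r.2)) (allRows n cs))))

/-! ### Independence -/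

abbrev URow := List ℕ × VL

/-- Removes rows whose value is, at this point, the only one not divisible by some number. -/
noncomputable def strip (p : ℕ) (fuel : ℕ) : List (ℕ × URow) → List (ℕ × URow) :=
  Nat.rec (motive := fun _ => List (ℕ × URow) → List (ℕ × URow)) (fun l => l) (fun _ ih l =>
    (fun M => cond (Nat.beq (len (filterR (fun q => Bool.not (Nat.beq (Nat.mod q.1 M) 0)) l)) 1)
      (ih (filterR (fun q => Nat.beq (Nat.mod q.1 M) 0) l)) l)
    (Nat.mul p (foldR (fun q g => Nat.gcd q.1 g) 0 l))) fuel

/-- A point at which some denominator vanishes is skipped, and at most 20 rows are removed at one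
point. Both restrictions can only leave more rows over, so soundness is unaffected. -/
noncomputable def stripAt (G : List (ℕ × ℕ)) (P : Pt) (p : ℕ) (rs : List URow) : List URow :=
  cond (all (fun r => Nat.blt 0 (denOf (evAbs P) r.2)) rs)
    (mapR Prod.snd (strip p 20
      (mapR (fun r => (quo (lcmVal (evAbs P) G) (evAbs P) r.2, r)) rs))) rs

noncomputable def stripAll (G : List (ℕ × ℕ)) (ps : List (Pt × ℕ)) : List URow → List URow :=
  List.rec (motive := fun _ => List URow → List URow) (fun l => l)
    (fun P _ ih l => ih (stripAt G P.1 P.2 l)) ps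

noncomputable def covers (G : List (ℕ × ℕ)) (rs : List URow) : Bool :=
  all (fun r => Option.casesOn (motive := fun _ => Bool) (dense G r.2) false (fun _ => true)) rs

noncomputable def checkRows (G : List (ℕ × ℕ)) (ps : List (Pt × ℕ)) (rs : List URow) : Bool :=
  all (fun g => nonzeroForm g.1) G && covers G rs && Nat.beq (len (stripAll G ps rs)) 0

noncomputable def uRows (n : ℕ) : List URow := mapR (fun A => (A, prodL A)) (enum cand [] n)

noncomputable def checkIndep (n : ℕ) (ps : List (Pt × ℕ)) : Bool :=
  checkRows (lcmL (mapR (fun r => (1, r.2)) (uRows n))) ps (uRows n)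

end VertexTable

/-! ### Kernel evaluation of the checks for sizes up to six. -/

namespace VertexTable

set_option exponentiation.threshold 1000000
set_option maxRecDepth 100000

theorem checkFixed_le : all checkFixed [0, 1, 2, 3, 4, 5, 6] = true := by
  decide +kernel

/-- In all these tables the list is `rhsCoeffs n`. It is followed by the degree d of the numerator,
a strict bound D for its degree in x, and powers of two with B > height and S > height · (32 B)^d.
The companion `checkRoots` has to find D zeros; its cap on the number of surviving rows merely
avoids expensive zeros. -/
theorem checkTable_one : checkTable 1 [-1] 4 3 (2 ^ 5) (2 ^ 46) = true := by
  decide +kernel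

theorem checkRoots_one :
    checkRoots 1 [-1] 8 0 65536 3 (2 ^ 5) (2 ^ 46) = true := by
  decide +kernel

theorem checkTable_two : checkTable 2 [5, -1] 15 10 (2 ^ 19) (2 ^ 380) = true := by
  decide +kernel

theorem checkRoots_two :
    checkRoots 2 [5, -1] 8 0 65536 10 (2 ^ 19) (2 ^ 380) = true := by
  decide +kernel

theorem checkTable_three : checkTable 3 [-20, 15, -1] 32 22 (2 ^ 51) (2 ^ 1844) = true := by
  decide +kernel

theorem checkRoots_three :
    checkRoots 3 [-20, 15, -1] 11 0 65536 22 (2 ^ 51) (2 ^ 1844) = true := by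
  decide +kernel

theorem checkTable_four : checkTable 4 [126, -155, 30, -1] 69 49 (2 ^ 120) (2 ^ 8746) = true := by
  decide +kernel

theorem checkRoots_four :
    checkRoots 4 [126, -155, 30, -1] 27 0 65536 49 (2 ^ 120) (2 ^ 8746) = true := by
  decide +kernel

theorem checkTable_five : checkTable 5 [-624, 1630, -575, 50, -1] 114 81 (2 ^ 222) (2 ^ 26101) = true := by
  decide +kernel

theorem checkRoots_five :
    checkRoots 5 [-624, 1630, -575, 50, -1] 55 0 65536 81 (2 ^ 222) (2 ^ 26101) = true := by
  decide +kernel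

/-- Each entry is a point (xp, xn, y, z, s) together with the factor by which the gcd of the values
is multiplied to obtain the modulus. These are witnesses; only the outcome of the elimination
matters. -/
theorem checkIndep_zero : checkIndep 0 [(⟨1, 0, 1, 1, 1⟩, 3)] = true := by
  decide +kernel

theorem checkIndep_one : checkIndep 1 [(⟨1, 0, 1, 1, 1⟩, 3)] = true := by
  decide +kernel

theorem checkIndep_two : checkIndep 2 [(⟨165, 0, 79, 31, 4649⟩, 3)] = true := by
  decide +kernel

theorem checkIndep_three : checkIndep 3 [(⟨108, 0, 164, 112, 6449⟩, 3)] = true := by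
  decide +kernel

theorem checkIndep_four :
    checkIndep 4 [(⟨0, 3623, 8875, 122, 3598⟩, 5), (⟨270, 0, 165, 193, 709⟩, 3),
      (⟨255, 0, 252, 519, 12603⟩, 3), (⟨596, 0, 837, 50, 1484⟩, 3)] = true := by
  decide +kernel

theorem checkIndep_five :
    checkIndep 5 [(⟨0, 191, 106, 166, 218⟩, 3), (⟨0, 76, 247, 243, 161⟩, 3),
      (⟨0, 1231, 1875, 622, 1106⟩, 5), (⟨0, 135, 188, 161, 325⟩, 3), (⟨0, 115, 77, 50, 436⟩, 3),
      (⟨0, 80, 75, 89, 238⟩, 3), (⟨0, 5149, 1374, 4120, 5765146⟩, 7),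
      (⟨0, 124, 483030, 160563, 2786⟩, 11), (⟨632, 0, 1258, 1874, 639⟩, 5),
      (⟨0, 144, 19, 387, 15238⟩, 5)] = true := by
  decide +kernel

theorem checkIndep_six :
    checkIndep 6 [(⟨0, 131, 162, 109, 221⟩, 3), (⟨0, 112, 57, 136, 244⟩, 3),
      (⟨0, 1246, 625, 752, 3256⟩, 5), (⟨0, 714, 496, 243, 704⟩, 3), (⟨83, 0, 92, 278, 343⟩, 3),
      (⟨27, 0, 80, 2, 838⟩, 3), (⟨81, 0, 67, 154, 4307⟩, 3),
      (⟨0, 160809, 160811, 483516, 658968⟩, 11), (⟨70, 0, 243, 83, 160⟩, 3),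
      (⟨9122, 0, 5752, 6376, 775498⟩, 5), (⟨4, 0, 14, 729, 740⟩, 3), (⟨104, 0, 165, 838, 521⟩, 3),
      (⟨0, 729, 239, 352, 2⟩, 3), (⟨39930, 0, 17303, 2664, 119792⟩, 11),
      (⟨731, 0, 720, 729, 4306⟩, 3), (⟨461, 0, 488, 702, 1732⟩, 3),
      (⟨0, 18633, 9314, 3992, 316775⟩, 11), (⟨0, 678, 219, 730, 1000⟩, 3),
      (⟨0, 482668, 483035, 483155, 3059967⟩, 11), (⟨77, 0, 134, 101, 142⟩, 3),
      (⟨9, 0, 251, 237, 77888⟩, 5), (⟨0, 35, 37, 57, 788⟩, 3), (⟨85, 0, 254, 231, 4143⟩, 3),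
      (⟨267, 0, 215, 521, 195⟩, 3), (⟨0, 79, 163, 25, 6398⟩, 3), (⟨79, 0, 89, 77, 4218⟩, 3),
      (⟨79, 0, 29, 2, 13064⟩, 3), (⟨239, 0, 241, 259, 390386⟩, 5), (⟨0, 61, 109, 62, 34⟩, 3)]
      = true := by
  decide +kernel

theorem checkTable_six : checkTable 6 [6000, -17194, 9765, -1525, 75, -1] 171 130 (2 ^ 362) (2 ^ 63120) = true := by
  decide +kernel

/-- For n = 6 the zeros are collected in three disjoint ranges of codes: 57 + 29 + 44 = 130 = D. -/
theorem checkRoots_six_low :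
    checkRoots 6 [6000, -17194, 9765, -1525, 75, -1] 140 0 51690 57 (2 ^ 362) (2 ^ 63120) = true := by
  decide +kernel

theorem checkRoots_six_mid :
    checkRoots 6 [6000, -17194, 9765, -1525, 75, -1] 140 51690 52700 29 (2 ^ 362) (2 ^ 63120) = true := by
  decide +kernel

theorem checkRoots_six_high :
    checkRoots 6 [6000, -17194, 9765, -1525, 75, -1] 140 52700 65536 44 (2 ^ 362) (2 ^ 63120) = true := by
  decide +kernel

end VertexTable

/-! ### Soundness of the checks, independently of solid partitions. -/

namespace VertexTable

/-! ### The recursors as the usual list functions -/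

section Lists
variable {α β : Type}

@[simp] theorem foldR_nil (f : α → β → β) (b : β) : foldR f b [] = b := rfl

theorem mapR_eq (f : α → β) (l : List α) : mapR f l = l.map f := by
  induction l with
  | nil => rfl
  | cons a l ih => simp only [List.map_cons, ← ih]; rfl

theorem app_eq (l l' : List α) : app l l' = l ++ l' := by
  induction l with
  | nil => rfl
  | cons a l ih => simp only [List.cons_append, ← ih]; rfl

theorem filterR_eq (p : α → Bool) (l : List α) : filterR p l = l.filter p := by
  induction l with
  | nil => rfl
  | cons a l ih =>
    have h : filterR p (a :: l) = cond (p a) (a :: filterR p l) (filterR p l) := rfl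
    rw [h, ih]; cases hp : p a <;> simp [hp]

theorem len_eq (l : List α) : len l = l.length := by
  induction l with
  | nil => rfl
  | cons a l ih =>
    have h : len (a :: l) = Nat.succ (len l) := rfl
    rw [h, ih]; rfl

theorem all_iff (p : α → Bool) (l : List α) : all p l = true ↔ ∀ a ∈ l, p a = true := by
  induction l with
  | nil => simp [all]
  | cons a l ih =>
    have h : all p (a :: l) = cond (p a) (all p l) false := rfl
    rw [h]; cases hp : p a <;> simp [hp, ih]

theorem pairwiseR_iff (r : α → α → Bool) (l : List α) :
    pairwiseR r l = true ↔ l.Pairwise fun a b => r a b = true := by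
  induction l with
  | nil => simp [pairwiseR]
  | cons a l ih =>
    have h : pairwiseR r (a :: l) = cond (all (r a) l) (pairwiseR r l) false := rfl
    have h' := all_iff (r a) l
    rw [h, List.pairwise_cons]
    cases hp : all (r a) l
    · simp only [cond_false, Bool.false_eq_true, false_iff]
      intro hh
      exact absurd (h'.2 hh.1) (by simp [hp])
    · simp only [cond_true, ih]
      exact ⟨fun hh => ⟨h'.1 hp, hh⟩, fun hh => hh.2⟩

theorem force_eq (n : ℕ) (f : ℕ → β) : force n f = f n := by
  cases n <;> rfl

end Lists

/-! ### The `ℓ¹` norm of integer polynomials -/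

/-- `ν` behaves as the sum of the absolute values of the coefficients of an integer polynomial. -/
structure IsL1 {R : Type*} [CommRing R] (ν : R → ℕ) : Prop where
  zero : ν 0 = 0
  one : ν 1 ≤ 1
  add : ∀ a b, ν (a + b) ≤ ν a + ν b
  mul : ∀ a b, ν (a * b) ≤ ν a * ν b
  intCast_mul : ∀ (n : ℤ) a, ν (n * a) = n.natAbs * ν a
  eq_zero : ∀ a, ν a = 0 → a = 0

theorem isL1_int : IsL1 Int.natAbs where
  zero := rfl
  one := le_rfl
  add := Int.natAbs_add_le
  mul a b := (Int.natAbs_mul a b).le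
  intCast_mul n a := by simp [Int.natAbs_mul]
  eq_zero a h := Int.natAbs_eq_zero.mp h

namespace IsL1

variable {R : Type*} [CommRing R] {ν : R → ℕ}

theorem intCast (h : IsL1 ν) (n : ℤ) : ν (n : R) ≤ n.natAbs := by
  have := h.intCast_mul n 1
  rw [mul_one] at this
  rw [this]
  exact (Nat.mul_le_mul_left _ h.one).trans (by simp)

theorem pow (h : IsL1 ν) (a : R) (n : ℕ) : ν (a ^ n) ≤ ν a ^ n := by
  induction n with
  | zero => simpa using h.one
  | succ n ih =>
    rw [pow_succ, pow_succ]
    exact (h.mul _ _).trans (Nat.mul_le_mul_right _ ih)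

theorem listSum (h : IsL1 ν) (l : List R) : ν l.sum ≤ (l.map ν).sum := by
  induction l with
  | nil => simp [h.zero]
  | cons a l ih =>
    rw [List.sum_cons, List.map_cons, List.sum_cons]
    exact (h.add _ _).trans (Nat.add_le_add_left ih _)

end IsL1

open Polynomial in
/-- The `ℓ¹` norm of a polynomial. -/
noncomputable def polyNorm {R : Type*} [CommRing R] (ν : R → ℕ) (p : R[X]) : ℕ :=
  p.sum fun _ a => ν a

section PolyNorm
open Polynomial

variable {R : Type*} [CommRing R] {ν : R → ℕ}

theorem polyNorm_eq (h : IsL1 ν) (p : R[X]) (n : ℕ) (hn : p.natDegree < n) :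
    polyNorm ν p = ∑ i ∈ Finset.range n, ν (p.coeff i) :=
  p.sum_over_range' (fun _ => h.zero) n hn

theorem polyNorm_add (h : IsL1 ν) (p q : R[X]) :
    polyNorm ν (p + q) ≤ polyNorm ν p + polyNorm ν q := by
  set n := max p.natDegree q.natDegree + 1
  rw [polyNorm_eq h (p + q) n (Nat.lt_succ_of_le (natDegree_add_le p q)),
    polyNorm_eq h p n (Nat.lt_succ_of_le (le_max_left _ _)),
    polyNorm_eq h q n (Nat.lt_succ_of_le (le_max_right _ _)), ← Finset.sum_add_distrib]
  exact Finset.sum_le_sum fun i _ => by rw [coeff_add]; exact h.add _ _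

theorem polyNorm_zero : polyNorm ν (0 : R[X]) = 0 := by simp [polyNorm]

theorem polyNorm_monomial (h : IsL1 ν) (n : ℕ) (a : R) : polyNorm ν (monomial n a) = ν a :=
  sum_monomial_index a _ h.zero

theorem polyNorm_sum (h : IsL1 ν) {ι : Type*} (s : Finset ι) (f : ι → R[X]) :
    polyNorm ν (∑ i ∈ s, f i) ≤ ∑ i ∈ s, polyNorm ν (f i) :=
  Finset.le_sum_of_subadditive _ polyNorm_zero.le (polyNorm_add h) s f

theorem polyNorm_mul (h : IsL1 ν) (p q : R[X]) :
    polyNorm ν (p * q) ≤ polyNorm ν p * polyNorm ν q := by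
  rw [mul_eq_sum_sum]
  refine (polyNorm_sum h _ _).trans ?_
  rw [polyNorm, polyNorm, sum_def, Finset.sum_mul]
  refine Finset.sum_le_sum fun i _ => ?_
  rw [sum_def, sum_def, Finset.mul_sum]
  refine (polyNorm_sum h _ _).trans (Finset.sum_le_sum fun j _ => ?_)
  rw [polyNorm_monomial h]
  exact h.mul _ _

theorem coeff_le_polyNorm (h : IsL1 ν) (p : R[X]) (i : ℕ) : ν (p.coeff i) ≤ polyNorm ν p := by
  by_cases hi : i ∈ p.support
  · exact Finset.single_le_sum (f := fun i => ν (p.coeff i)) (fun _ _ => Nat.zero_le _) hi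
  · rw [notMem_support_iff.mp hi, h.zero]
    exact Nat.zero_le _

/-- The norm on R[X] has the same properties as the one on R, so the construction iterates from ℤ to
polynomials in s, x and y. -/
theorem isL1_polyNorm (h : IsL1 ν) : IsL1 (polyNorm (R := R) ν) where
  zero := polyNorm_zero
  one := by
    rw [← monomial_zero_one, polyNorm_monomial h]
    exact h.one
  add := polyNorm_add h
  mul := polyNorm_mul h
  intCast_mul n p := by
    rcases eq_or_ne n 0 with rfl | hn
    · simp [polyNorm_zero]
    have hd : ((n : R[X]) * p).natDegree < p.natDegree + 1 := by
      rw [Nat.lt_succ_iff]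
      refine natDegree_mul_le.trans ?_
      simp
    rw [polyNorm_eq h _ _ hd, polyNorm_eq h p _ (Nat.lt_succ_self _), Finset.mul_sum]
    refine Finset.sum_congr rfl fun i _ => ?_
    rw [← h.intCast_mul, ← C_eq_intCast, coeff_C_mul]
  eq_zero p hp := by
    ext i
    rw [coeff_zero]
    exact h.eq_zero _ (Nat.le_zero.mp (hp ▸ coeff_le_polyNorm h p i))

theorem polyNorm_C (h : IsL1 ν) (a : R) : polyNorm ν (C a) = ν a := by
  rw [← monomial_zero_left, polyNorm_monomial h]

theorem polyNorm_X_le (h : IsL1 ν) : polyNorm ν (X : R[X]) ≤ 1 := by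
  rw [← monomial_one_one_eq_X, polyNorm_monomial h]
  exact h.one

/-- An integer polynomial with a root larger than all its coefficients vanishes. -/
theorem eq_zero_of_eval_eq_zero (h : IsL1 ν) {B : ℕ} (q : R[X]) (hB : polyNorm ν q < B)
    (h0 : q.eval (B : R) = 0) : q = 0 := by
  have key : ∀ n : ℕ, ∀ q : R[X], q.natDegree ≤ n → (∀ i, ν (q.coeff i) < B) →
      q.eval (B : R) = 0 → q = 0 := by
    intro n
    induction n with
    | zero =>
      intro q hq _ h0
      rw [eq_C_of_natDegree_le_zero hq] at h0 ⊢
      rw [eval_C] at h0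
      rw [h0, C_0]
    | succ n ih =>
      intro q hq hc h0
      have hx := divX_mul_X_add q
      have h1 : (B : R) * q.divX.eval (B : R) + q.coeff 0 = 0 := by
        have h2 := congrArg (eval (B : R)) hx
        rw [h0, eval_add, eval_mul, eval_X, eval_C] at h2
        rw [mul_comm, h2]
      -- The constant coefficient is -B times the value of `q.divX` at B but has norm less than B.
      -- Hence that value is 0, the constant coefficient is 0, and induction applies to `q.divX`.
      have h2 : q.coeff 0 = ((-(B : ℤ) : ℤ) : R) * q.divX.eval (B : R) := by
        push_cast
        linear_combination h1
      have h3 : ν (q.divX.eval (B : R)) = 0 := by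
        have h4 := hc 0
        rw [h2, h.intCast_mul, Int.natAbs_neg, Int.natAbs_natCast] at h4
        by_contra hne
        exact absurd h4 (not_lt.mpr (Nat.le_mul_of_pos_right _ (Nat.pos_of_ne_zero hne)))
      have h4 := h.eq_zero _ h3
      have h5 : q.coeff 0 = 0 := by rw [h2, h4, mul_zero]
      have h6 : q.divX = 0 := by
        refine ih _ ?_ (fun i => ?_) h4
        · rw [natDegree_divX_eq_natDegree_tsub_one]
          omega
        · rw [coeff_divX]
          exact hc _
      rw [← hx, h6, h5]
      simp
  exact key _ q le_rfl (fun i => (coeff_le_polyNorm h q i).trans_lt hB) h0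

end PolyNorm

/-! ### Products of powers of linear forms -/

section Forms

variable {R : Type*} [CommRing R]

/-- The linear form with code `k`. -/
noncomputable def lin (x y z s : R) (k : ℕ) : R :=
  (if k < 32768 then s else 0) + ((dig (k / 1024) : ℤ) : R) * x + ((dig (k / 32) : ℤ) : R) * y
    + ((dig k : ℤ) : R) * z

theorem map_lin {R' : Type*} [CommRing R'] (f : R →+* R') (x y z s : R) (k : ℕ) :
    f (lin x y z s k) = lin (f x) (f y) (f z) (f s) k := by
  simp only [lin, map_add, map_mul, map_intCast, apply_ite f, map_zero]

theorem lin_smul (t x y z s : R) (k : ℕ) :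
    lin (t * x) (t * y) (t * z) (t * s) k = t * lin x y z s k := by
  simp only [lin]
  split_ifs <;> ring

theorem l1_eq (k : ℕ) : l1 k = (if k < 32768 then 1 else 0) + ((dig (k / 1024)).natAbs
    + ((dig (k / 32)).natAbs + (dig k).natAbs)) := by
  change cond (Nat.blt k 32768) 1 0 + _ = _
  congr 1
  by_cases h : k < 32768
  · rw [if_pos h, show Nat.blt k 32768 = true by simpa [Nat.blt_eq] using h]; rfl
  · rw [if_neg h, show Nat.blt k 32768 = false by
      rw [← Bool.not_eq_true]; simpa [Nat.blt_eq] using h]; rfl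

theorem norm_lin_le {ν : R → ℕ} (h : IsL1 ν) {x y z s : R} {W : ℕ} (hx : ν x ≤ W) (hy : ν y ≤ W)
    (hz : ν z ≤ W) (hs : ν s ≤ W) (k : ℕ) : ν (lin x y z s k) ≤ l1 k * W := by
  have hm : ∀ (n : ℤ) (a : R), ν a ≤ W → ν (n * a) ≤ n.natAbs * W := fun n a ha => by
    rw [h.intCast_mul]; exact Nat.mul_le_mul_left _ ha
  have h1 : ν (if k < 32768 then s else 0) ≤ (if k < 32768 then 1 else 0) * W := by
    split_ifs
    · simpa using hs
    · simp [h.zero]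
  rw [l1_eq, lin, add_mul, add_mul, add_mul, ← add_assoc, ← add_assoc]
  exact (h.add _ _).trans (add_le_add ((h.add _ _).trans (add_le_add ((h.add _ _).trans
    (add_le_add h1 (hm _ _ hx))) (hm _ _ hy))) (hm _ _ hz))

end Forms

section Products

variable {M : Type*} [CommMonoid M]

/-- The product of the `v g ^ e` for `g` in `G`, with exponents `e` in `es`. -/
def prodE (v : ℕ → M) : List (ℕ × ℕ) → List ℕ → M
  | g :: G, e :: es => v g.1 ^ e * prodE v G es
  | _, _ => 1

def prodG (v : ℕ → M) (G : List (ℕ × ℕ)) : M := (G.map fun g => v g.1 ^ g.2).prod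

def prodNum (v : ℕ → M) (l : VL) : M := (l.map fun p => v p.1 ^ p.2.toNat).prod

def prodDen (v : ℕ → M) (l : VL) : M := (l.map fun p => v p.1 ^ (-p.2).toNat).prod

theorem map_prodE {M' : Type*} [CommMonoid M'] (f : M →* M') (v : ℕ → M) (G : List (ℕ × ℕ))
    (es : List ℕ) : f (prodE v G es) = prodE (fun k => f (v k)) G es := by
  induction G generalizing es with
  | nil => simp [prodE]
  | cons g G ih => cases es <;> simp [prodE, ih]

theorem pw_eq (v acc e : ℕ) : pw v acc e = v ^ e * acc := by
  induction e with
  | zero => simp [pw]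
  | succ e ih =>
    have h : pw v acc (e + 1) = v * pw v acc e := rfl
    rw [h, ih]
    ring

theorem zipProd_eq (G : List (ℕ × ℕ)) (v : ℕ → ℕ) (es : List ℕ) :
    zipProd G v es = prodE v G es := by
  induction G generalizing es with
  | nil => cases es <;> rfl
  | cons g G ih =>
    cases es with
    | nil => rfl
    | cons e es =>
      have h : zipProd (g :: G) v (e :: es) = pw (v g.1) (zipProd G v es) e := rfl
      rw [h, pw_eq, ih]
      rfl

theorem lcmVal_eq (v : ℕ → ℕ) (G : List (ℕ × ℕ)) : lcmVal v G = prodG v G := by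
  induction G with
  | nil => rfl
  | cons g G ih =>
    have h : lcmVal v (g :: G) = pw (v g.1) (lcmVal v G) g.2 := rfl
    rw [h, pw_eq, ih]
    simp [prodG]

theorem numOf_eq (v : ℕ → ℕ) (l : VL) : numOf v l = prodNum v l := by
  induction l with
  | nil => rfl
  | cons p l ih =>
    obtain ⟨k, e⟩ := p
    cases e with
    | ofNat n =>
      have h : numOf v ((k, Int.ofNat n) :: l) = pw (v k) (numOf v l) n := rfl
      rw [h, pw_eq, ih]
      simp [prodNum]
    | negSucc n =>
      have h : numOf v ((k, Int.negSucc n) :: l) = numOf v l := rfl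
      rw [h, ih]
      simp [prodNum]

theorem denOf_eq (v : ℕ → ℕ) (l : VL) : denOf v l = prodDen v l := by
  induction l with
  | nil => rfl
  | cons p l ih =>
    obtain ⟨k, e⟩ := p
    cases e with
    | ofNat n =>
      have h : denOf v ((k, Int.ofNat n) :: l) = denOf v l := rfl
      rw [h, ih]
      simp [prodDen]
    | negSucc n =>
      have h : denOf v ((k, Int.negSucc n) :: l) = pw (v k) (denOf v l) (n + 1) := rfl
      rw [h, pw_eq, ih]
      simp [prodDen]

theorem dense_nil (l : VL) : dense [] l = if l = [] then some [] else none := by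
  cases l <;> rfl

theorem dense_cons_nil (g : ℕ × ℕ) (G : List (ℕ × ℕ)) :
    dense (g :: G) [] = (dense G []).map (List.cons g.2) := rfl

theorem dense_cons_cons (g : ℕ × ℕ) (G : List (ℕ × ℕ)) (p : ℕ × ℤ) (l : VL) :
    dense (g :: G) (p :: l) = if g.1 = p.1 then
      (if 0 ≤ (g.2 : ℤ) + p.2 then (dense G l).map (List.cons ((g.2 : ℤ) + p.2).toNat) else none)
      else (dense G (p :: l)).map (List.cons g.2) := by
  have h : dense (g :: G) (p :: l) = cond (Nat.beq g.1 p.1)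
      (Int.casesOn (motive := fun _ => Option (List ℕ)) ((g.2 : ℤ) + p.2)
        (fun n => Option.map (List.cons n) (dense G l)) (fun _ => none))
      (Option.map (List.cons g.2) (dense G (p :: l))) := rfl
  rw [h]
  by_cases hk : g.1 = p.1
  · rw [if_pos hk, show Nat.beq g.1 p.1 = true by simp [hk], cond_true]
    cases hn : (g.2 : ℤ) + p.2 with
    | ofNat n => simp
    | negSucc n => simp
  · rw [if_neg hk, show Nat.beq g.1 p.1 = false by
      rw [← Bool.not_eq_true, Nat.beq_eq]; exact hk, cond_false]

/-- Stated without division, so that it applies in any commutative monoid: to absolute values in ℕ,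
to signs in ℤ, and to field elements. -/
theorem dense_spec (v : ℕ → M) : ∀ (G : List (ℕ × ℕ)) (l : VL) (es : List ℕ),
    dense G l = some es → es.length = G.length ∧
      prodG v G * prodNum v l = prodE v G es * prodDen v l := by
  intro G
  induction G with
  | nil =>
    intro l es h
    rw [dense_nil] at h
    split_ifs at h with hl
    · cases h
      subst hl
      simp [prodG, prodNum, prodDen, prodE]
  | cons g G ih =>
    intro l es h
    cases l with
    | nil =>
      rw [dense_cons_nil, Option.map_eq_some_iff] at h
      obtain ⟨es', h', rfl⟩ := h
      obtain ⟨h1, h2⟩ := ih _ _ h'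
      refine ⟨by simp [h1], ?_⟩
      simp only [prodG, prodNum, prodDen, prodE, List.map_nil, List.prod_nil, mul_one,
        List.map_cons, List.prod_cons] at h2 ⊢
      rw [h2]
    | cons p l =>
      rw [dense_cons_cons] at h
      split_ifs at h with hk hn
      · rw [Option.map_eq_some_iff] at h
        obtain ⟨es', h', rfl⟩ := h
        obtain ⟨h1, h2⟩ := ih _ _ h'
        refine ⟨by simp [h1], ?_⟩
        simp only [prodG, prodNum, prodDen, prodE, List.map_cons, List.prod_cons] at h2 ⊢
        have h3 : g.2 + p.2.toNat = ((g.2 : ℤ) + p.2).toNat + (-p.2).toNat := by omega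
        calc _ = v g.1 ^ (g.2 + p.2.toNat) * ((List.map (fun g => v g.1 ^ g.2) G).prod
              * (List.map (fun p => v p.1 ^ p.2.toNat) l).prod) := by
              rw [pow_add, hk]; simp only [mul_assoc, mul_left_comm]
          _ = _ := by
              rw [h2, h3, pow_add, hk]; simp only [mul_assoc, mul_left_comm]
      · rw [Option.map_eq_some_iff] at h
        obtain ⟨es', h', rfl⟩ := h
        obtain ⟨h1, h2⟩ := ih _ _ h'
        refine ⟨by simp [h1], ?_⟩
        simp only [prodG, prodE, List.map_cons, List.prod_cons] at h2 ⊢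
        rw [mul_assoc, h2, mul_assoc]

theorem prodE_append (v : ℕ → M) : ∀ (G₁ : List (ℕ × ℕ)) (es₁ : List ℕ) (G₂ : List (ℕ × ℕ))
    (es₂ : List ℕ), es₁.length = G₁.length →
      prodE v (G₁ ++ G₂) (es₁ ++ es₂) = prodE v G₁ es₁ * prodE v G₂ es₂
  | [], [], G₂, es₂, _ => by simp [prodE]
  | g :: G₁, e :: es₁, G₂, es₂, h => by
    simp only [List.cons_append, prodE]
    rw [prodE_append v G₁ es₁ G₂ es₂ (by simpa using h), mul_assoc]
  | [], _ :: _, _, _, h => by simp at h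
  | _ :: _, [], _, _, h => by simp at h

theorem prodE_congr {v w : ℕ → M} : ∀ (G : List (ℕ × ℕ)) (es : List ℕ),
    (∀ g ∈ G, v g.1 = w g.1) → prodE v G es = prodE w G es
  | [], _, _ => by simp [prodE]
  | _ :: _, [], _ => by simp [prodE]
  | g :: G, e :: es, h => by
    simp only [prodE]
    rw [h g (by simp), prodE_congr G es fun g hg => h g (by simp [hg])]

theorem prodE_mul (v w : ℕ → M) : ∀ (G : List (ℕ × ℕ)) (es : List ℕ),
    prodE (fun k => v k * w k) G es = prodE v G es * prodE w G es
  | [], _ => by simp [prodE]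
  | _ :: _, [] => by simp [prodE]
  | g :: G, e :: es => by
    simp only [prodE]
    rw [prodE_mul v w G es, mul_pow, mul_mul_mul_comm]

theorem prodE_const (t : M) (G : List (ℕ × ℕ)) (es : List ℕ) :
    prodE (fun _ => t) G es = t ^ zipSum G (fun _ => true) es := by
  induction G generalizing es with
  | nil => cases es <;> simp [prodE, zipSum]
  | cons g G ih =>
    cases es with
    | nil => simp [prodE, zipSum]
    | cons e es =>
      have h : zipSum (g :: G) (fun _ => true) (e :: es)
        = e + zipSum G (fun _ => true) es := rfl
      rw [h, pow_add, ← ih]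
      rfl

end Products

end VertexTable

namespace VertexTable

/-! ### The numerator of a sum of rows -/

noncomputable def exps (G : List (ℕ × ℕ)) (l : VL) : List ℕ := (dense G l).getD []

/-- The product of the sum of the rows with the common denominator. -/
noncomputable def numer {R : Type*} [CommRing R] (G : List (ℕ × ℕ)) (rs : List Row)
    (x y z s : R) : R :=
  (rs.map fun r => (r.1 : R) * prodE (lin x y z s) G (exps G r.2)).sum

theorem map_numer {R : Type*} {R' : Type*} [CommRing R] [CommRing R'] (f : R →+* R')
    (G : List (ℕ × ℕ)) (rs : List Row) (x y z s : R) :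
    f (numer G rs x y z s) = numer G rs (f x) (f y) (f z) (f s) := by
  rw [numer, numer, map_list_sum, List.map_map]
  congr 1
  refine List.map_congr_left fun r _ => ?_
  have := map_prodE (f : R →* R') (lin x y z s) G (exps G r.2)
  simp only [MonoidHom.coe_coe] at this
  simp only [Function.comp, map_mul, map_intCast, this, map_lin]

theorem numer_smul {R : Type*} [CommRing R] {G : List (ℕ × ℕ)} {rs : List Row} {d : ℕ}
    (hd : ∀ r ∈ rs, zipSum G (fun _ => true) (exps G r.2) = d) (t x y z s : R) :
    numer G rs (t * x) (t * y) (t * z) (t * s) = t ^ d * numer G rs x y z s := by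
  rw [numer, numer, ← List.sum_map_mul_left]
  congr 1
  refine List.map_congr_left fun r hr => ?_
  have : lin (t * x) (t * y) (t * z) (t * s) = fun k => (fun _ => t) k * lin x y z s k :=
    funext fun k => lin_smul t x y z s k
  rw [this, prodE_mul, prodE_const, hd r hr]
  ring

theorem norm_prodE_le {R : Type*} [CommRing R] {ν : R → ℕ} (h : IsL1 ν) {v : ℕ → R} {w : ℕ → ℕ}
    (hv : ∀ k, ν (v k) ≤ w k) (G : List (ℕ × ℕ)) (es : List ℕ) :
    ν (prodE v G es) ≤ prodE w G es := by
  induction G generalizing es with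
  | nil => simpa [prodE] using h.one
  | cons g G ih =>
    cases es with
    | nil => simpa [prodE] using h.one
    | cons e es =>
      refine (h.mul _ _).trans (Nat.mul_le_mul ((h.pow _ _).trans ?_) (ih es))
      exact Nat.pow_le_pow_left (hv _) _

theorem height_eq (G : List (ℕ × ℕ)) (rs : List Row) (hG : ∀ r ∈ rs, (dense G r.2).isSome) :
    height G rs = (rs.map fun r => r.1.natAbs * prodE l1 G (exps G r.2)).sum := by
  induction rs with
  | nil => rfl
  | cons r rs ih =>
    have h : height G (r :: rs) = Option.casesOn (motive := fun _ => ℕ) (dense G r.2)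
      (height G rs) (fun es => r.1.natAbs * zipProd G l1 es + height G rs) := rfl
    obtain ⟨es, hes⟩ := Option.isSome_iff_exists.mp (hG r (by simp))
    rw [h, ih fun r hr => hG r (by simp [hr]), List.map_cons, List.sum_cons, exps, hes]
    simp only [zipProd_eq, Option.getD_some]

/-- Each form has norm at most `l1 * W` at the given point, and homogeneity of degree d collects the
factors W into W ^ d. -/
theorem norm_numer_le {R : Type*} [CommRing R] {ν : R → ℕ} (h : IsL1 ν) {G : List (ℕ × ℕ)}
    {rs : List Row} {d : ℕ} (hG : ∀ r ∈ rs, (dense G r.2).isSome)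
    (hd : ∀ r ∈ rs, zipSum G (fun _ => true) (exps G r.2) = d) {x y z s : R} {W : ℕ}
    (hx : ν x ≤ W) (hy : ν y ≤ W) (hz : ν z ≤ W) (hs : ν s ≤ W) :
    ν (numer G rs x y z s) ≤ height G rs * W ^ d := by
  rw [height_eq G rs hG, ← List.sum_map_mul_right]
  refine (h.listSum _).trans ?_
  rw [List.map_map]
  refine List.sum_le_sum fun r hr => ?_
  have h1 := norm_prodE_le h (v := lin x y z s) (w := fun k => l1 k * (fun _ => W) k)
    (norm_lin_le h hx hy hz hs) G (exps G r.2)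
  rw [prodE_mul, prodE_const, hd r hr] at h1
  rw [mul_assoc]
  exact (h.mul _ _).trans (Nat.mul_le_mul (h.intCast _) h1)

/-! ### Integer points -/

theorem dig_eq (n : ℕ) : dig n = ((n % 32 : ℕ) : ℤ) - 16 := Int.subNatNat_eq_coe

theorem evP_sub_evN (P : Pt) (k : ℕ) :
    (evP P k : ℤ) - evN P k = lin ((P.xp : ℤ) - P.xn) (P.y : ℤ) (P.z : ℤ) (P.s : ℤ) k := by
  have h : (cond (Nat.blt k 32768) P.s 0) = if k < 32768 then P.s else 0 := by
    by_cases h : k < 32768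
    · rw [if_pos h, show Nat.blt k 32768 = true by simpa [Nat.blt_eq] using h]; rfl
    · rw [if_neg h, show Nat.blt k 32768 = false by
        rw [← Bool.not_eq_true]; simpa [Nat.blt_eq] using h]; rfl
  have hP : evP P k = (if k < 32768 then P.s else 0)
      + (((k / 1024 % 32) * P.xp + 16 * P.xn) + ((k / 32 % 32) * P.y + (k % 32) * P.z)) := by
    rw [← h]; rfl
  have hN : evN P k = ((k / 1024 % 32) * P.xn + 16 * P.xp) + 16 * (P.y + P.z) := rfl
  rw [hP, hN, lin, dig_eq, dig_eq, dig_eq]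
  split_ifs <;> push_cast <;> ring

/-- The sign belonging to a truth value. -/
def sign (b : Bool) : ℤ := cond b (-1) 1

theorem sign_mul_self (b : Bool) : sign b * sign b = 1 := by cases b <;> rfl

theorem lin_eq_sign_mul (P : Pt) (k : ℕ) :
    lin ((P.xp : ℤ) - P.xn) (P.y : ℤ) (P.z : ℤ) (P.s : ℤ) k = sign (evNeg P k) * evAbs P k := by
  have hA : evAbs P k = (evP P k - evN P k) + (evN P k - evP P k) := rfl
  rw [← evP_sub_evN, hA]
  by_cases h : evP P k < evN P k
  · rw [show evNeg P k = true by simpa [evNeg, Nat.blt_eq] using h]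
    simp only [sign, cond_true]
    omega
  · rw [show evNeg P k = false by
      rw [← Bool.not_eq_true]; simpa [evNeg, Nat.blt_eq] using h]
    simp only [sign, cond_false]
    omega

theorem prodNum_mul_prodDen_sign (ng : ℕ → Bool) (l : VL) :
    prodNum (fun k => sign (ng k)) l * prodDen (fun k => sign (ng k)) l
      = (-1) ^ parOf ng l := by
  induction l with
  | nil => rfl
  | cons p l ih =>
    have h : parOf ng (p :: l) = cond (ng p.1) (p.2.natAbs + parOf ng l) (parOf ng l) := rfl
    simp only [prodNum, prodDen, List.map_cons, List.prod_cons] at ih ⊢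
    rw [mul_mul_mul_comm, ih, ← pow_add, h, show p.2.toNat + (-p.2).toNat = p.2.natAbs by omega]
    cases ng p.1
    · simp [sign]
    · simp only [sign, cond_true, pow_add]

/-- The sign of a row after clearing denominators is its own parity times the sign of the common
denominator. The latter is the same for all rows and does not affect the vanishing of their sum. -/
theorem prodE_sign (ng : ℕ → Bool) (G : List (ℕ × ℕ)) (l : VL) (es : List ℕ)
    (h : dense G l = some es) :
    prodE (fun k => sign (ng k)) G es
      = prodG (fun k => sign (ng k)) G * (-1) ^ parOf ng l := by
  have h1 := (dense_spec (fun k => sign (ng k)) G l es h).2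
  have h2 : prodDen (fun k => sign (ng k)) l * prodDen (fun k => sign (ng k)) l = 1 := by
    clear h h1
    induction l with
    | nil => rfl
    | cons p l ih =>
      simp only [prodDen, List.map_cons, List.prod_cons] at ih ⊢
      rw [mul_mul_mul_comm, ih, mul_one, ← mul_pow, sign_mul_self, one_pow]
  rw [← prodNum_mul_prodDen_sign, ← mul_assoc, h1, mul_assoc, h2, mul_one]

theorem quo_eq (v : ℕ → ℕ) (G : List (ℕ × ℕ)) (l : VL) (es : List ℕ) (h : dense G l = some es)
    (h0 : 0 < denOf v l) : quo (lcmVal v G) v l = prodE v G es := by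
  have h1 := (dense_spec v G l es h).2
  rw [denOf_eq] at h0
  change lcmVal v G * numOf v l / denOf v l = _
  rw [lcmVal_eq, numOf_eq, denOf_eq, h1]
  exact Nat.mul_div_cancel _ h0

theorem neg_one_pow_eq_sign (n : ℕ) : (-1 : ℤ) ^ n = sign (oddR n) := by
  rcases Nat.even_or_odd n with h | h
  · rw [h.neg_one_pow, show oddR n = false by
      change Nat.beq (n % 2) 1 = false
      rw [Nat.even_iff.mp h]
      rfl]
    rfl
  · rw [h.neg_one_pow, show oddR n = true by
      change Nat.beq (n % 2) 1 = true
      rw [Nat.odd_iff.mp h]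
      rfl]
    rfl

theorem sign_isNeg (c : ℤ) : sign (isNeg c) * c.natAbs = c := by
  cases c with
  | ofNat n => simp [isNeg, sign]
  | negSucc n => simp [isNeg, sign]; omega

theorem sign_xor (a b : Bool) : sign (Bool.xor a b) = sign a * sign b := by
  cases a <;> cases b <;> rfl

theorem signedSum_sub (L : ℕ) (v : ℕ → ℕ) (ng : ℕ → Bool) (rs : List Row) :
    (signedSum true L v ng rs : ℤ) - signedSum false L v ng rs
      = (rs.map fun r => r.1 * ((-1) ^ parOf ng r.2 * (quo L v r.2 : ℤ))).sum := by
  induction rs with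
  | nil => rfl
  | cons r rs ih =>
    have h : ∀ b, signedSum b L v ng (r :: rs) = cond (Bool.xor b (Bool.xor (oddR (parOf ng r.2))
      (isNeg r.1))) (r.1.natAbs * quo L v r.2 + signedSum b L v ng rs)
        (signedSum b L v ng rs) := fun _ => rfl
    rw [h, h, List.map_cons, List.sum_cons, ← ih, neg_one_pow_eq_sign]
    have h2 : r.1 * (sign (oddR (parOf ng r.2)) * (quo L v r.2 : ℤ))
        = sign (Bool.xor (oddR (parOf ng r.2)) (isNeg r.1)) * (r.1.natAbs * quo L v r.2) := by
      conv_lhs => rw [← sign_isNeg r.1]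
      rw [sign_xor]
      ring
    rw [h2]
    cases Bool.xor (oddR (parOf ng r.2)) (isNeg r.1)
    · simp only [Bool.xor_false, cond_true, cond_false, sign]
      push_cast
      ring
    · simp only [Bool.xor_true, Bool.not_true, Bool.not_false, cond_true, cond_false, sign]
      push_cast
      ring

theorem vanish_spec {G : List (ℕ × ℕ)} {v : ℕ → ℕ} {ng : ℕ → Bool} {rs : List Row}
    (h : vanish (lcmVal v G) v ng rs = true) (hG : ∀ r ∈ rs, (dense G r.2).isSome) :
    (rs.map fun r => r.1 * prodE (fun k => sign (ng k) * v k) G (exps G r.2)).sum = 0 := by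
  rw [vanish, Bool.and_eq_true, all_iff, Nat.beq_eq] at h
  have h1 := signedSum_sub (lcmVal v G) v ng rs
  rw [h.2, sub_self] at h1
  have h2 : (rs.map fun r => r.1 * prodE (fun k => sign (ng k) * (v k : ℤ)) G (exps G r.2))
      = rs.map fun r => prodG (fun k => sign (ng k)) G *
        (r.1 * ((-1) ^ parOf ng r.2 * (quo (lcmVal v G) v r.2 : ℤ))) := by
    refine List.map_congr_left fun r hr => ?_
    obtain ⟨es, hes⟩ := Option.isSome_iff_exists.mp (hG r hr)
    have h3 : ((prodE v G es : ℕ) : ℤ) = prodE (fun k => (v k : ℤ)) G es :=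
      map_prodE (Nat.castRingHom ℤ : ℕ →* ℤ) v G es
    rw [quo_eq v G r.2 es hes (by have := h.1 r hr; rwa [Nat.blt_eq] at this), exps, hes,
      Option.getD_some, prodE_mul, prodE_sign ng G r.2 es hes, h3]
    ring
  rw [h2, List.sum_map_mul_left, ← h1, mul_zero]

end VertexTable

namespace VertexTable

/-! ### Vanishing at the zeros of linear forms -/

/-- One step of the walk through the common denominator: the exponent e of the form g decides
whether the row survives at the zero of g, and the advanced tail fits the remaining forms. -/
theorem exists_dense_cons {g : ℕ × ℕ} {G : List (ℕ × ℕ)} {t : VL} {es : List ℕ}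
    (h : dense (g :: G) t = some es) : ∃ e es', es = e :: es' ∧
      dense G (List.casesOn (motive := fun _ => VL) t []
        (fun p t => cond (Nat.beq g.1 p.1) t (p :: t))) = some es' ∧
      ∀ c l rs, survivors g ((c, l, t) :: rs)
        = if e = 0 then (c, l) :: survivors g rs else survivors g rs := by
  have hs : ∀ c l rs, survivors g ((c, l, t) :: rs) =
      List.casesOn (motive := fun _ => List Row) t
        (Nat.casesOn (motive := fun _ => List Row) g.2 ((c, l) :: survivors g rs)
          (fun _ => survivors g rs))
        (fun p _ => cond (Nat.beq g.1 p.1)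
          (Nat.casesOn (motive := fun _ => List Row) (Int.natAbs ((g.2 : ℤ) + p.2))
            ((c, l) :: survivors g rs) (fun _ => survivors g rs))
          (Nat.casesOn (motive := fun _ => List Row) g.2 ((c, l) :: survivors g rs)
            (fun _ => survivors g rs))) := fun _ _ _ => rfl
  have hc : ∀ (n : ℕ) (a b : List Row), Nat.casesOn (motive := fun _ => List Row) n a (fun _ => b)
      = if n = 0 then a else b := fun n a b => by cases n <;> simp
  cases t with
  | nil =>
    rw [dense_cons_nil, Option.map_eq_some_iff] at h
    obtain ⟨es', h', rfl⟩ := h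
    exact ⟨g.2, es', rfl, h', fun c l rs => by rw [hs, hc]⟩
  | cons p t =>
    rw [dense_cons_cons] at h
    split_ifs at h with hk hn
    · rw [Option.map_eq_some_iff] at h
      obtain ⟨es', h', rfl⟩ := h
      have hb : Nat.beq g.1 p.1 = true := by simp [hk]
      refine ⟨_, es', rfl, ?_, fun c l rs => ?_⟩
      · simpa only [hb, cond_true] using h'
      · rw [hs]
        simp only [hb, cond_true, hc]
        exact if_congr (by omega) rfl rfl
    · rw [Option.map_eq_some_iff] at h
      obtain ⟨es', h', rfl⟩ := h
      have hb : Nat.beq g.1 p.1 = false := by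
        rw [← Bool.not_eq_true, Nat.beq_eq]; exact hk
      refine ⟨_, es', rfl, ?_, fun c l rs => ?_⟩
      · simpa only [hb, cond_false] using h'
      · rw [hs]
        simp only [hb, cond_false, hc]

/-- The remaining parts of the rows fit to the part `suf` of the list `pre ++ suf` of forms. -/
def Aligned (pre suf : List (ℕ × ℕ)) (rs : List TailRow) : Prop :=
  ∀ r ∈ rs, ∃ es₁ es₂, dense (pre ++ suf) r.2.1 = some (es₁ ++ es₂) ∧ es₁.length = pre.length ∧
    dense suf r.2.2 = some es₂

theorem Aligned.advance {pre suf : List (ℕ × ℕ)} {g : ℕ × ℕ} {rs : List TailRow}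
    (h : Aligned pre (g :: suf) rs) : Aligned (pre ++ [g]) suf (advance g.1 rs) := by
  intro r hr
  rw [VertexTable.advance, mapR_eq, List.mem_map] at hr
  obtain ⟨r', hr', rfl⟩ := hr
  obtain ⟨es₁, es₂, h1, h2, h3⟩ := h r' hr'
  obtain ⟨e, es', rfl, h4, _⟩ := exists_dense_cons h3
  exact ⟨es₁ ++ [e], es', by simpa using h1, by simp [h2], h4⟩

/-- Rows with a positive power of g vanish under u. The remaining rows do not involve g, so u may be
replaced by any w agreeing with it on the other forms. -/
theorem survivors_spec {pre suf : List (ℕ × ℕ)} {g : ℕ × ℕ} {u w : ℕ → ℤ} {rs : List TailRow}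
    (h : Aligned pre (g :: suf) rs) (hu : u g.1 = 0)
    (huw : ∀ g' ∈ pre ++ suf, u g'.1 = w g'.1) :
    (rs.map fun r => r.1 * prodE u (pre ++ g :: suf) (exps (pre ++ g :: suf) r.2.1)).sum
      = ((survivors g rs).map fun r =>
          r.1 * prodE w (pre ++ g :: suf) (exps (pre ++ g :: suf) r.2)).sum := by
  induction rs with
  | nil => rfl
  | cons r rs ih =>
    obtain ⟨c, l, t⟩ := r
    obtain ⟨es₁, es₂, h1, h2, h3⟩ := h (c, l, t) (by simp)
    obtain ⟨e, es', rfl, h4, h5⟩ := exists_dense_cons h3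
    have he : exps (pre ++ g :: suf) l = es₁ ++ e :: es' := by rw [exps, h1]; rfl
    have hp : ∀ v : ℕ → ℤ, prodE v (pre ++ g :: suf) (es₁ ++ e :: es')
        = prodE v pre es₁ * (v g.1 ^ e * prodE v suf es') := fun v => by
      rw [prodE_append v pre es₁ _ _ h2]; rfl
    rw [List.map_cons, List.sum_cons, ih fun r hr => h r (by simp [hr]), h5]
    simp only [he, hp]
    rcases eq_or_ne e 0 with rfl | h0
    · rw [if_pos rfl, List.map_cons, List.sum_cons]
      simp only [he, hp, pow_zero]
      rw [prodE_congr pre es₁ fun g' hg' => huw g' (by simp [hg']),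
        prodE_congr suf es' fun g' hg' => huw g' (by simp [hg'])]
    · rw [if_neg h0, hu, zero_pow h0]
      ring

theorem mem_survivors {g : ℕ × ℕ} {rs : List TailRow} {r : Row} (h : r ∈ survivors g rs) :
    ∃ t, (r.1, r.2, t) ∈ rs := by
  induction rs with
  | nil => simp [survivors] at h
  | cons r' rs ih =>
    have h' : r ∈ (r'.1, r'.2.1) :: survivors g rs := by
      obtain ⟨c, l, t⟩ := r'
      have hs : survivors g ((c, l, t) :: rs) =
          List.casesOn (motive := fun _ => List Row) t
            (Nat.casesOn (motive := fun _ => List Row) g.2 ((c, l) :: survivors g rs)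
              (fun _ => survivors g rs))
            (fun p _ => cond (Nat.beq g.1 p.1)
              (Nat.casesOn (motive := fun _ => List Row) (Int.natAbs ((g.2 : ℤ) + p.2))
                ((c, l) :: survivors g rs) (fun _ => survivors g rs))
              (Nat.casesOn (motive := fun _ => List Row) g.2 ((c, l) :: survivors g rs)
                (fun _ => survivors g rs))) := rfl
      rw [hs] at h
      have hc : ∀ n : ℕ, r ∈ Nat.casesOn (motive := fun _ => List Row) n
          ((c, l) :: survivors g rs) (fun _ => survivors g rs) →
          r ∈ (c, l) :: survivors g rs := fun n hn => by
        cases n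
        · exact hn
        · exact List.mem_cons_of_mem _ hn
      cases t with
      | nil => exact hc _ h
      | cons p t =>
        cases hb : Nat.beq g.1 p.1 <;> simp only [hb, cond_true, cond_false] at h <;> exact hc _ h
    rw [List.mem_cons] at h'
    rcases h' with rfl | h'
    · exact ⟨r'.2.2, by simp⟩
    · obtain ⟨t, ht⟩ := ih h'
      exact ⟨t, by simp [ht]⟩

theorem isX_iff (k : ℕ) : isX k = true ↔ 16 < k / 1024 % 32 ∧ 32768 ≤ k := by
  rw [isX, Bool.and_eq_true, Nat.blt_eq, Nat.ble_eq]
  rfl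

theorem rootPt_x (B S k : ℕ) : ((rootPt B S k).xp : ℤ) - (rootPt B S k).xn
    = -(dig (k / 32) * B + dig k) := by
  change ((16 * (B + 1) : ℕ) : ℤ) - ((k / 32 % 32 * B + k % 32 : ℕ) : ℤ) = _
  rw [dig_eq, dig_eq]
  push_cast
  ring

theorem rootPt_z {k : ℕ} (h : isX k = true) (B S : ℕ) :
    ((rootPt B S k).z : ℤ) = dig (k / 1024) := by
  change ((k / 1024 % 32 - 16 : ℕ) : ℤ) = _
  rw [isX_iff] at h
  rw [dig_eq]
  omega

theorem rootPt_y (B S k : ℕ) : (rootPt B S k).y = (rootPt B S k).z * B := by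
  simp only [rootPt, Nat.mul_eq]

/-- The numerator at the point `rootPt B S k`. -/
noncomputable def numerAt (G : List (ℕ × ℕ)) (rs : List Row) (P : Pt) : ℤ :=
  numer G rs ((P.xp : ℤ) - P.xn) (P.y : ℤ) (P.z : ℤ) (P.s : ℤ)

theorem vanish_survivors_spec {pre suf : List (ℕ × ℕ)} {g : ℕ × ℕ} {rs : List TailRow} (P : Pt)
    (L : ℕ) (hL : L = lcmVal (except g.1 (evAbs P)) (pre ++ g :: suf))
    (hG : ((pre ++ g :: suf).map Prod.fst).Nodup) (h : Aligned pre (g :: suf) rs)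
    (hu : lin ((P.xp : ℤ) - P.xn) (P.y : ℤ) (P.z : ℤ) (P.s : ℤ) g.1 = 0)
    (hv : vanish L (except g.1 (evAbs P)) (evNeg P) (survivors g rs) = true) :
    numerAt (pre ++ g :: suf) (rs.map fun r => (r.1, r.2.1)) P = 0 := by
  have hne : ∀ g' ∈ pre ++ suf, g'.1 ≠ g.1 := by
    intro g' hg' he
    rw [List.map_append, List.map_cons, List.nodup_middle, List.nodup_cons] at hG
    apply hG.1
    rw [← List.map_append, ← he]
    exact List.mem_map_of_mem hg'
  have h1 := survivors_spec (u := lin ((P.xp : ℤ) - P.xn) (P.y : ℤ) (P.z : ℤ) (P.s : ℤ))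
    (w := fun k => sign (evNeg P k) * (except g.1 (evAbs P) k : ℕ)) h hu (fun g' hg' => by
      have h2 : Nat.beq g'.1 g.1 = false := by
        rw [← Bool.not_eq_true, Nat.beq_eq]; exact hne g' hg'
      rw [lin_eq_sign_mul, except, h2, cond_false])
  have h3 : numerAt (pre ++ g :: suf) (rs.map fun r => (r.1, r.2.1)) P
      = (rs.map fun r => r.1 * prodE (lin ((P.xp : ℤ) - P.xn) (P.y : ℤ) (P.z : ℤ) (P.s : ℤ))
        (pre ++ g :: suf) (exps (pre ++ g :: suf) r.2.1)).sum := by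
    rw [numerAt, numer, List.map_map]
    congr 1
  rw [h3, h1]
  subst hL
  refine vanish_spec hv fun r hr => ?_
  obtain ⟨t, ht⟩ := mem_survivors hr
  obtain ⟨es₁, es₂, h2, -, -⟩ := h _ ht
  exact Option.isSome_iff_exists.mpr ⟨_, h2⟩

theorem lin_rootPt {B S k : ℕ} (hX : isX k = true) :
    lin (((rootPt B S k).xp : ℤ) - (rootPt B S k).xn) ((rootPt B S k).y : ℤ)
      ((rootPt B S k).z : ℤ) ((rootPt B S k).s : ℤ) k = 0 := by
  rw [lin, if_neg (not_lt.mpr ((isX_iff _).mp hX).2), rootPt_x, rootPt_y, Nat.cast_mul,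
    rootPt_z hX]
  simp only [Int.cast_id]
  ring

/-- Induction on the unread part of the common denominator `pre ++ suf`. Being a sublist of the
codes makes the zeros found belong to distinct forms, so that they can be counted. -/
theorem roots_spec {τ lo hi B S : ℕ} {suf : List (ℕ × ℕ)} :
    ∀ {pre : List (ℕ × ℕ)} {rs : List TailRow}, ((pre ++ suf).map Prod.fst).Nodup →
      Aligned pre suf rs →
      (roots τ lo hi B S (pre ++ suf) suf rs).Sublist (suf.map Prod.fst) ∧
      ∀ k ∈ roots τ lo hi B S (pre ++ suf) suf rs, lo ≤ k ∧ k < hi ∧ isX k = true ∧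
        numerAt (pre ++ suf) (rs.map fun r => (r.1, r.2.1)) (rootPt B S k) = 0 := by
  induction suf with
  | nil => intro pre rs _ _; simp [roots]
  | cons g suf ih =>
    intro pre rs hG h
    have hG' : pre ++ g :: suf = (pre ++ [g]) ++ suf := by simp
    have h1 := ih (pre := pre ++ [g]) (rs := advance g.1 rs) (by rw [← hG']; exact hG) h.advance
    have h2 : (advance g.1 rs).map (fun r => (r.1, r.2.1)) = rs.map fun r => (r.1, r.2.1) := by
      rw [advance, mapR_eq, List.map_map]
      rfl
    rw [h2, ← hG'] at h1
    have hr : roots τ lo hi B S (pre ++ g :: suf) (g :: suf) rs =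
        cond (Nat.ble lo g.1 && Nat.blt g.1 hi && isX g.1 &&
          Nat.ble (len (survivors g rs)) τ &&
          vanishAt (rootPt B S g.1) g.1 (pre ++ g :: suf) (survivors g rs))
        (g.1 :: roots τ lo hi B S (pre ++ g :: suf) suf (advance g.1 rs))
        (roots τ lo hi B S (pre ++ g :: suf) suf (advance g.1 rs)) := rfl
    rw [hr]
    cases hb : (Nat.ble lo g.1 && Nat.blt g.1 hi && isX g.1 &&
          Nat.ble (len (survivors g rs)) τ &&
          vanishAt (rootPt B S g.1) g.1 (pre ++ g :: suf) (survivors g rs))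
    · exact ⟨h1.1.cons _, h1.2⟩
    · simp only [Bool.and_eq_true, Nat.ble_eq, Nat.blt_eq] at hb
      refine ⟨by simpa using h1.1, ?_⟩
      simp only [cond_true, List.mem_cons, forall_eq_or_imp]
      exact ⟨⟨hb.1.1.1.1, hb.1.1.1.2, hb.1.1.2, vanish_survivors_spec _ _ rfl hG h (lin_rootPt hb.1.1.2) hb.2⟩, h1.2⟩

/-! ### The numerator vanishes identically -/

open Polynomial

/-- The hypotheses verified by `checkBounds`. -/
structure Bounded (d D B S : ℕ) (G : List (ℕ × ℕ)) (rs : List Row) : Prop where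
  nodup : (G.map Prod.fst).Nodup
  nonzero : ∀ g ∈ G, nonzeroForm g.1 = true
  isSome : ∀ r ∈ rs, (dense G r.2).isSome
  degree : ∀ r ∈ rs, zipSum G (fun _ => true) (exps G r.2) = d
  degreeX : ∀ r ∈ rs, zipSum G hasX (exps G r.2) < D
  height_lt : height G rs < B
  height_mul_lt : height G rs * (32 * B) ^ d < S
  distinct : ∀ k ∈ G.map Prod.fst, ∀ k' ∈ G.map Prod.fst, isX k = true → isX k' = true → k ≠ k' →
    dig (k' / 1024) * (-(dig (k / 32) * B + dig k))
      ≠ dig (k / 1024) * (-(dig (k' / 32) * B + dig k'))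

theorem bounded_of_checkBounds {d D B S : ℕ} {G : List (ℕ × ℕ)} {rs : List Row}
    (h : checkBounds d D B S G rs = true) : Bounded d D B S G rs := by
  simp only [checkBounds, Bool.and_eq_true] at h
  obtain ⟨⟨⟨⟨⟨h1, h0⟩, h2⟩, h3⟩, h4⟩, h5⟩ := h
  rw [pairwiseR_iff] at h1
  rw [covered, all_iff] at h2
  rw [Nat.blt_eq] at h3 h4
  have h2' : ∀ r ∈ rs, (dense G r.2).isSome ∧ zipSum G (fun _ => true) (exps G r.2) = d ∧
      zipSum G hasX (exps G r.2) < D := by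
    intro r hr
    have := h2 r hr
    rw [exps]
    cases hd : dense G r.2 with
    | none => rw [hd] at this; exact absurd this (by simp)
    | some es =>
      rw [hd] at this
      simpa [Nat.blt_eq] using this
  rw [distinctRoots, pairwiseR_iff, filterR_eq, mapR_eq] at h5
  rw [all_iff] at h0
  refine ⟨?_, h0, fun r hr => (h2' r hr).1, fun r hr => (h2' r hr).2.1, fun r hr => (h2' r hr).2.2, h3,
    h4, ?_⟩
  · rw [List.Nodup, List.pairwise_map]
    exact h1.imp fun hab => by rw [Nat.blt_eq] at hab; exact hab.ne
  · have hsymm : ∀ k ∈ (G.map Prod.fst).filter isX, ∀ k' ∈ (G.map Prod.fst).filter isX, k ≠ k' →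
        dig (k' / 1024) * (-(dig (k / 32) * B + dig k))
          ≠ dig (k / 1024) * (-(dig (k' / 32) * B + dig k')) := by
      -- The check sees each pair in one order only; the inequality is symmetric, so it extends to
      -- all pairs of different codes.
      refine fun k hk k' hk' hne => List.Pairwise.forall_of_forall_of_flip
        (R := fun k k' => k ≠ k' → dig (k' / 1024) * (-(dig (k / 32) * B + dig k))
          ≠ dig (k / 1024) * (-(dig (k' / 32) * B + dig k'))) (fun x _ h => absurd rfl h)
        ?_ ?_ hk hk' hne
      all_goals
        refine List.Pairwise.imp_of_mem ?_ h5
        intro k k' hk hk' hkk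
        rw [Bool.not_eq_true', ← Bool.not_eq_true, Nat.beq_eq] at hkk
        have hz := rootPt_z (List.mem_filter.mp hk).2 B 0
        have hz' := rootPt_z (List.mem_filter.mp hk').2 B 0
        try change k' ≠ k → _ ≠ _
        rw [← hz, ← hz', ← rootPt_x B 0 k, ← rootPt_x B 0 k']
        intro _ heq
        apply hkk
        simp only [Nat.add_eq, Nat.mul_eq]
        zify
        first | linear_combination heq | linear_combination -heq
    exact fun k hk k' hk' hX hX' => hsymm k (List.mem_filter.mpr ⟨hk, hX⟩) k'
      (List.mem_filter.mpr ⟨hk', hX'⟩)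

theorem natDegree_lin_le (B : ℕ) (k : ℕ) :
    (lin (X : ℚ[X][X]) (C (B : ℚ[X])) 1 (C X) k).natDegree ≤ if hasX k then 1 else 0 := by
  have h : lin (X : ℚ[X][X]) (C (B : ℚ[X])) 1 (C X) k = C ((dig (k / 1024) : ℤ) : ℚ[X]) * X
      + C ((if k < 32768 then X else 0) + ((dig (k / 32) : ℤ) : ℚ[X]) * (B : ℚ[X])
        + ((dig k : ℤ) : ℚ[X])) := by
    rw [lin]
    split_ifs <;> simp only [map_add, map_mul, map_natCast, map_intCast, map_zero] <;> ring
  rw [h]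
  by_cases hk : hasX k = true
  · rw [if_pos hk]
    exact natDegree_linear_le
  · have h0 : dig (k / 1024) = 0 := by
      rw [dig_eq]
      have h1 : Nat.beq (k / 1024 % 32) 16 = true := by
        cases hb : Nat.beq (k / 1024 % 32) 16
        · refine absurd ?_ hk
          change Bool.not (Nat.beq (k / 1024 % 32) 16) = true
          rw [hb]
          rfl
        · rfl
      rw [Nat.beq_eq] at h1
      omega
    rw [if_neg hk, h0, Int.cast_zero, C_0, zero_mul, zero_add, natDegree_C]

theorem natDegree_prodE_le {R : Type*} [CommRing R] {v : ℕ → R[X]}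
    (hv : ∀ k, (v k).natDegree ≤ if hasX k then 1 else 0) (G : List (ℕ × ℕ)) (es : List ℕ) :
    (prodE v G es).natDegree ≤ zipSum G hasX es := by
  induction G generalizing es with
  | nil => cases es <;> simp [prodE]
  | cons g G ih =>
    cases es with
    | nil => simp [prodE]
    | cons e es =>
      have h : zipSum (g :: G) hasX (e :: es)
        = cond (hasX g.1) (e + zipSum G hasX es) (zipSum G hasX es) := rfl
      refine natDegree_mul_le.trans ?_
      have h1 : (v g.1 ^ e).natDegree ≤ e * if hasX g.1 then 1 else 0 :=
        natDegree_pow_le.trans (Nat.mul_le_mul_left _ (hv _))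
      have h2 := ih es
      rw [h]
      cases hx : hasX g.1
      · simp only [hx, Bool.false_eq_true, if_false, mul_zero, cond_false] at h1 ⊢
        omega
      · simp only [hx, if_true, mul_one, cond_true] at h1 ⊢
        omega

variable {d D B S : ℕ} {G : List (ℕ × ℕ)} {rs : List Row}

theorem Bounded.pos (h : Bounded d D B S G rs) : 1 ≤ B :=
  Nat.one_le_iff_ne_zero.mpr fun h0 => by have := h.height_lt; omega

/-- Vanishing for one large value of `s` implies vanishing for all values. -/
theorem Bounded.numer_poly_s (h : Bounded d D B S G rs) {k : ℕ} (hX : isX k = true)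
    (h0 : numerAt G rs (rootPt B S k) = 0) :
    numer G rs ((-(dig (k / 32) * B + dig k) : ℤ) : ℤ[X]) ((dig (k / 1024) * B : ℤ) : ℤ[X])
      ((dig (k / 1024) : ℤ) : ℤ[X]) X = 0 := by
  have hν := isL1_polyNorm isL1_int
  have hB := h.pos
  have hdig : ∀ n, -16 ≤ dig n ∧ dig n ≤ 15 := fun n => by rw [dig_eq]; omega
  have hbound : ∀ n : ℤ, n.natAbs ≤ 32 * B →
      polyNorm Int.natAbs (n : ℤ[X]) ≤ 32 * B := fun n hn => (hν.intCast n).trans hn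
  refine eq_zero_of_eval_eq_zero isL1_int (B := S) _ ?_ ?_
  -- As digits have absolute value at most 16, the constant coordinates are bounded by 16 (B + 1) ≤
  -- 32 B.
  · refine (norm_numer_le hν h.isSome h.degree (W := 32 * B) ?_ ?_ ?_ ?_).trans_lt h.height_mul_lt
    · apply hbound
      have h1 := hdig (k / 32)
      have h2 := hdig k
      have h3 : -(16 * (B : ℤ)) ≤ dig (k / 32) * B := by nlinarith
      have h4 : dig (k / 32) * B ≤ 15 * (B : ℤ) := by nlinarith
      omega
    · apply hbound
      have h1 := hdig (k / 1024)
      rw [Int.natAbs_mul, Int.natAbs_natCast]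
      exact Nat.mul_le_mul_right _ (by omega)
    · apply hbound
      have h1 := hdig (k / 1024)
      omega
    · exact (polyNorm_X_le isL1_int).trans (by omega)
  · have h1 := map_numer (evalRingHom (S : ℤ)) G rs ((-(dig (k / 32) * B + dig k) : ℤ) : ℤ[X])
      ((dig (k / 1024) * B : ℤ) : ℤ[X]) ((dig (k / 1024) : ℤ) : ℤ[X]) X
    rw [map_intCast, map_intCast, map_intCast, coe_evalRingHom, eval_X] at h1
    rw [numerAt, rootPt_x, rootPt_y] at h0
    push_cast at h0
    rw [rootPt_z hX] at h0
    simpa using h1.trans h0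

/-- The variables are treated in the order s, x, y. At each zero found, the numerator vanishes as a
polynomial in s. Hence at y = B, z = 1 it is a polynomial in x over ℚ[s] of degree less than D with
D zeros. Finally, as a polynomial in y it vanishes at B, which exceeds its norm. The resulting
identity in ℤ[s][x][y] specializes to every commutative ring. -/
theorem Bounded.numer_eq_zero (h : Bounded d D B S G rs) (ks : Finset ℕ)
    (hks : ∀ k ∈ ks, k ∈ G.map Prod.fst ∧ isX k = true ∧ numerAt G rs (rootPt B S k) = 0)
    (hD : D ≤ ks.card) {R : Type*} [CommRing R] (x y s : R) : numer G rs x y 1 s = 0 := by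
  -- the zero of the form `k`, as a constant polynomial in `s`
  let ρ : ℕ → ℚ[X] := fun k =>
    C ((-(dig (k / 32) * B + dig k) : ℤ) / (dig (k / 1024) : ℤ) : ℚ)
  have ha : ∀ k ∈ ks, (dig (k / 1024) : ℚ) ≠ 0 := by
    intro k hk
    have h1 := (isX_iff k).mp (hks k hk).2.1
    have h2 : dig (k / 1024) ≠ 0 := by rw [dig_eq]; omega
    exact_mod_cast h2
  have hρ : Set.InjOn ρ ks := by
    intro k hk k' hk' he
    by_contra hne
    have h1 := h.distinct k (hks k hk).1 k' (hks k' hk').1 (hks k hk).2.1 (hks k' hk').2.1 hne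
    apply h1
    have h2 := C_injective he
    rw [div_eq_div_iff (ha k hk) (ha k' hk')] at h2
    have h3 : (((-(dig (k / 32) * B + dig k)) * dig (k' / 1024) : ℤ) : ℚ)
        = ((-(dig (k' / 32) * B + dig k') * dig (k / 1024) : ℤ) : ℚ) := by
      push_cast at h2 ⊢
      exact h2
    have h4 : (-(dig (k / 32) * B + dig k)) * dig (k' / 1024)
        = -(dig (k' / 32) * B + dig k') * dig (k / 1024) := by exact_mod_cast h3
    linear_combination h4
  have hQ : numer G rs (X : ℚ[X][X]) (C (B : ℚ[X])) 1 (C X) = 0 := by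
    refine eq_zero_of_degree_lt_of_eval_finset_eq_zero (ks.image ρ) ?_ ?_
    · rw [Finset.card_image_of_injOn hρ]
      refine lt_of_lt_of_le ?_ (Nat.cast_le.mpr hD)
      rw [← mem_degreeLT, numer]
      refine list_sum_mem fun p hp => ?_
      obtain ⟨r, hr, rfl⟩ := List.mem_map.mp hp
      rw [mem_degreeLT]
      refine lt_of_le_of_lt degree_le_natDegree (Nat.cast_lt.mpr ?_)
      refine lt_of_le_of_lt ?_ (h.degreeX r hr)
      refine natDegree_mul_le.trans ?_
      rw [natDegree_intCast, zero_add]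
      exact natDegree_prodE_le (natDegree_lin_le B) _ _
    · intro q hq
      obtain ⟨k, hk, rfl⟩ := Finset.mem_image.mp hq
      have h1 := h.numer_poly_s (hks k hk).2.1 (hks k hk).2.2
      have h2 := map_numer (evalRingHom (ρ k)) G rs (X : ℚ[X][X]) (C (B : ℚ[X])) 1 (C X)
      simp only [coe_evalRingHom, eval_X, eval_C, map_one] at h2
      rw [h2]
      set a : ℚ[X] := C ((dig (k / 1024) : ℤ) : ℚ)
      -- The zero has denominator a. The known relation at the integral point is used with s
      -- replaced by a s; homogeneity then divides all four coordinates by a.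
      have h3 := congrArg (eval₂RingHom (Int.castRingHom ℚ[X]) (a * X)) h1
      rw [map_numer, map_zero] at h3
      simp only [map_intCast, coe_eval₂RingHom, eval₂_X] at h3
      have h4 := numer_smul h.degree a (ρ k) (B : ℚ[X]) 1 X
      have h5 : a * ρ k = ((-(dig (k / 32) * B + dig k) : ℤ) : ℚ[X]) := by
        rw [← C_mul, mul_div_cancel₀ _ (ha k hk)]
        exact C_eq_intCast _
      have h6 : a * (B : ℚ[X]) = ((dig (k / 1024) * B : ℤ) : ℚ[X]) := by
        push_cast
        rw [← C_eq_intCast]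
      have h7 : a * 1 = ((dig (k / 1024) : ℤ) : ℚ[X]) := by rw [mul_one, ← C_eq_intCast]
      rw [h5, h6, h7, h3] at h4
      have h8 : a ^ d ≠ 0 := pow_ne_zero _ (C_ne_zero.mpr (ha k hk))
      exact (mul_eq_zero.mp h4.symm).resolve_left h8
  have hZ : numer G rs (X : ℤ[X][X]) (C (B : ℤ[X])) 1 (C X) = 0 := by
    apply map_injective (mapRingHom (Int.castRingHom ℚ))
      (map_injective _ (Int.cast_injective (α := ℚ)))
    rw [Polynomial.map_zero, ← coe_mapRingHom, map_numer, ← hQ]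
    simp
  have hν := isL1_polyNorm (isL1_polyNorm isL1_int)
  have hY : numer G rs (C X : ℤ[X][X][X]) X 1 (C (C X)) = 0 := by
    refine eq_zero_of_eval_eq_zero hν (B := B) _ ?_ ?_
    · refine (norm_numer_le (isL1_polyNorm hν) h.isSome h.degree (W := 1) ?_ ?_ ?_ ?_).trans_lt
        (by simpa using h.height_lt)
      · rw [polyNorm_C hν]; exact polyNorm_X_le (isL1_polyNorm isL1_int)
      · exact polyNorm_X_le hν
      · exact (isL1_polyNorm hν).one
      · rw [polyNorm_C hν, polyNorm_C (isL1_polyNorm isL1_int)]; exact polyNorm_X_le isL1_int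
    · have h1 := map_numer (evalRingHom (B : ℤ[X][X])) G rs (C X : ℤ[X][X][X]) X 1 (C (C X))
      simp only [coe_evalRingHom, eval_X, eval_C, map_one] at h1
      rw [h1, ← hZ]
      simp
  have h1 := map_numer (eval₂RingHom (eval₂RingHom (eval₂RingHom (Int.castRingHom R) s) x) y) G rs
    (C X : ℤ[X][X][X]) X 1 (C (C X))
  rw [hY, map_zero] at h1
  simpa using h1.symm

end VertexTable

namespace VertexTable

/-! ### Vanishing of the sum of the rows -/

/-- The product of powers encoded by a list, for values `v` of the linear forms. -/
noncomputable def ev {F : Type*} [Field F] (v : ℕ → F) (l : VL) : F :=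
  (l.map fun p => v p.1 ^ p.2).prod

section Ev
variable {F : Type*} [Field F] {v : ℕ → F}

theorem ev_nil : ev v [] = 1 := rfl

theorem ev_cons (p : ℕ × ℤ) (l : VL) : ev v (p :: l) = v p.1 ^ p.2 * ev v l := by
  simp [ev]

theorem ev_congr {w : ℕ → F} {l : VL} (h : ∀ p ∈ l, v p.1 = w p.1) : ev v l = ev w l := by
  rw [ev, ev, List.map_congr_left fun p hp => by rw [h p hp]]

theorem ev_mul_prodDen {l : VL} (h : ∀ p ∈ l, v p.1 ≠ 0) : ev v l * prodDen v l = prodNum v l := by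
  induction l with
  | nil => simp [ev, prodDen, prodNum]
  | cons p l ih =>
    have h1 := ih fun q hq => h q (by simp [hq])
    have h2 : v p.1 ^ p.2 * v p.1 ^ (-p.2).toNat = v p.1 ^ p.2.toNat := by
      have h0 := h p (by simp)
      rw [← zpow_natCast, ← zpow_natCast, ← zpow_add₀ h0]
      congr 1
      omega
    simp only [ev, prodDen, prodNum, List.map_cons, List.prod_cons] at h1 ⊢
    rw [← h2, ← h1]
    ring

theorem prodDen_ne_zero {l : VL} (h : ∀ p ∈ l, v p.1 ≠ 0) : prodDen v l ≠ 0 := by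
  rw [prodDen]
  refine List.prod_ne_zero fun h0 => ?_
  obtain ⟨p, hp, h1⟩ := List.mem_map.mp h0
  exact pow_ne_zero _ (h p hp) h1

theorem prodG_ne_zero {G : List (ℕ × ℕ)} (h : ∀ g ∈ G, v g.1 ≠ 0) : prodG v G ≠ 0 := by
  rw [prodG]
  refine List.prod_ne_zero fun h0 => ?_
  obtain ⟨p, hp, h1⟩ := List.mem_map.mp h0
  exact pow_ne_zero _ (h p hp) h1

theorem mem_of_dense {G : List (ℕ × ℕ)} : ∀ {l : VL}, (dense G l).isSome →
    ∀ p ∈ l, ∃ g ∈ G, g.1 = p.1 := by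
  induction G with
  | nil =>
    intro l h p hp
    rw [dense_nil] at h
    split_ifs at h with h0
    · simp [h0] at hp
    · simp at h
  | cons g G ih =>
    intro l h p hp
    cases l with
    | nil => simp at hp
    | cons q l =>
      rw [dense_cons_cons] at h
      split_ifs at h with h0 h1
      · rw [Option.isSome_map] at h
        rcases List.mem_cons.mp hp with rfl | hp
        · exact ⟨g, by simp, h0⟩
        · obtain ⟨g', hg', he⟩ := ih h p hp
          exact ⟨g', by simp [hg'], he⟩
      · simp at h
      · rw [Option.isSome_map] at h
        obtain ⟨g', hg', he⟩ := ih h p hp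
        exact ⟨g', by simp [hg'], he⟩

theorem prodG_mul_ev {G : List (ℕ × ℕ)} (hG : ∀ g ∈ G, v g.1 ≠ 0) {l : VL}
    (h : (dense G l).isSome) : prodG v G * ev v l = prodE v G (exps G l) := by
  obtain ⟨es, hes⟩ := Option.isSome_iff_exists.mp h
  have hl : ∀ p ∈ l, v p.1 ≠ 0 := fun p hp => by
    obtain ⟨g, hg, he⟩ := mem_of_dense h p hp
    rw [← he]
    exact hG g hg
  have h1 := (dense_spec v G l es hes).2
  rw [← ev_mul_prodDen hl, ← mul_assoc] at h1
  rw [exps, hes]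
  exact mul_right_cancel₀ (prodDen_ne_zero hl) h1

theorem ev_congr_of_dense {w : ℕ → F} {G : List (ℕ × ℕ)} (hG : ∀ g ∈ G, nonzeroForm g.1 = true)
    (hw : ∀ k, nonzeroForm k = true → v k = w k) {l : VL} (h : (dense G l).isSome) :
    ev v l = ev w l :=
  ev_congr fun p hp => by
    obtain ⟨g, hg, he⟩ := mem_of_dense h p hp
    rw [← he]
    exact hw _ (hG g hg)

theorem prodG_mul_sum {x y z s : F} {G : List (ℕ × ℕ)} {rs : List Row}
    (hG : ∀ g ∈ G, lin x y z s g.1 ≠ 0) (h : ∀ r ∈ rs, (dense G r.2).isSome) :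
    prodG (lin x y z s) G * (rs.map fun r => (r.1 : F) * ev (lin x y z s) r.2).sum
      = numer G rs x y z s := by
  rw [numer, ← List.sum_map_mul_left]
  congr 1
  refine List.map_congr_left fun r hr => ?_
  rw [← prodG_mul_ev hG (h r hr)]
  ring

end Ev

/-- Zeros of linear forms at which the numerator has been found to vanish. -/
theorem mem_roots {n : ℕ} {cs : List ℤ} {τ lo hi d D B S : ℕ}
    (hb : Bounded d D B S (lcmL (allRows n cs)) (allRows n cs)) {c : ℕ}
    (h : checkRoots n cs τ lo hi c B S = true) : ∃ ks : Finset ℕ, c ≤ ks.card ∧ ∀ k ∈ ks,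
      k ∈ (lcmL (allRows n cs)).map Prod.fst ∧ lo ≤ k ∧ k < hi ∧ isX k = true ∧
        numerAt (lcmL (allRows n cs)) (allRows n cs) (rootPt B S k) = 0 := by
  rw [checkRoots, Nat.ble_eq, len_eq, mapR_eq] at h
  have h1 := roots_spec (τ := τ) (lo := lo) (hi := hi) (B := B) (S := S)
    (suf := lcmL (allRows n cs)) (pre := [])
    (rs := (allRows n cs).map fun r => (r.1, r.2, r.2)) hb.nodup (by
      intro r hr
      obtain ⟨r', hr', rfl⟩ := List.mem_map.mp hr
      obtain ⟨es, hes⟩ := Option.isSome_iff_exists.mp (hb.isSome r' hr')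
      exact ⟨[], es, hes, rfl, hes⟩)
  rw [List.nil_append, List.map_map] at h1
  refine ⟨(roots τ lo hi B S (lcmL (allRows n cs)) (lcmL (allRows n cs))
    ((allRows n cs).map fun r => (r.1, r.2, r.2))).toFinset, ?_, ?_⟩
  · rw [List.toFinset_card_of_nodup (h1.1.nodup hb.nodup)]
    exact h
  · intro k hk
    rw [List.mem_toFinset] at hk
    obtain ⟨h2, h3, h4, h5⟩ := h1.2 k hk
    refine ⟨h1.1.subset hk, h2, h3, h4, ?_⟩
    convert h5
    simp [Function.comp_def]

/-- Homogeneity reduces to z = 1. Only the values of v at nonzero forms enter, which admits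
`formNZ`, a function without zeros, in the place of the linear forms themselves. -/
theorem sum_rows_eq_zero_of_roots {n : ℕ} {cs : List ℤ} {d D B S : ℕ}
    (hb : Bounded d D B S (lcmL (allRows n cs)) (allRows n cs)) {ks : Finset ℕ}
    (hks : ∀ k ∈ ks, k ∈ (lcmL (allRows n cs)).map Prod.fst ∧ isX k = true ∧
      numerAt (lcmL (allRows n cs)) (allRows n cs) (rootPt B S k) = 0)
    (hD : D ≤ ks.card) {F : Type*} [Field F] {x y z s : F} (hz : z ≠ 0)
    (hl : ∀ k, nonzeroForm k = true → lin x y z s k ≠ 0) {v : ℕ → F}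
    (hv : ∀ k, nonzeroForm k = true → v k = lin x y z s k) :
    ((allRows n cs).map fun r => (r.1 : F) * ev v r.2).sum = 0 := by
  have h1 := hb.numer_eq_zero ks hks hD (x / z) (y / z) (s / z)
  have h2 := numer_smul hb.degree z (x / z) (y / z) 1 (s / z)
  rw [h1, mul_zero, mul_div_cancel₀ _ hz, mul_div_cancel₀ _ hz, mul_div_cancel₀ _ hz,
    mul_one] at h2
  have hG : ∀ g ∈ lcmL (allRows n cs), lin x y z s g.1 ≠ 0 := fun g hg => hl _ (hb.nonzero g hg)
  rw [← prodG_mul_sum hG hb.isSome] at h2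
  have h3 : ((allRows n cs).map fun r => (r.1 : F) * ev v r.2)
      = (allRows n cs).map fun r => (r.1 : F) * ev (lin x y z s) r.2 :=
    List.map_congr_left fun r hr => by
      rw [ev_congr_of_dense hb.nonzero hv (hb.isSome r hr)]
  rw [h3]
  exact (mul_eq_zero.mp h2).resolve_left (prodG_ne_zero hG)

theorem sum_rows_eq_zero {n : ℕ} {cs : List ℤ} {τ d D B S : ℕ}
    (hT : checkTable n cs d D B S = true) (hR : checkRoots n cs τ 0 65536 D B S = true)
    {F : Type*} [Field F] {x y z s : F} (hz : z ≠ 0)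
    (hl : ∀ k, nonzeroForm k = true → lin x y z s k ≠ 0) {v : ℕ → F}
    (hv : ∀ k, nonzeroForm k = true → v k = lin x y z s k) :
    ((allRows n cs).map fun r => (r.1 : F) * ev v r.2).sum = 0 := by
  have hb := bounded_of_checkBounds hT
  obtain ⟨ks, hc, hks⟩ := mem_roots hb hR
  exact sum_rows_eq_zero_of_roots hb
    (fun k hk => ⟨(hks k hk).1, (hks k hk).2.2.2.1, (hks k hk).2.2.2.2⟩) hc hz hl hv

/-- The same, if the zeros have been found in three intervals. -/
theorem sum_rows_eq_zero_of_three {n : ℕ} {cs : List ℤ} {τ m m' c₁ c₂ c₃ d D B S : ℕ}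
    (hT : checkTable n cs d D B S = true) (h₁ : checkRoots n cs τ 0 m c₁ B S = true)
    (h₂ : checkRoots n cs τ m m' c₂ B S = true) (h₃ : checkRoots n cs τ m' 65536 c₃ B S = true)
    (hm : m ≤ m') (hD : D = c₁ + c₂ + c₃) {F : Type*} [Field F] {x y z s : F} (hz : z ≠ 0)
    (hl : ∀ k, nonzeroForm k = true → lin x y z s k ≠ 0) {v : ℕ → F}
    (hv : ∀ k, nonzeroForm k = true → v k = lin x y z s k) :
    ((allRows n cs).map fun r => (r.1 : F) * ev v r.2).sum = 0 := by
  have hb := bounded_of_checkBounds hT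
  obtain ⟨k₁, hc₁, h₁⟩ := mem_roots hb h₁
  obtain ⟨k₂, hc₂, h₂⟩ := mem_roots hb h₂
  obtain ⟨k₃, hc₃, h₃⟩ := mem_roots hb h₃
  refine sum_rows_eq_zero_of_roots hb (ks := k₁ ∪ k₂ ∪ k₃) (fun k hk => ?_) ?_ hz hl hv
  · rw [Finset.mem_union, Finset.mem_union] at hk
    rcases hk with (hk | hk) | hk
    · exact ⟨(h₁ k hk).1, (h₁ k hk).2.2.2.1, (h₁ k hk).2.2.2.2⟩
    · exact ⟨(h₂ k hk).1, (h₂ k hk).2.2.2.1, (h₂ k hk).2.2.2.2⟩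
    · exact ⟨(h₃ k hk).1, (h₃ k hk).2.2.2.1, (h₃ k hk).2.2.2.2⟩
  · rw [Finset.card_union_of_disjoint, Finset.card_union_of_disjoint]
    · omega
    · rw [Finset.disjoint_left]
      intro k h h'
      have := (h₁ k h).2.2.1
      have := (h₂ k h').2.1
      omega
    · rw [Finset.disjoint_left]
      intro k h h'
      rw [Finset.mem_union] at h
      have h4 := (h₃ k h').2.1
      rcases h with h | h
      · have := (h₁ k h).2.2.1
        omega
      · have := (h₂ k h).2.2.1
        omega

/-! ### Independence -/

/-- The sum of a function over the rows, if the function vanishes where `δ` does. -/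
def SameSum (δ : URow → ℤ) (l l' : List URow) : Prop :=
  ∀ f : URow → ℤ, (∀ r, δ r = 0 → f r = 0) → (l.map f).sum = (l'.map f).sum

/-- The values are known up to signs σ. If M divides all values except that of q₀, the relation
gives M ∣ δ σ q₀.1; with δ = ±1 this would make M divide the value of q₀ as well. So δ is 0 there,
the row may be dropped, and the relation persists for the others. -/
theorem strip_spec {δ : URow → ℤ} (hδ : ∀ r, δ r = -1 ∨ δ r = 0 ∨ δ r = 1) (p fuel : ℕ) :
    ∀ l : List (ℕ × URow), (∃ σ : URow → ℤ, (∀ r, σ r = 1 ∨ σ r = -1) ∧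
      (l.map fun q => δ q.2 * (σ q.2 * q.1)).sum = 0) →
      (∀ q ∈ l, δ q.2 = 0 ∨ q ∈ strip p fuel l) ∧
      SameSum δ (l.map Prod.snd) ((strip p fuel l).map Prod.snd) ∧ ∀ q ∈ strip p fuel l, q ∈ l := by
  induction fuel with
  | zero => exact fun l _ => ⟨fun q hq => Or.inr hq, fun f _ => rfl, fun q hq => hq⟩
  | succ fuel ih =>
    rintro l ⟨σ, hσ, h⟩
    set M := Nat.mul p (foldR (fun q g => Nat.gcd q.1 g) 0 l) with hM
    have hs : strip p (fuel + 1) l = cond (Nat.beq (len (filterR (fun q =>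
        Bool.not (Nat.beq (Nat.mod q.1 M) 0)) l)) 1)
      (strip p fuel (filterR (fun q => Nat.beq (Nat.mod q.1 M) 0) l)) l := rfl
    clear_value M
    rw [filterR_eq, filterR_eq, len_eq] at hs
    rw [hs]
    cases hb : Nat.beq (List.filter (fun q => Bool.not (Nat.beq (Nat.mod q.1 M) 0)) l).length 1
    · exact ⟨fun q hq => Or.inr hq, fun f _ => rfl, fun q hq => hq⟩
    rw [Nat.beq_eq, List.length_eq_one_iff] at hb
    obtain ⟨q₀, hq₀⟩ := hb
    rw [cond_true]
    have hsplit : ∀ f : ℕ × URow → ℤ, (l.map f).sum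
        = f q₀ + ((l.filter fun q => Nat.beq (Nat.mod q.1 M) 0).map f).sum := by
      intro f
      have h1 := (List.filter_append_perm (fun q : ℕ × URow => Nat.beq (Nat.mod q.1 M) 0) l).map f
      rw [← h1.sum_eq, List.map_append, List.sum_append, add_comm]
      congr 1
      have h2 : (l.filter fun q => !Nat.beq (Nat.mod q.1 M) 0) = [q₀] := hq₀
      rw [h2]
      simp
    have hdvd : ∀ q : ℕ × URow, Nat.beq (Nat.mod q.1 M) 0 = true ↔ (M : ℤ) ∣ q.1 := by
      intro q
      rw [Nat.beq_eq, Int.natCast_dvd_natCast]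
      exact (Nat.dvd_iff_mod_eq_zero).symm
    have h0 : δ q₀.2 = 0 := by
      by_contra h0
      have h1 := hsplit fun q => δ q.2 * (σ q.2 * q.1)
      rw [h] at h1
      have h2 : (M : ℤ) ∣ ((l.filter fun q => Nat.beq (Nat.mod q.1 M) 0).map
          fun q => δ q.2 * (σ q.2 * q.1)).sum := by
        refine List.dvd_sum fun a ha => ?_
        obtain ⟨q, hq, rfl⟩ := List.mem_map.mp ha
        exact Dvd.dvd.mul_left (Dvd.dvd.mul_left ((hdvd q).mp (List.mem_filter.mp hq).2) _) _
      have h3 : (M : ℤ) ∣ δ q₀.2 * (σ q₀.2 * q₀.1) := by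
        have : δ q₀.2 * (σ q₀.2 * q₀.1) = -((l.filter fun q => Nat.beq (Nat.mod q.1 M) 0).map
          fun q => δ q.2 * (σ q.2 * q.1)).sum := by linarith
        rw [this]
        exact h2.neg_right
      have h4 : (M : ℤ) ∣ q₀.1 := by
        rcases hσ q₀.2 with h5 | h5 <;> rcases hδ q₀.2 with h6 | h6 | h6
        all_goals first
          | exact absurd h6 h0
          | (rw [h5, h6] at h3
             simpa only [one_mul, neg_mul, neg_neg, dvd_neg] using h3)
      have h5 : q₀ ∈ l.filter fun q => Bool.not (Nat.beq (Nat.mod q.1 M) 0) := by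
        rw [hq₀]; simp
      have h6 := (List.mem_filter.mp h5).2
      rw [(hdvd q₀).mpr h4] at h6
      simp at h6
    have hsum : ∀ f : ℕ × URow → ℤ, f q₀ = 0 → (l.map f).sum
        = ((l.filter fun q => Nat.beq (Nat.mod q.1 M) 0).map f).sum := fun f hf => by
      rw [hsplit, hf, zero_add]
    obtain ⟨h1, h2, h3⟩ := ih (l.filter fun q => Nat.beq (Nat.mod q.1 M) 0) ⟨σ, hσ, by
      rw [← hsum _ (by rw [h0, zero_mul]), h]⟩
    refine ⟨?_, ?_, fun q hq => (List.mem_filter.mp (h3 q hq)).1⟩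
    · intro q hq
      cases hm : Nat.beq (Nat.mod q.1 M) 0
      · have h5 : q ∈ l.filter fun q => Bool.not (Nat.beq (Nat.mod q.1 M) 0) :=
          List.mem_filter.mpr ⟨hq, by rw [hm]; rfl⟩
        rw [hq₀, List.mem_singleton] at h5
        exact Or.inl (h5 ▸ h0)
      · exact h1 q (List.mem_filter.mpr ⟨hq, hm⟩)
    · intro f hf
      rw [← h2 f hf, List.map_map, List.map_map]
      exact hsum _ (hf _ h0)

/-- The sum `∑ δ_r X_r` vanishes at all integer points, for the numerators `X_r` of the rows. -/
def Vanishes (G : List (ℕ × ℕ)) (δ : URow → ℤ) (rs : List URow) : Prop :=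
  ∀ x y z s : ℤ, (rs.map fun r => δ r * prodE (lin x y z s) G (exps G r.2)).sum = 0

theorem prodE_eq_one_or {v : ℕ → ℤ} (hv : ∀ k, v k = 1 ∨ v k = -1) : ∀ (G : List (ℕ × ℕ))
    (es : List ℕ), prodE v G es = 1 ∨ prodE v G es = -1
  | [], _ => Or.inl (by simp [prodE])
  | _ :: _, [] => Or.inl (by simp [prodE])
  | g :: G, e :: es => by
    have h1 := prodE_eq_one_or hv G es
    have h2 : v g.1 ^ e = 1 ∨ v g.1 ^ e = -1 := by
      rcases hv g.1 with h | h
      · left; rw [h, one_pow]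
      · rw [h]; exact neg_one_pow_eq_or ℤ e
    rw [prodE]
    rcases h1 with h1 | h1 <;> rcases h2 with h2 | h2 <;> rw [h1, h2] <;> norm_num

theorem stripAt_spec {G : List (ℕ × ℕ)} {δ : URow → ℤ}
    (hδ : ∀ r, δ r = -1 ∨ δ r = 0 ∨ δ r = 1) (P : Pt) (p : ℕ) {rs : List URow}
    (hG : ∀ r ∈ rs, (dense G r.2).isSome) (h : Vanishes G δ rs) :
    (∀ r ∈ rs, δ r = 0 ∨ r ∈ stripAt G P p rs) ∧ SameSum δ rs (stripAt G P p rs) ∧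
      ∀ r ∈ stripAt G P p rs, r ∈ rs := by
  cases hd : all (fun r : URow => Nat.blt 0 (denOf (evAbs P) r.2)) rs
  · rw [stripAt, hd]
    exact ⟨fun r hr => Or.inr hr, fun f _ => rfl, fun r hr => hr⟩
  rw [stripAt, hd, cond_true, mapR_eq, mapR_eq]
  rw [all_iff] at hd
  set l : List (ℕ × URow) := rs.map fun r => (quo (lcmVal (evAbs P) G) (evAbs P) r.2, r) with hl
  have hsnd : l.map Prod.snd = rs := by simp [hl, Function.comp_def]
  obtain ⟨h1, h2, h3⟩ := strip_spec hδ p 20 l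
    ⟨fun r => prodE (fun k => sign (evNeg P k)) G (exps G r.2), fun r => prodE_eq_one_or
      (fun k => by cases evNeg P k; exacts [Or.inl rfl, Or.inr rfl]) _ _, by
      rw [← h ((P.xp : ℤ) - P.xn) P.y P.z P.s, hl, List.map_map]
      congr 1
      refine List.map_congr_left fun r hr => ?_
      obtain ⟨es, hes⟩ := Option.isSome_iff_exists.mp (hG r hr)
      have h4 := hd r hr
      rw [Nat.blt_eq] at h4
      have h5 : ((prodE (evAbs P) G es : ℕ) : ℤ) = prodE (fun k => (evAbs P k : ℤ)) G es :=
        map_prodE (Nat.castRingHom ℤ : ℕ →* ℤ) (evAbs P) G es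
      have h6 : lin ((P.xp : ℤ) - P.xn) (P.y : ℤ) (P.z : ℤ) (P.s : ℤ)
        = fun k => sign (evNeg P k) * (evAbs P k : ℤ) := funext fun k => lin_eq_sign_mul P k
      simp only [Function.comp, exps, hes, Option.getD_some]
      rw [quo_eq _ G r.2 es hes h4, h5, h6, prodE_mul]⟩
  rw [hsnd] at h2
  refine ⟨fun r hr => ?_, h2, fun r hr => ?_⟩
  · rw [← hsnd] at hr
    obtain ⟨q, hq, rfl⟩ := List.mem_map.mp hr
    exact (h1 q hq).imp_right fun h => List.mem_map_of_mem h
  · obtain ⟨q, hq, rfl⟩ := List.mem_map.mp hr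
    rw [← hsnd]
    exact List.mem_map_of_mem (h3 q hq)

theorem Vanishes.of_sameSum {G : List (ℕ × ℕ)} {δ : URow → ℤ} {rs rs' : List URow}
    (h : Vanishes G δ rs) (h' : SameSum δ rs rs') : Vanishes G δ rs' := fun x y z s => by
  rw [← h x y z s]
  exact (h' _ fun r hr => by rw [hr, zero_mul]).symm

theorem mem_stripAll {G : List (ℕ × ℕ)} {δ : URow → ℤ}
    (hδ : ∀ r, δ r = -1 ∨ δ r = 0 ∨ δ r = 1) (ps : List (Pt × ℕ)) : ∀ {rs : List URow},
    (∀ r ∈ rs, (dense G r.2).isSome) → Vanishes G δ rs →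
      ∀ r ∈ rs, δ r = 0 ∨ r ∈ stripAll G ps rs := by
  induction ps with
  | nil => exact fun _ _ r hr => Or.inr hr
  | cons P ps ih =>
    intro rs hG h r hr
    obtain ⟨h1, h2, h3⟩ := stripAt_spec hδ P.1 P.2 hG h
    rcases h1 r hr with h4 | h4
    · exact Or.inl h4
    · exact ih (fun r hr => hG r (h3 r hr)) (h.of_sameSum h2) r h4

/-- The hypotheses verified by `checkRows`. -/
theorem of_checkRows {G : List (ℕ × ℕ)} {ps : List (Pt × ℕ)} {rs : List URow}
    (hc : checkRows G ps rs = true) : (∀ g ∈ G, nonzeroForm g.1 = true) ∧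
      (∀ r ∈ rs, (dense G r.2).isSome) ∧ stripAll G ps rs = [] := by
  rw [checkRows, Bool.and_eq_true, Bool.and_eq_true, all_iff, covers, all_iff, Nat.beq_eq, len_eq,
    List.length_eq_zero_iff] at hc
  refine ⟨hc.1.1, fun r hr => ?_, hc.2⟩
  have h1 := hc.1.2 r hr
  cases hd : dense G r.2 with
  | none => rw [hd] at h1; exact absurd h1 (by simp)
  | some es => rfl

/-- Nothing is left at the end of the elimination, and a row is only ever removed when its δ must be
0. -/
theorem eq_zero_of_checkRows {G : List (ℕ × ℕ)} {ps : List (Pt × ℕ)} {rs : List URow}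
    (hc : checkRows G ps rs = true) {δ : URow → ℤ} (hδ : ∀ r, δ r = -1 ∨ δ r = 0 ∨ δ r = 1)
    (h : Vanishes G δ rs) : ∀ r ∈ rs, δ r = 0 := by
  obtain ⟨-, h1, h2⟩ := of_checkRows hc
  intro r hr
  refine (mem_stripAll hδ ps h1 h r hr).resolve_right ?_
  rw [h2]
  exact List.not_mem_nil

end VertexTable

namespace VertexTable

/-! ### Linear forms in the field of the identity -/

/-- The form `d₁ λ₁ + d₂ λ₂ + d₃ λ₃ + d₄ λ₄`. -/
noncomputable def sForm : LamDField := ∑ i : Fin 4, dvar i * lamD i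

/-- The value of a linear form at `x = λ₁`, `y = λ₂`, `z = λ₃`, `s = ∑ d_i λ_i`. -/
noncomputable def form : ℕ → LamDField := lin (lamD 0) (lamD 1) (lamD 2) sForm

theorem lam_castSucc (i : Fin 3) :
    lam i.castSucc = algebraMap (MvPolynomial (Fin 3) ℚ) LamField (MvPolynomial.X i) := by
  rw [lam, Fin.snoc_castSucc]

theorem lam_three : lam 3 = -(lam 0 + lam 1 + lam 2) := by
  have h : lam 3 = -∑ i : Fin 3, algebraMap (MvPolynomial (Fin 3) ℚ) LamField
      (MvPolynomial.X i) := Fin.snoc_last _ _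
  rw [h, Fin.sum_univ_three, ← lam_castSucc, ← lam_castSucc, ← lam_castSucc]
  rfl

theorem lam_zero_ne_zero : lam 0 ≠ 0 := by
  change lam (Fin.castSucc 0) ≠ 0
  rw [lam_castSucc]
  exact (map_ne_zero_iff _ (IsFractionRing.injective _ _)).mpr (MvPolynomial.X_ne_zero _)

open MvPolynomial in
/-- A polynomial relation between `λ₁, λ₂, λ₃` and `∑ d_i λ_i` holds at all integer points. -/
theorem eq_zero_at_int {q : ∀ {R : Type} [CommRing R], R → R → R → R → R}
    (hq : ∀ {R R' : Type} [CommRing R] [CommRing R'] (f : R →+* R') (x y z s : R),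
      f (q x y z s) = q (f x) (f y) (f z) (f s))
    (h : q (lamD 0) (lamD 1) (lamD 2) sForm = 0) (x y z s : ℤ) : q x y z s = 0 := by
  have h1 : q (C (lam 0)) (C (lam 1)) (C (lam 2)) (∑ i : Fin 4, X i * C (lam i))
      = (0 : MvPolynomial (Fin 4) LamField) := by
    apply IsFractionRing.injective (MvPolynomial (Fin 4) LamField) LamDField
    rw [map_zero, ← h, hq, map_sum, sForm]
    congr 1
    exact Finset.sum_congr rfl fun i _ => map_mul _ _ _
  have h2 : q (lam 0) (lam 1) (lam 2) (s : LamField) = 0 := by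
    -- The choice d₁ = s / λ₁ and d₂ = d₃ = d₄ = 0 gives ∑ d_i λ_i the prescribed value s.
    have h2 := hq (eval (Pi.single 0 ((s : LamField) / lam 0) : Fin 4 → LamField)) (C (lam 0))
      (C (lam 1)) (C (lam 2)) (∑ i : Fin 4, X i * C (lam i))
    rw [h1, map_zero, eval_C, eval_C, eval_C, map_sum, Finset.sum_eq_single 0] at h2
    · rw [h2, map_mul, eval_X, eval_C, Pi.single_eq_same, div_mul_cancel₀ _ lam_zero_ne_zero]
    · intro i _ hi
      simp [hi]
    · simp
  have h3 : q (X 0) (X 1) (X 2) (s : MvPolynomial (Fin 3) ℚ) = 0 := by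
    apply IsFractionRing.injective (MvPolynomial (Fin 3) ℚ) LamField
    rw [map_zero, hq, map_intCast, ← h2, ← lam_castSucc, ← lam_castSucc, ← lam_castSucc]
    rfl
  have h4 := hq (eval (![(x : ℚ), y, z] : Fin 3 → ℚ)) (X 0) (X 1) (X 2)
    (s : MvPolynomial (Fin 3) ℚ)
  rw [h3, map_zero, eval_X, eval_X, eval_X, map_intCast] at h4
  have h5 := hq (Int.castRingHom ℚ) x y z s
  exact Int.cast_injective (α := ℚ) (h5.trans (h4.symm.trans Int.cast_zero.symm))

theorem form_ne_zero {k : ℕ} (hk : nonzeroForm k = true) : form k ≠ 0 := by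
  intro h0
  have h : ∀ x y z s : ℤ, lin x y z s k = 0 :=
    eq_zero_at_int (q := fun x y z s => lin x y z s k) (fun f x y z s => map_lin f x y z s k) h0
  rw [nonzeroForm, Bool.or_eq_true, Nat.blt_eq, Bool.not_eq_true', ← Bool.not_eq_true,
    Nat.beq_eq] at hk
  have h1 := h 0 0 0 1
  have h2 := h 1 0 0 0
  have h3 := h 0 1 0 0
  have h4 := h 0 0 1 0
  simp only [lin, dig_eq, mul_zero, mul_one, add_zero, zero_add, ite_self, Int.cast_id] at h1 h2 h3 h4
  rcases hk with hk | hk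
  · rw [if_pos hk] at h1
    exact one_ne_zero h1
  · apply hk
    change k % 32768 = 16912
    omega

theorem Vanishes.of_numer {G : List (ℕ × ℕ)} {δ : URow → ℤ} {rs : List URow}
    (h : numer G (rs.map fun r => (δ r, r.2)) (lamD 0) (lamD 1) (lamD 2) sForm = 0) :
    Vanishes G δ rs := by
  intro x y z s
  have h1 := eq_zero_at_int (q := fun x y z s => numer G (rs.map fun r => (δ r, r.2)) x y z s)
    (fun f x y z s => map_numer f G _ x y z s) h x y z s
  rw [numer, List.map_map] at h1
  simpa [Function.comp_def] using h1

theorem eq_zero_of_sum_eq_zero {G : List (ℕ × ℕ)} {ps : List (Pt × ℕ)} {rs : List URow}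
    (hc : checkRows G ps rs = true) {δ : URow → ℤ} (hδ : ∀ r, δ r = -1 ∨ δ r = 0 ∨ δ r = 1)
    {v : ℕ → LamDField} (hv : ∀ k, nonzeroForm k = true → v k = form k)
    (h : (rs.map fun r => (δ r : LamDField) * ev v r.2).sum = 0) : ∀ r ∈ rs, δ r = 0 := by
  obtain ⟨h1, h2, -⟩ := of_checkRows hc
  have h0 : (rs.map fun r => (δ r : LamDField) * ev v r.2)
      = rs.map fun r => (δ r : LamDField) * ev form r.2 :=
    List.map_congr_left fun r hr => by rw [ev_congr_of_dense h1 hv (h2 r hr)]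
  rw [h0] at h
  refine eq_zero_of_checkRows hc hδ (Vanishes.of_numer ?_)
  have h3 := prodG_mul_sum (x := lamD 0) (y := lamD 1) (z := lamD 2) (s := sForm) (G := G)
    (rs := rs.map fun r => (δ r, r.2)) (fun g hg => form_ne_zero (h1 g hg)) (by
      intro r hr
      obtain ⟨r', hr', rfl⟩ := List.mem_map.mp hr
      exact h2 r' hr')
  rw [← h3, List.map_map]
  exact mul_eq_zero_of_right _ h

end VertexTable

/-! ### From solid partitions and their vertices to the rows of the table. -/

namespace VertexTable

/-! ### Characters of `T` -/

/-- The weight encoded by a number. -/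
noncomputable def dec (k : ℕ) : Fin 3 → ℤ := ![dig (k / 1024), dig (k / 32), dig k]

/-- The weight encoded by `k` has entries of absolute value at most `r`. -/
def InBox (r : ℤ) (k : ℕ) : Prop :=
  |dig (k / 1024)| ≤ r ∧ |dig (k / 32)| ≤ r ∧ |dig k| ≤ r ∧ k < 32768

theorem InBox.mono {r r' : ℤ} (h : r ≤ r') {k : ℕ} (hk : InBox r k) : InBox r' k :=
  ⟨hk.1.trans h, hk.2.1.trans h, hk.2.2.1.trans h, hk.2.2.2⟩

theorem InBox.eq {r : ℤ} {k : ℕ} (h : InBox r k) :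
    (k : ℤ) = 16912 + 1024 * dig (k / 1024) + 32 * dig (k / 32) + dig k := by
  have h1 := h.2.2.2
  simp only [dig_eq]
  omega

/-- The two offsets are those of weights and of forms without s, 49680 = 16912 + 32768. Entries of
absolute value at most 15 cause no carries between the digits in base 32. -/
theorem dig_of_eq {a b c : ℤ} (ha : |a| ≤ 15) (hb : |b| ≤ 15) (hc : |c| ≤ 15) {k : ℕ}
    (h : (k : ℤ) = 16912 + 1024 * a + 32 * b + c ∨ (k : ℤ) = 49680 + 1024 * a + 32 * b + c) :
    dig (k / 1024) = a ∧ dig (k / 32) = b ∧ dig k = c := by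
  rw [abs_le] at ha hb hc
  simp only [dig_eq]
  omega

theorem InBox.shift {r r' : ℤ} {k z : ℕ} (hk : InBox r k) (hz : InBox r' z) (h : r + r' ≤ 15) :
    InBox (r + r') (k + z - 16912) ∧ dec (k + z - 16912) = dec k + dec z := by
  have h1 := hk.eq
  have h2 := hz.eq
  have ha := (abs_add_le _ _).trans (add_le_add hk.1 hz.1)
  have hb := (abs_add_le _ _).trans (add_le_add hk.2.1 hz.2.1)
  have hc := (abs_add_le _ _).trans (add_le_add hk.2.2.1 hz.2.2.1)
  have hlt : 16912 ≤ k + z ∧ k + z - 16912 < 32768 := by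
    have ha' := abs_le.mp (ha.trans h)
    have hb' := abs_le.mp (hb.trans h)
    have hc' := abs_le.mp (hc.trans h)
    omega
  obtain ⟨h3, h4, h5⟩ := dig_of_eq (ha.trans h) (hb.trans h) (hc.trans h) (k := k + z - 16912)
    (Or.inl (by push_cast [hlt.1]; linarith))
  refine ⟨⟨?_, ?_, ?_, hlt.2⟩, ?_⟩
  · rw [h3]; exact ha
  · rw [h4]; exact hb
  · rw [h5]; exact hc
  · rw [dec, h3, h4, h5]
    ext i
    fin_cases i <;> rfl

theorem InBox.neg {r : ℤ} {k : ℕ} (hk : InBox r k) (h : r ≤ 15) :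
    InBox r (33824 - k) ∧ dec (33824 - k) = -dec k := by
  have h1 := hk.eq
  have h2 := hk.2.2.2
  have ha := hk.1
  have hb := hk.2.1
  have hc := hk.2.2.1
  rw [← abs_neg] at ha hb hc
  have hlt : k ≤ 33824 ∧ 33824 - k < 32768 := by
    have ha' := abs_le.mp (ha.trans h)
    have hb' := abs_le.mp (hb.trans h)
    have hc' := abs_le.mp (hc.trans h)
    omega
  obtain ⟨h3, h4, h5⟩ := dig_of_eq (ha.trans h) (hb.trans h) (hc.trans h) (k := 33824 - k)
    (Or.inl (by push_cast [hlt.1]; linarith))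
  refine ⟨⟨?_, ?_, ?_, hlt.2⟩, ?_⟩
  · rw [h3]; exact ha
  · rw [h4]; exact hb
  · rw [h5]; exact hc
  · rw [dec, h3, h4, h5]
    ext i
    fin_cases i <;> rfl

theorem dec_ne_zero {r : ℤ} {k : ℕ} (hk : InBox r k) (h : k ≠ 16912) : dec k ≠ 0 := by
  intro h0
  apply h
  have h1 := hk.eq
  have ha : dig (k / 1024) = 0 := congrFun h0 0
  have hb : dig (k / 32) = 0 := congrFun h0 1
  have hc : dig k = 0 := congrFun h0 2
  rw [ha, hb, hc] at h1
  omega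

/-! ### Sums over lists -/

theorem madd_cons_cons (p q : ℕ × ℤ) (t u : VL) : madd (p :: t) (q :: u) =
    cond (Nat.ble p.1 q.1)
        (cond (Nat.beq p.1 q.1) (consNZ p.1 (p.2 + q.2) (madd t u)) (p :: madd t (q :: u)))
        (q :: madd (p :: t) u) := rfl

section ListSum
variable {M : Type*} [AddCommMonoid M]

/-- A quantity that is additive in lists with multiplicities. -/
def vsum (φ : ℕ → ℤ → M) (l : VL) : M := (l.map fun p => φ p.1 p.2).sum

theorem vsum_cons (φ : ℕ → ℤ → M) (p : ℕ × ℤ) (l : VL) :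
    vsum φ (p :: l) = φ p.1 p.2 + vsum φ l := by simp [vsum]

variable {φ : ℕ → ℤ → M} (h0 : ∀ k, φ k 0 = 0) (ha : ∀ k a b, φ k (a + b) = φ k a + φ k b)
include h0

theorem vsum_consNZ (k : ℕ) (e : ℤ) (l : VL) : vsum φ (consNZ k e l) = φ k e + vsum φ l := by
  cases e with
  | ofNat n =>
    cases n with
    | zero =>
      have : φ k (Int.ofNat 0) = 0 := h0 k
      rw [this, zero_add]
      rfl
    | succ n => exact vsum_cons φ _ _
  | negSucc n => exact vsum_cons φ _ _

include ha in
theorem vsum_madd : ∀ l l' : VL, vsum φ (madd l l') = vsum φ l + vsum φ l' := by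
  intro l
  induction l with
  | nil => intro l'; simp [madd, vsum]
  | cons p t ih =>
    intro l'
    induction l' with
    | nil => change vsum φ (p :: t) = _; simp [vsum]
    | cons q u ihu =>
      rw [madd_cons_cons]
      cases hb : Nat.ble p.1 q.1
      · rw [cond_false, vsum_cons, ihu, vsum_cons φ q u]
        exact add_left_comm _ _ _
      · rw [cond_true]
        cases hq : Nat.beq p.1 q.1
        · rw [cond_false, vsum_cons, ih, vsum_cons φ p t, add_assoc]
        · rw [cond_true, vsum_consNZ h0, ih, ha, vsum_cons, vsum_cons, Nat.beq_eq] at *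
          rw [hq]
          exact add_add_add_comm _ _ _ _

end ListSum

theorem mem_consNZ {k : ℕ} {e : ℤ} {l : VL} {p : ℕ × ℤ} (h : p ∈ consNZ k e l) :
    p.1 = k ∨ p ∈ l := by
  cases e with
  | ofNat n =>
    cases n with
    | zero => exact Or.inr h
    | succ n =>
      rcases List.mem_cons.mp h with h | h
      · exact Or.inl (by rw [h])
      · exact Or.inr h
  | negSucc n =>
    rcases List.mem_cons.mp h with h | h
    · exact Or.inl (by rw [h])
    · exact Or.inr h

theorem forall_madd {P : ℕ → Prop} : ∀ {l l' : VL}, (∀ p ∈ l, P p.1) → (∀ p ∈ l', P p.1) →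
    ∀ p ∈ madd l l', P p.1 := by
  intro l
  induction l with
  | nil => exact fun _ h' => h'
  | cons p t ih =>
    intro l'
    induction l' with
    | nil => exact fun h _ => h
    | cons q u ihu =>
      intro h h' r hr
      rw [madd_cons_cons] at hr
      have ht : ∀ p ∈ t, P p.1 := fun r hr => h r (List.mem_cons_of_mem _ hr)
      have hu : ∀ p ∈ u, P p.1 := fun r hr => h' r (List.mem_cons_of_mem _ hr)
      cases hb : Nat.ble p.1 q.1
      · rw [hb, cond_false, List.mem_cons] at hr
        rcases hr with rfl | hr
        · exact h' _ (by simp)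
        · exact ihu h hu r hr
      · rw [hb, cond_true] at hr
        cases hq : Nat.beq p.1 q.1
        · rw [hq, cond_false, List.mem_cons] at hr
          rcases hr with rfl | hr
          · exact h _ (by simp)
          · exact ih ht h' r hr
        · rw [hq, cond_true] at hr
          rcases mem_consNZ hr with hr | hr
          · rw [hr]; exact h p (by simp)
          · exact ih ht hu r hr

theorem forceVL_eq (l : VL) : forceVL l = l := by
  induction l with
  | nil => rfl
  | cons p l ih =>
    obtain ⟨k, e⟩ := p
    have h : forceVL ((k, e) :: l) = force k fun k =>
      Int.casesOn (motive := fun _ => VL) e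
        (fun n => force n fun n => (k, Int.ofNat n) :: forceVL l)
      (fun n => force n fun n => (k, Int.negSucc n) :: forceVL l) := rfl
    rw [h, force_eq, ih]
    cases e <;> simp only [force_eq]

/-! ### The character of a list of boxes -/

/-- The character encoded by a list. -/
noncomputable def ch : VL → Laurent3 := vsum fun k e => AddMonoidAlgebra.single (dec k) e

theorem ch_madd (l l' : VL) : ch (madd l l') = ch l + ch l' :=
  vsum_madd (fun _ => AddMonoidAlgebra.single_zero _)
    (fun _ _ _ => AddMonoidAlgebra.single_add _ _ _) l l'

/-- The monomial `t^w` on `T`. -/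
noncomputable def mono (w : Fin 3 → ℤ) : Laurent3 := AddMonoidAlgebra.single w 1

theorem mono_add (w w' : Fin 3 → ℤ) : mono (w + w') = mono w * mono w' := by
  rw [mono, mono, mono, AddMonoidAlgebra.single_mul_single, one_mul]

theorem ch_shift {r r' : ℤ} {z : ℕ} (hz : InBox r' z) (hr : r + r' ≤ 15) {l : VL}
    (hl : ∀ p ∈ l, InBox r p.1) : (∀ p ∈ shift z l, InBox (r + r') p.1) ∧
      ch (shift z l) = mono (dec z) * ch l ∧
      vsum (fun _ e => e) (shift z l) = vsum (fun _ e => e) l := by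
  have hs : shift z l = l.map fun p => (p.1 + z - 16912, p.2) := mapR_eq _ _
  rw [hs]
  refine ⟨fun p hp => ?_, ?_, ?_⟩
  · obtain ⟨q, hq, rfl⟩ := List.mem_map.mp hp
    exact ((hl q hq).shift hz hr).1
  · rw [ch, vsum, vsum, List.map_map, ← List.sum_map_mul_left]
    congr 1
    refine List.map_congr_left fun p hp => ?_
    simp only [Function.comp, ((hl p hp).shift hz hr).2]
    rw [mono, AddMonoidAlgebra.single_mul_single, one_mul, add_comm]
  · rw [vsum, vsum, List.map_map]
    rfl

/-- The character `(1 - t₁⁻¹)(1 - t₂⁻¹)(1 - t₃⁻¹)`. -/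
noncomputable def pChar : Laurent3 :=
  (1 - mono ![-1, 0, 0]) * (1 - mono ![0, -1, 0]) * (1 - mono ![0, 0, -1])

theorem inBox_pbar : ∀ p ∈ pbar, InBox 1 p.1 := by
  simp only [pbar, List.mem_cons, List.not_mem_nil, or_false, forall_eq_or_imp, forall_eq, InBox,
    dig_eq]
  norm_num

theorem ch_pbar : ch pbar = pChar := by
  have h1 : mono ![-1, -1, 0] = mono ![-1, 0, 0] * mono ![0, -1, 0] := by
    rw [← mono_add]; congr 1; ext i; fin_cases i <;> rfl
  have h2 : mono ![-1, 0, -1] = mono ![-1, 0, 0] * mono ![0, 0, -1] := by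
    rw [← mono_add]; congr 1; ext i; fin_cases i <;> rfl
  have h3 : mono ![0, -1, -1] = mono ![0, -1, 0] * mono ![0, 0, -1] := by
    rw [← mono_add]; congr 1; ext i; fin_cases i <;> rfl
  have h4 : mono ![-1, -1, -1] = mono ![-1, 0, 0] * mono ![0, -1, 0] * mono ![0, 0, -1] := by
    rw [← mono_add, ← mono_add]; congr 1; ext i; fin_cases i <;> rfl
  have h5 : ∀ w, AddMonoidAlgebra.single w (-1) = -mono w := fun w => by
    rw [mono]; exact AddMonoidAlgebra.single_neg _ _
  have h6 : mono ![0, 0, 0] = 1 := by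
    rw [AddMonoidAlgebra.one_def, mono]
    congr 1
    ext i; fin_cases i <;> rfl
  have hd : ∀ k, dec k = ![((k / 1024 % 32 : ℕ) : ℤ) - 16, ((k / 32 % 32 : ℕ) : ℤ) - 16,
      ((k % 32 : ℕ) : ℤ) - 16] :=
    fun k => by rw [dec, dig_eq, dig_eq, dig_eq]
  rw [ch, pbar]
  simp only [vsum, List.map_cons, List.map_nil, List.sum_cons, List.sum_nil, hd]
  norm_num [h5]
  have h7 : ∀ w, AddMonoidAlgebra.single w 1 = mono w := fun _ => rfl
  simp only [h7, h1, h2, h3, h4, h6]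
  rw [pChar]
  ring

/-- Weights of boxes have entries at most 5, hence at most 6 here and at most 11 in `wL_spec`,
within the range of the digits. The total multiplicity is 0 because that of `pbar` is. -/
theorem yL_spec {A : List ℕ} (hA : ∀ b ∈ A, InBox 5 (wt b)) : (∀ p ∈ yL A, InBox 6 p.1) ∧
    ch (yL A) = (A.map fun b => mono (-dec (wt b))).sum * pChar ∧
    vsum (fun _ e => e) (yL A) = 0 := by
  induction A with
  | nil => simp [yL, ch, vsum]
  | cons b A ih =>
    obtain ⟨h1, h2, h3⟩ := ih fun b hb => hA b (List.mem_cons_of_mem _ hb)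
    have hy : yL (b :: A) = madd (shift (33824 - wt b) pbar) (yL A) := rfl
    have hb := (hA b (by simp)).neg (by norm_num)
    obtain ⟨h4, h5, h6⟩ := ch_shift hb.1 (r := 1) (by norm_num) inBox_pbar
    rw [hy]
    refine ⟨forall_madd h4 h1, ?_, ?_⟩
    · rw [ch_madd, h5, h2, ch_pbar, hb.2, List.map_cons, List.sum_cons, add_mul]
    · rw [vsum_madd (fun _ => rfl) (fun _ _ _ => rfl), h3, h6]
      rfl

/-- The part of W containing P has rank 0, so the rank of W is minus the number of boxes; this is
the parity needed in `eulerT_add_dual`. -/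
theorem wL_spec {A : List ℕ} (hA : ∀ b ∈ A, InBox 5 (wt b)) : (∀ p ∈ wL A, InBox 11 p.1) ∧
    ch (wL A) = -(A.map fun b => mono (dec (wt b))).sum
      + (A.map fun b => mono (dec (wt b))).sum * (A.map fun b => mono (-dec (wt b))).sum * pChar ∧
    vsum (fun _ e => e) (wL A) = -A.length := by
  obtain ⟨hy, hy', hy''⟩ := yL_spec hA
  -- The list inside `yL A` has to stay fixed while the outer list shrinks.
  have key : ∀ A' : List ℕ, (∀ b ∈ A', InBox 5 (wt b)) →
      (∀ p ∈ foldR (fun b acc => madd ((wt b, -1) :: []) (madd (shift (wt b) (yL A)) acc)) [] A',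
        InBox 11 p.1) ∧
      ch (foldR (fun b acc => madd ((wt b, -1) :: []) (madd (shift (wt b) (yL A)) acc)) [] A')
        = -(A'.map fun b => mono (dec (wt b))).sum
          + (A'.map fun b => mono (dec (wt b))).sum * ch (yL A) ∧
      vsum (fun _ e => e)
        (foldR (fun b acc => madd ((wt b, -1) :: []) (madd (shift (wt b) (yL A)) acc)) [] A')
        = -A'.length := by
    intro A' hA'
    induction A' with
    | nil => simp [ch, vsum]
    | cons b A' ih =>
      obtain ⟨h1, h2, h3⟩ := ih fun b hb => hA' b (List.mem_cons_of_mem _ hb)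
      have hw : foldR (fun b acc => madd ((wt b, -1) :: []) (madd (shift (wt b) (yL A)) acc)) []
          (b :: A') = madd [(wt b, -1)] (madd (shift (wt b) (yL A)) (foldR (fun b acc =>
            madd ((wt b, -1) :: []) (madd (shift (wt b) (yL A)) acc)) [] A')) := rfl
      obtain ⟨h4, h5, h6⟩ := ch_shift (hA' b (by simp)) (r := 6) (by norm_num) hy
      rw [hw]
      refine ⟨forall_madd ?_ (forall_madd h4 h1), ?_, ?_⟩
      · simpa using (hA' b (by simp)).mono (by norm_num)
      · have h7 : ch [(wt b, -1)] = -mono (dec (wt b)) := by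
          simp only [ch, vsum, List.map_cons, List.map_nil, List.sum_cons, List.sum_nil, add_zero,
            mono]
          exact AddMonoidAlgebra.single_neg _ _
        rw [ch_madd, ch_madd, h2, h5, h7, List.map_cons, List.sum_cons]
        ring
      · rw [vsum_madd (fun _ => rfl) (fun _ _ _ => rfl), vsum_madd (fun _ => rfl) (fun _ _ _ => rfl),
          h3, h6, hy'']
        simp [vsum]
  obtain ⟨h1, h2, h3⟩ := key A hA
  refine ⟨h1, h2.trans ?_, h3⟩
  rw [hy', mul_assoc]

end VertexTable

namespace VertexTable

/-! ### Euler classes -/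

/-- The first Chern class of a character of `T`. -/
noncomputable def chern (w : Fin 3 → ℤ) : LamField := ∑ i : Fin 3, (w i : LamField) * lam i.castSucc

theorem algebraMap_chern (w : Fin 3 → ℤ) : algebraMap LamField LamDField (chern w)
    = w 0 * lamD 0 + w 1 * lamD 1 + w 2 * lamD 2 := by
  rw [chern, Fin.sum_univ_three]
  simp only [map_add, map_mul, map_intCast]
  rfl

theorem chern_ne_zero {w : Fin 3 → ℤ} (h : w ≠ 0) : chern w ≠ 0 := by
  intro h0
  have h1 := congrArg (algebraMap LamField LamDField) h0
  rw [algebraMap_chern, map_zero] at h1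
  have h2 : ∀ x y z _s : ℤ, (w 0 : ℤ) * x + (w 1 : ℤ) * y + (w 2 : ℤ) * z = 0 :=
    eq_zero_at_int (q := fun x y z _ => (w 0 : _) * x + (w 1 : _) * y + (w 2 : _) * z)
      (fun f x y z _ => by simp only [map_add, map_mul, map_intCast]) h1
  apply h
  ext i
  fin_cases i
  · simpa using h2 1 0 0 0
  · simpa using h2 0 1 0 0
  · simpa using h2 0 0 1 0

/-- The first Chern class, or `1` for the trivial character. -/
noncomputable def chernNZ (w : Fin 3 → ℤ) : LamField := if w = 0 then 1 else chern w

theorem chernNZ_ne_zero (w : Fin 3 → ℤ) : chernNZ w ≠ 0 := by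
  rw [chernNZ]
  split_ifs with h
  · exact one_ne_zero
  · exact chern_ne_zero h

/-- The product `∏ u(w) ^ m_w` over the weights of a character. -/
noncomputable def mprod (u : (Fin 3 → ℤ) → LamField) (W : Laurent3) : LamField :=
  W.coeff.prod fun w m => u w ^ m

section Mprod
variable {u : (Fin 3 → ℤ) → LamField} (hu : ∀ w, u w ≠ 0)
include hu

/-- Positive and negative exponents may cancel in the sum, so multiplicativity requires u to have no
zeros; hence the value 1 of `chernNZ` at the trivial weight. -/
theorem mprod_add (W W' : Laurent3) : mprod u (W + W') = mprod u W * mprod u W' := by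
  rw [mprod, AddMonoidAlgebra.coeff_add]
  exact Finsupp.prod_add_index' (fun _ => zpow_zero _) fun w m m' => zpow_add₀ (hu w) m m'

omit hu in
theorem mprod_single (w : Fin 3 → ℤ) (m : ℤ) :
    mprod u (AddMonoidAlgebra.single w m) = u w ^ m := by
  rw [mprod, AddMonoidAlgebra.coeff_single]
  exact Finsupp.prod_single_index (zpow_zero _)

theorem mprod_ch (l : VL) : mprod u (ch l) = (l.map fun p => u (dec p.1) ^ p.2).prod := by
  induction l with
  | nil => simp [ch, vsum, mprod]
  | cons p l ih =>
    rw [ch, vsum_cons, mprod_add hu, mprod_single, List.map_cons, List.prod_cons, ← ih]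
    rfl

/-- The dual of a character. -/
noncomputable def dual (W : Laurent3) : Laurent3 := AddMonoidAlgebra.mapDomain (fun w => -w) W

theorem mprod_dual (W : Laurent3) : mprod u (dual W) = mprod (fun w => u (-w)) W := by
  have h : (dual W).coeff = W.coeff.mapDomain (fun w => -w) := rfl
  rw [mprod, h]
  exact Finsupp.prod_mapDomain_index (fun _ => zpow_zero _) fun w m m' => zpow_add₀ (hu w) m m'

end Mprod

theorem eulerT_eq_mprod {W : Laurent3} (h : W.coeff 0 = 0) : eulerT W = mprod chernNZ W := by
  refine Finsupp.prod_congr fun w hw => ?_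
  have h0 : w ≠ 0 := by
    rintro rfl
    exact Finsupp.mem_support_iff.mp hw h
  rw [chernNZ, if_neg h0]
  rfl

theorem mprod_chernNZ_dual {W : Laurent3} (h : W.coeff 0 = 0) :
    mprod chernNZ (dual W) = mprod (fun _ => -1) W * mprod chernNZ W := by
  rw [mprod_dual chernNZ_ne_zero, mprod, mprod, mprod, ← Finsupp.prod_mul]
  refine Finsupp.prod_congr fun w hw => ?_
  have h0 : w ≠ 0 := by
    rintro rfl
    exact Finsupp.mem_support_iff.mp hw h
  rw [chernNZ, chernNZ, if_neg h0, if_neg (neg_ne_zero.mpr h0), ← mul_zpow]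
  congr 1
  rw [chern, chern, neg_one_mul, ← Finset.sum_neg_distrib]
  exact Finset.sum_congr rfl fun i _ => by simp

theorem coeff_dual (W : Laurent3) : (dual W).coeff 0 = W.coeff 0 := by
  have h := Finsupp.mapDomain_apply (neg_injective (G := Fin 3 → ℤ)) W.coeff 0
  rw [neg_zero] at h
  exact h

theorem coeff_ch {l : VL} (h : ∀ p ∈ l, dec p.1 ≠ 0) : (ch l).coeff 0 = 0 := by
  induction l with
  | nil => simp [ch, vsum]
  | cons p l ih =>
    rw [ch, vsum_cons, AddMonoidAlgebra.coeff_add, Finsupp.add_apply, AddMonoidAlgebra.coeff_single,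
      Finsupp.single_eq_of_ne (h p (by simp)).symm, zero_add]
    exact ih fun q hq => h q (List.mem_cons_of_mem _ hq)

theorem mprod_neg_one (l : VL) :
    mprod (fun _ => -1) (ch l) = (-1) ^ vsum (fun _ e => e) l := by
  rw [mprod_ch fun _ => neg_ne_zero.mpr one_ne_zero]
  induction l with
  | nil => simp [vsum]
  | cons p l ih =>
    rw [List.map_cons, List.prod_cons, ih, vsum_cons,
      zpow_add₀ (neg_ne_zero.mpr (one_ne_zero (α := LamField)))]

/-- The Euler class of a character that is the sum of `W` and its dual is a square up to sign. -/
theorem eulerT_add_dual {l : VL} (h : ∀ p ∈ l, dec p.1 ≠ 0) {n : ℕ}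
    (hn : vsum (fun _ e => e) l = -(n : ℤ)) :
    (-1) ^ n * eulerT (ch l + dual (ch l)) = mprod chernNZ (ch l) ^ 2 := by
  have h0 := coeff_ch h
  rw [eulerT_eq_mprod (by
      rw [AddMonoidAlgebra.coeff_add, Finsupp.add_apply, coeff_dual, h0, add_zero]),
    mprod_add chernNZ_ne_zero, mprod_chernNZ_dual h0, mprod_neg_one, hn, zpow_neg, zpow_natCast,
    ← inv_pow, inv_neg_one, mul_left_comm, ← mul_assoc ((-1 : LamField) ^ n) ((-1) ^ n),
    ← mul_pow, neg_one_mul, neg_neg, one_pow, one_mul, sq]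

/-! ### Products of powers of linear forms -/

/-- The value of a linear form, or `1` if it vanishes. -/
noncomputable def formNZ (k : ℕ) : LamDField := open Classical in if form k = 0 then 1 else form k

theorem formNZ_ne_zero (k : ℕ) : formNZ k ≠ 0 := by
  rw [formNZ]
  split_ifs with h
  · exact one_ne_zero
  · exact h

theorem formNZ_eq {k : ℕ} (h : nonzeroForm k = true) : formNZ k = form k :=
  if_neg (form_ne_zero h)

theorem ofMul_ev {F : Type*} [Field F] (v : ℕ → F) (l : VL) : Additive.ofMul (ev v l)
    = vsum (fun k e => Additive.ofMul (v k ^ e)) l := by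
  induction l with
  | nil => rfl
  | cons p l ih => rw [ev_cons, vsum_cons, ofMul_mul, ih]

theorem ev_madd {F : Type*} [Field F] {v : ℕ → F} (hv : ∀ k, v k ≠ 0) (l l' : VL) :
    ev v (madd l l') = ev v l * ev v l' := by
  apply Additive.ofMul.injective
  rw [ofMul_mul, ofMul_ev, ofMul_ev, ofMul_ev]
  refine vsum_madd (fun k => ?_) (fun k a b => ?_) l l'
  · rw [zpow_zero, ofMul_one]
  · rw [zpow_add₀ (hv k), ofMul_mul]

theorem ev_singleton {F : Type*} [Field F] (v : ℕ → F) (k : ℕ) (e : ℤ) :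
    ev v [(k, e)] = v k ^ e := by
  rw [ev_cons, ev_nil, mul_one]

theorem form_of_le {k : ℕ} (h : 32768 ≤ k) : form k = dig (k / 1024) * lamD 0
    + dig (k / 32) * lamD 1 + dig k * lamD 2 := by
  rw [form, lin, if_neg (not_lt.mpr h), zero_add]

theorem dig_add (k : ℕ) : dig ((k + 32768) / 1024) = dig (k / 1024) ∧
    dig ((k + 32768) / 32) = dig (k / 32) ∧ dig (k + 32768) = dig k := by
  simp only [dig_eq]
  omega

theorem form_add (k : ℕ) : form (k + 32768) = algebraMap LamField LamDField (chern (dec k)) := by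
  obtain ⟨h1, h2, h3⟩ := dig_add k
  rw [form_of_le (by omega), algebraMap_chern, h1, h2, h3]
  rfl

theorem nonzeroForm_add {k : ℕ} (h : k < 32768) (h' : k ≠ 16912) :
    nonzeroForm (k + 32768) = true := by
  rw [nonzeroForm, Bool.or_eq_true, Bool.not_eq_true', ← Bool.not_eq_true, Nat.beq_eq]
  refine Or.inr ?_
  change ¬ (k + 32768) % 32768 = 16912
  omega

theorem formNZ_add {r : ℤ} {k : ℕ} (h : InBox r k) (h' : k ≠ 16912) :
    formNZ (k + 32768) = algebraMap LamField LamDField (chernNZ (dec k)) := by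
  rw [formNZ_eq (nonzeroForm_add h.2.2.2 h'), form_add, chernNZ, if_neg (dec_ne_zero h h')]

theorem formNZ_neg {k : ℕ} (h : InBox 15 k) (h' : k ≠ 16912) :
    formNZ (33824 - k + 32768) = -formNZ (k + 32768) := by
  have h1 := h.neg le_rfl
  have h2 := h.2.2.2
  have hne : 33824 - k ≠ 16912 := by omega
  rw [formNZ_eq (nonzeroForm_add h1.1.2.2.2 hne), formNZ_eq (nonzeroForm_add h2 h'), form_add,
    form_add, h1.2, ← map_neg]
  congr 1
  rw [chern, chern, ← Finset.sum_neg_distrib]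
  exact Finset.sum_congr rfl fun i _ => by simp

/-- If the form is g times a primitive form p, then p · (g z) = form · z, and the three inserted
powers multiply to the required one. Most of the proof shows that the codes of p and g z have no
carries. -/
theorem ev_insPos {k : ℕ} (h : InBox 15 k) (hk : 16912 < k) (e : ℤ) (acc : VL) :
    ev formNZ (insPos k e acc) = formNZ (k + 32768) ^ e * ev formNZ acc := by
  have hi : insPos k e acc = cond (Nat.beq (content k) 1) (madd [(k + 32768, e)] acc)
    (madd [((k - 16912) / content k + 49680, e)]
      (madd [(content k + 49680, e)] (madd [(49681, -e)] acc))) := rfl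
  rw [hi]
  cases hb : Nat.beq (content k) 1
  swap
  · rw [cond_true, ev_madd formNZ_ne_zero, ev_singleton]
  set g := content k with hg
  have hc : g = Nat.gcd (dig (k / 1024)).natAbs (Nat.gcd (dig (k / 32)).natAbs (dig k).natAbs) :=
    rfl
  obtain ⟨a, ha⟩ : (g : ℤ) ∣ dig (k / 1024) :=
    Int.natCast_dvd.mpr (hc ▸ Nat.gcd_dvd_left _ _)
  obtain ⟨b, hb⟩ : (g : ℤ) ∣ dig (k / 32) :=
    Int.natCast_dvd.mpr (hc ▸ (Nat.gcd_dvd_right _ _).trans (Nat.gcd_dvd_left _ _))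
  obtain ⟨c, hc'⟩ : (g : ℤ) ∣ dig k :=
    Int.natCast_dvd.mpr (hc ▸ (Nat.gcd_dvd_right _ _).trans (Nat.gcd_dvd_right _ _))
  have hkeq := h.eq
  clear_value g
  have hg0 : 0 < g := by
    rcases Nat.eq_zero_or_pos g with h0 | h0
    · rw [h0, Nat.cast_zero, zero_mul] at ha hb hc'
      rw [ha, hb, hc'] at hkeq
      omega
    · exact h0
  have hg0' : (1 : ℤ) ≤ g := by exact_mod_cast hg0
  have hle : ∀ {u v : ℤ}, u = g * v → |u| ≤ 15 → |v| ≤ 15 := by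
    intro u v huv hu
    rw [huv, abs_mul, Nat.abs_cast] at hu
    nlinarith [abs_nonneg v]
  have h1 := hle ha h.1
  have h2 := hle hb h.2.1
  have h3 := hle hc' h.2.2.1
  have hq : (((k - 16912) / g : ℕ) : ℤ) = 1024 * a + 32 * b + c := by
    rw [Int.natCast_div, Nat.cast_sub hk.le]
    have : (k : ℤ) - (16912 : ℕ) = g * (1024 * a + 32 * b + c) := by
      rw [hkeq, ha, hb, hc']
      push_cast
      ring
    rw [this, Int.mul_ediv_cancel_left _ (by omega)]
  have hg15 : (g : ℤ) ≤ 15 := by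
    have hne : a ≠ 0 ∨ b ≠ 0 ∨ c ≠ 0 := by
      by_contra hcon
      push Not at hcon
      rw [hcon.1, hcon.2.1, hcon.2.2] at hq
      rw [hcon.1, mul_zero] at ha
      rw [hcon.2.1, mul_zero] at hb
      rw [hcon.2.2, mul_zero] at hc'
      rw [ha, hb, hc'] at hkeq
      omega
    have aux : ∀ {u v : ℤ}, u = g * v → |u| ≤ 15 → v ≠ 0 → (g : ℤ) ≤ 15 := by
      intro u v huv hu hv
      rw [huv, abs_mul, Nat.abs_cast] at hu
      have := Int.one_le_abs hv
      nlinarith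
    rcases hne with h0 | h0 | h0
    · exact aux ha h.1 h0
    · exact aux hb h.2.1 h0
    · exact aux hc' h.2.2.1 h0
  obtain ⟨d1, d2, d3⟩ := dig_of_eq h1 h2 h3 (k := (k - 16912) / g + 49680)
    (Or.inr (by push_cast [hq]; ring))
  obtain ⟨e1, e2, e3⟩ := dig_of_eq (a := 0) (b := 0) (c := g) (by norm_num) (by norm_num)
    (by rw [Nat.abs_cast]; exact hg15) (k := g + 49680) (Or.inr (by push_cast; ring))
  obtain ⟨z1, z2, z3⟩ := dig_of_eq (a := 0) (b := 0) (c := 1) (by norm_num) (by norm_num)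
    (by norm_num) (k := 49681) (Or.inr (by norm_num))
  obtain ⟨k1, k2, k3⟩ := dig_add k
  have hnz : ∀ {m : ℕ}, 49680 < m → m < 65536 → nonzeroForm m = true := fun {m} hm hm' => by
    have := nonzeroForm_add (k := m - 32768) (by omega) (by omega)
    rwa [Nat.sub_add_cancel (by omega)] at this
  have hq0 : 0 < (k - 16912) / g := by
    rcases Nat.eq_zero_or_pos ((k - 16912) / g) with h0 | h0
    · rw [h0, Nat.cast_zero] at hq
      have : (k : ℤ) = 16912 := by
        rw [hkeq, ha, hb, hc']
        linear_combination (-(g : ℤ)) * hq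
      omega
    · exact h0
  have hq1 : (k - 16912) / g ≤ k - 16912 := Nat.div_le_self _ _
  have hk' := h.2.2.2
  clear hq hc hkeq h1 h2 h3
  generalize (k - 16912) / g = q at *
  have hle' : ∀ m, 32768 ≤ m + 49680 := fun m => (Nat.le_add_left _ m).trans' (by norm_num)
  have hz : form 49681 ≠ 0 := form_ne_zero (hnz (by norm_num) (by norm_num))
  have fq : form (q + 49680) = a * lamD 0 + b * lamD 1 + c * lamD 2 := by
    rw [form_of_le (hle' q), d1, d2, d3]
  have fg : form (g + 49680) = g * lamD 2 := by
    rw [form_of_le (hle' g), e1, e2, e3]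
    push_cast
    ring
  have fz : form 49681 = lamD 2 := by
    rw [form_of_le (by norm_num), z1, z2, z3]
    push_cast
    ring
  have fk : form (k + 32768) = (g : LamDField) * (a * lamD 0 + b * lamD 1 + c * lamD 2) := by
    rw [form_of_le (Nat.le_add_left _ _), k1, k2, k3, ha, hb, hc']
    push_cast
    ring
  have key : form (q + 49680) * form (g + 49680) = form (k + 32768) * form 49681 := by
    rw [fq, fg, fk, fz]
    ring
  have hqn : nonzeroForm (q + 49680) = true := hnz (Nat.lt_add_of_pos_left hq0) (by omega)
  have hgn : nonzeroForm (g + 49680) = true := hnz (Nat.lt_add_of_pos_left hg0) (by omega)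
  rw [cond_false, ev_madd formNZ_ne_zero, ev_madd formNZ_ne_zero, ev_madd formNZ_ne_zero,
    ev_singleton, ev_singleton, ev_singleton, formNZ_eq hqn, formNZ_eq hgn,
    formNZ_eq (hnz (by norm_num) (by norm_num)), formNZ_eq (nonzeroForm_add hk' (by omega)),
    ← mul_assoc, ← mul_zpow, key, mul_zpow, ← mul_assoc, mul_assoc (form (k + 32768) ^ e), zpow_neg,
    mul_inv_cancel₀ (zpow_ne_zero _ hz), mul_one]

theorem neg_zpow_eq {F : Type*} [Field F] (a : F) (e : ℤ) :
    a ^ e = (-1) ^ e.natAbs * (-a) ^ e := by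
  rw [← neg_one_mul a, mul_zpow, ← mul_assoc]
  have h : (-1 : F) ^ e.natAbs * (-1) ^ e = 1 := by
    rcases Int.natAbs_eq e with h | h
    · nth_rw 2 [h]
      rw [zpow_natCast, ← mul_pow, neg_one_mul, neg_neg, one_pow]
    · nth_rw 2 [h]
      rw [zpow_neg, zpow_natCast, ← inv_pow, inv_neg_one, ← mul_pow, neg_one_mul, neg_neg, one_pow]
  rw [h, one_mul]

theorem ev_canon {l : VL} (h : ∀ p ∈ l, InBox 15 p.1 ∧ p.1 ≠ 16912) :
    algebraMap LamField LamDField (mprod chernNZ (ch l))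
      = (-1) ^ negDeg l * ev formNZ (canon l) := by
  rw [mprod_ch chernNZ_ne_zero, map_list_prod, List.map_map]
  induction l with
  | nil => simp [negDeg, canon, ev_nil]
  | cons p l ih =>
    obtain ⟨hp, hp'⟩ := h p (by simp)
    have hn : negDeg (p :: l)
      = cond (Nat.ble p.1 16912) (p.2.natAbs + negDeg l) (negDeg l) := rfl
    have hc : canon (p :: l) = cond (Nat.ble p.1 16912) (insPos (33824 - p.1) p.2 (canon l))
      (insPos p.1 p.2 (canon l)) := rfl
    rw [List.map_cons, List.prod_cons, ih fun q hq => h q (List.mem_cons_of_mem _ hq), hn, hc,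
      Function.comp_apply, map_zpow₀, ← formNZ_add hp hp']
    cases hb : Nat.ble p.1 16912
    · have hlt : 16912 < p.1 := by
        by_contra hcon
        rw [Nat.ble_eq_true_of_le (not_lt.mp hcon)] at hb
        exact absurd hb (by simp)
      rw [cond_false, cond_false, ev_insPos hp hlt]
      ring
    · rw [Nat.ble_eq] at hb
      rw [cond_true, cond_true, ev_insPos (hp.neg le_rfl).1 (by omega), formNZ_neg hp hp',
        neg_zpow_eq (formNZ (p.1 + 32768)), pow_add]
      ring

theorem nonzeroForm_of_lt {k : ℕ} (h : k < 32768) : nonzeroForm k = true := by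
  rw [nonzeroForm, Bool.or_eq_true, Nat.blt_eq]
  exact Or.inl h

theorem ev_sL {A : List ℕ} (hA : ∀ b ∈ A, InBox 5 (wt b)) (l : VL) :
    ev formNZ (sL A l) = (A.map fun b => form (wt b)).prod * ev formNZ l := by
  induction A with
  | nil => simp [sL]
  | cons b A ih =>
    have hs : sL (b :: A) l = madd [(wt b, 1)] (sL A l) := rfl
    rw [hs, ev_madd formNZ_ne_zero, ih fun b hb => hA b (List.mem_cons_of_mem _ hb), ev_singleton,
      zpow_one, formNZ_eq (nonzeroForm_of_lt (hA b (by simp)).2.2.2), List.map_cons, List.prod_cons,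
      mul_assoc]

end VertexTable

namespace VertexTable

/-! ### The enumeration of solid partitions -/

theorem enum_nil_zero (acc : List ℕ) : enum [] acc 0 = [acc] := rfl

theorem enum_nil_succ (acc : List ℕ) (n : ℕ) : enum [] acc (n + 1) = [] := rfl

theorem enum_cons_zero (b : ℕ) (bs acc : List ℕ) : enum (b :: bs) acc 0 = [acc] := rfl

theorem enum_cons_succ (b : ℕ) (bs acc : List ℕ) (n : ℕ) : enum (b :: bs) acc (n + 1) =
    (if supported b acc then enum bs (b :: acc) n else []) ++ enum bs acc (n + 1) := by
  have h : enum (b :: bs) acc (n + 1) =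
    app (cond (supported b acc) (enum bs (b :: acc) n) []) (enum bs acc (n + 1)) := rfl
  rw [h, app_eq]
  cases supported b acc <;> rfl

/-- Each entry of the list is supported by `acc` and the preceding entries. -/
def Grows : List ℕ → List ℕ → Prop
  | _, [] => True
  | acc, b :: c => supported b acc = true ∧ Grows (b :: acc) c

/-- The list c of added boxes is read in the order of the candidates while `acc` grows at its head,
whence the reversal. -/
theorem mem_enum {bs : List ℕ} : ∀ {acc : List ℕ} {n : ℕ} {A : List ℕ}, A ∈ enum bs acc n ↔
    ∃ c : List ℕ, c.Sublist bs ∧ c.length = n ∧ Grows acc c ∧ A = c.reverse ++ acc := by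
  induction bs with
  | nil =>
    intro acc n A
    cases n with
    | zero =>
      rw [enum_nil_zero, List.mem_singleton]
      constructor
      · rintro rfl
        exact ⟨[], List.Sublist.refl _, rfl, trivial, rfl⟩
      · rintro ⟨c, -, hc, -, rfl⟩
        rw [List.length_eq_zero_iff] at hc
        rw [hc]
        rfl
    | succ n =>
      rw [enum_nil_succ]
      constructor
      · intro h
        exact absurd h List.not_mem_nil
      · rintro ⟨c, hs, hc, -⟩
        rw [List.sublist_nil] at hs
        rw [hs] at hc
        simp at hc
  | cons b bs ih =>
    intro acc n A
    cases n with
    | zero =>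
      rw [enum_cons_zero, List.mem_singleton]
      constructor
      · rintro rfl
        exact ⟨[], List.nil_sublist _, rfl, trivial, rfl⟩
      · rintro ⟨c, -, hc, -, rfl⟩
        rw [List.length_eq_zero_iff] at hc
        rw [hc]
        rfl
    | succ n =>
      rw [enum_cons_succ, List.mem_append, ih]
      constructor
      · rintro (h | ⟨c, h1, h2, h3, h4⟩)
        · split_ifs at h with hs
          · obtain ⟨c, h1, h2, h3, h4⟩ := ih.mp h
            exact ⟨b :: c, h1.cons_cons b, by simp [h2], ⟨hs, h3⟩, by simp [h4]⟩
          · exact absurd h List.not_mem_nil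
        · exact ⟨c, h1.cons b, h2, h3, h4⟩
      · rintro ⟨c, h1, h2, h3, h4⟩
        rcases List.sublist_cons_iff.mp h1 with h1 | ⟨c', rfl, h1'⟩
        · exact Or.inr ⟨c, h1, h2, h3, h4⟩
        · left
          rw [if_pos h3.1, ih]
          exact ⟨c', h1', by simpa using h2, h3.2, by simp [h4]⟩

theorem nodup_enum {bs : List ℕ} (hb : bs.Nodup) : ∀ (acc : List ℕ) (n : ℕ),
    (enum bs acc n).Nodup := by
  induction bs with
  | nil =>
    intro acc n
    cases n
    · exact List.nodup_singleton _
    · exact List.nodup_nil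
  | cons b bs ih =>
    intro acc n
    rw [List.nodup_cons] at hb
    cases n with
    | zero => exact List.nodup_singleton _
    | succ n =>
      rw [enum_cons_succ, List.nodup_append]
      refine ⟨?_, ih hb.2 _ _, ?_⟩
      · split_ifs
        · exact ih hb.2 _ _
        · exact List.nodup_nil
      · intro A hA A' hA' he
        split_ifs at hA
        · obtain ⟨c, -, h1, -, h2⟩ := mem_enum.mp hA
          obtain ⟨c', h3, -, -, h4⟩ := mem_enum.mp hA'
          rw [h2, h4, List.append_cons] at he
          have h5 := List.append_cancel_right he
          apply hb.1
          apply h3.subset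
          rw [← List.mem_reverse, ← h5]
          simp
        · exact absurd hA List.not_mem_nil

/-- The box `b'` lies directly below the box `b`. -/
def IsPred (b' b : ℕ) : Prop :=
  (b % 8 ≠ 0 ∧ b' = b - 1) ∨ (b / 8 % 8 ≠ 0 ∧ b' = b - 8) ∨ (b / 64 % 8 ≠ 0 ∧ b' = b - 64) ∨
    (b / 512 ≠ 0 ∧ b' = b - 512)

theorem IsPred.lt {b' b : ℕ} (h : IsPred b' b) : b' < b := by
  unfold IsPred at h
  omega

theorem mem_iff (k : ℕ) (l : List ℕ) : mem k l = true ↔ k ∈ l := by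
  induction l with
  | nil => simp [mem]
  | cons a l ih =>
    have h : mem k (a :: l) = cond (Nat.beq a k) true (mem k l) := rfl
    rw [h, List.mem_cons, ← ih]
    cases hb : Nat.beq a k
    · rw [cond_false, or_iff_right]
      rintro rfl
      simp at hb
    · rw [Nat.beq_eq] at hb
      simp [hb]

theorem supported_iff (b : ℕ) (acc : List ℕ) :
    supported b acc = true ↔ ∀ b', IsPred b' b → b' ∈ acc := by
  simp only [supported, Bool.and_eq_true, Bool.or_eq_true, Nat.beq_eq, mem_iff]
  constructor
  · rintro ⟨⟨⟨h1, h2⟩, h3⟩, h4⟩ b' (⟨h, hb⟩ | ⟨h, hb⟩ | ⟨h, hb⟩ | ⟨h, hb⟩) <;> rw [hb]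
    · exact h1.resolve_left h
    · exact h2.resolve_left h
    · exact h3.resolve_left h
    · exact h4.resolve_left h
  · intro h
    exact ⟨⟨⟨or_iff_not_imp_left.mpr fun h' => h _ (Or.inl ⟨h', rfl⟩),
      or_iff_not_imp_left.mpr fun h' => h _ (Or.inr (Or.inl ⟨h', rfl⟩))⟩,
      or_iff_not_imp_left.mpr fun h' => h _ (Or.inr (Or.inr (Or.inl ⟨h', rfl⟩)))⟩,
      or_iff_not_imp_left.mpr fun h' => h _ (Or.inr (Or.inr (Or.inr ⟨h', rfl⟩)))⟩

theorem Grows.mem_of_isPred {c : List ℕ} : ∀ {acc : List ℕ}, Grows acc c → ∀ b ∈ c, ∀ b',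
    IsPred b' b → b' ∈ acc ∨ b' ∈ c := by
  induction c with
  | nil => exact fun _ b hb => absurd hb List.not_mem_nil
  | cons a c ih =>
    intro acc h b hb b' hp
    rcases List.mem_cons.mp hb with rfl | hb
    · exact Or.inl ((supported_iff _ _).mp h.1 b' hp)
    · rcases ih h.2 b hb b' hp with h1 | h1
      · rcases List.mem_cons.mp h1 with rfl | h1
        · exact Or.inr (by simp)
        · exact Or.inl h1
      · exact Or.inr (List.mem_cons_of_mem _ h1)

/-- A box directly below another has a smaller code, so in an increasing list it comes earlier and
closure suffices. -/
theorem grows_of_closed {c : List ℕ} : ∀ {acc : List ℕ}, c.Pairwise (· < ·) →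
    (∀ b ∈ c, ∀ b', IsPred b' b → b' ∈ acc ∨ b' ∈ c) → Grows acc c := by
  induction c with
  | nil => exact fun _ _ => trivial
  | cons a c ih =>
    intro acc hc h
    rw [List.pairwise_cons] at hc
    refine ⟨(supported_iff _ _).mpr fun b' hp => ?_, ih hc.2 fun b hb b' hp => ?_⟩
    · refine (h a (by simp) b' hp).resolve_right fun hm => ?_
      have h1 := hp.lt
      rcases List.mem_cons.mp hm with rfl | hm
      · exact lt_irrefl _ h1
      · exact lt_asymm h1 (hc.1 b' hm)
    · rcases h b (List.mem_cons_of_mem _ hb) b' hp with h1 | h1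
      · exact Or.inl (List.mem_cons_of_mem _ h1)
      · rcases List.mem_cons.mp h1 with rfl | h1
        · exact Or.inl (by simp)
        · exact Or.inr h1

/-- The code of a box. -/
def code (x : Σ _ : ℕ × ℕ × ℕ, ℕ) : ℕ := x.1.1 + 8 * x.1.2.1 + 64 * x.1.2.2 + 512 * x.2

/-- The box with a given code. -/
def decode (b : ℕ) : Σ _ : ℕ × ℕ × ℕ, ℕ := ⟨(b % 8, b / 8 % 8, b / 64 % 8), b / 512⟩

theorem code_decode (b : ℕ) : code (decode b) = b := by
  simp only [code, decode]
  omega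

theorem decode_code {i j k l : ℕ} (hi : i < 8) (hj : j < 8) (hk : k < 8) :
    decode (code ⟨(i, j, k), l⟩) = ⟨(i, j, k), l⟩ := by
  simp only [code, decode, Sigma.mk.injEq, Prod.mk.injEq, heq_eq_eq]
  omega

theorem code_digits {i j k l : ℕ} (hi : i < 8) (hj : j < 8) (hk : k < 8) :
    code ⟨(i, j, k), l⟩ % 8 = i ∧ code ⟨(i, j, k), l⟩ / 8 % 8 = j ∧
      code ⟨(i, j, k), l⟩ / 64 % 8 = k ∧ code ⟨(i, j, k), l⟩ / 512 = l := by
  have h := decode_code hi hj hk (l := l)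
  simp only [decode, Sigma.mk.injEq, Prod.mk.injEq, heq_eq_eq] at h
  exact ⟨h.1.1, h.1.2.1, h.1.2.2, h.2⟩

theorem mem_cand {k : ℕ} : k ∈ cand ↔ k % 8 + k / 8 % 8 + k / 64 % 8 + k / 512 ≤ 5 := by
  rw [cand, List.mem_filter, List.mem_range, Nat.ble_eq, and_iff_right_iff_imp]
  have h := code_decode k
  simp only [code, decode] at h
  omega

theorem pairwise_cand : cand.Pairwise (· < ·) :=
  List.pairwise_lt_range.sublist List.filter_sublist

/-! ### The boxes of a solid partition -/

open SolidPartition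

/-- The boxes of a solid partition. -/
def boxes (π : SolidPartition) : Finset (Σ _ : ℕ × ℕ × ℕ, ℕ) :=
  π.parts.support.sigma fun p => Finset.range (π.parts p)

theorem mem_boxes {π : SolidPartition} {x : Σ _ : ℕ × ℕ × ℕ, ℕ} :
    x ∈ boxes π ↔ x.2 < π.parts x.1 := by
  rw [boxes, Finset.mem_sigma, Finset.mem_range, Finsupp.mem_support_iff]
  exact ⟨fun h => h.2, fun h => ⟨by omega, h⟩⟩

theorem sum_parts (π : SolidPartition) {M : Type*} [AddCommMonoid M] (f : ℕ × ℕ × ℕ → ℕ → M) :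
    (π.parts.sum fun p m => ∑ l ∈ Finset.range m, f p l) = ∑ x ∈ boxes π, f x.1 x.2 := by
  rw [boxes, Finset.sum_sigma]
  rfl

theorem prod_parts (π : SolidPartition) {M : Type*} [CommMonoid M] (f : ℕ × ℕ × ℕ → ℕ → M) :
    (π.parts.prod fun p m => ∏ l ∈ Finset.range m, f p l) = ∏ x ∈ boxes π, f x.1 x.2 := by
  rw [boxes, Finset.prod_sigma]
  rfl

theorem card_boxes (π : SolidPartition) : (boxes π).card = π.size := by
  rw [boxes, Finset.card_sigma, size]
  simp [Finsupp.sum]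

theorem parts_anti (π : SolidPartition) {i j k i' j' k' : ℕ} (hi : i' ≤ i) (hj : j' ≤ j)
    (hk : k' ≤ k) : π.parts (i, j, k) ≤ π.parts (i', j', k') :=
  ((antitone_nat_of_succ_le (f := fun a => π.parts (a, j, k)) fun a => π.anti₁ a j k) hi).trans
    (((antitone_nat_of_succ_le (f := fun a => π.parts (i', a, k)) fun a => π.anti₂ i' a k) hj).trans
      ((antitone_nat_of_succ_le (f := fun a => π.parts (i', j', a)) fun a => π.anti₃ i' j' a) hk))

/-- All boxes have coordinate sum at most `5`. -/
def IsSmall (π : SolidPartition) : Prop :=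
  ∀ i j k l, l < π.parts (i, j, k) → i + j + k + l ≤ 5

/-- A lattice path from the origin to (i, j, k, l), moving along the four coordinates one after
another, stays inside π and consists of i + j + k + l + 1 different boxes. -/
theorem isSmall_of_size_le {π : SolidPartition} (h : π.size ≤ 6) : IsSmall π := by
  intro i j k l hl
  let g : ℕ → Σ _ : ℕ × ℕ × ℕ, ℕ := fun a =>
    ⟨(min a i, min (a - i) j, min (a - i - j) k), a - i - j - k⟩
  have h1 : ((Finset.range (i + j + k + l + 1)).image g) ⊆ boxes π := by
    intro x hx
    obtain ⟨a, ha, rfl⟩ := Finset.mem_image.mp hx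
    rw [Finset.mem_range] at ha
    rw [mem_boxes]
    refine lt_of_le_of_lt ?_ (hl.trans_le (parts_anti π (min_le_right a i)
      (min_le_right (a - i) j) (min_le_right (a - i - j) k)))
    change a - i - j - k ≤ l
    omega
  have h2 := Finset.card_le_card h1
  rw [Finset.card_image_of_injective, Finset.card_range, card_boxes] at h2
  · omega
  · intro a b hab
    simp only [g, Sigma.mk.injEq, Prod.mk.injEq, heq_eq_eq] at hab
    omega

/-- The boxes of a solid partition, as a list of codes. -/
noncomputable def boxList (π : SolidPartition) : List ℕ :=
  (cand.filter fun b => decide ((decode b).2 < π.parts (decode b).1)).reverse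

theorem mem_boxList {π : SolidPartition} {b : ℕ} :
    b ∈ boxList π ↔ b ∈ cand ∧ decode b ∈ boxes π := by
  rw [boxList, List.mem_reverse, List.mem_filter, decide_eq_true_eq, mem_boxes]

theorem nodup_boxList (π : SolidPartition) : (boxList π).Nodup :=
  List.nodup_reverse.mpr ((pairwise_cand.imp fun h => h.ne).filter _)

theorem IsSmall.decode_code {π : SolidPartition} (h : IsSmall π) {x : Σ _ : ℕ × ℕ × ℕ, ℕ}
    (hx : x ∈ boxes π) : decode (code x) = x ∧ code x ∈ boxList π := by
  obtain ⟨⟨i, j, k⟩, l⟩ := x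
  have h1 := h i j k l (mem_boxes.mp hx)
  have h2 : decode (code ⟨(i, j, k), l⟩) = ⟨(i, j, k), l⟩ :=
    VertexTable.decode_code (by omega) (by omega) (by omega)
  refine ⟨h2, mem_boxList.mpr ⟨?_, by rw [h2]; exact hx⟩⟩
  obtain ⟨h3, h4, h5, h6⟩ := code_digits (i := i) (j := j) (k := k) (l := l) (by omega) (by omega)
    (by omega)
  rw [mem_cand, h3, h4, h5, h6]
  exact h1

theorem IsSmall.sum_boxes {π : SolidPartition} (h : IsSmall π) {M : Type*} [AddCommMonoid M]
    (f : (Σ _ : ℕ × ℕ × ℕ, ℕ) → M) :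
    ∑ x ∈ boxes π, f x = ((boxList π).map fun b => f (decode b)).sum := by
  rw [← List.sum_toFinset _ (nodup_boxList π)]
  refine Finset.sum_nbij' code decode (fun x hx => ?_) (fun b hb => ?_) (fun x hx => ?_)
    (fun b _ => code_decode b) (fun x hx => ?_)
  · exact List.mem_toFinset.mpr (h.decode_code hx).2
  · exact (mem_boxList.mp (List.mem_toFinset.mp hb)).2
  · exact (h.decode_code hx).1
  · rw [(h.decode_code hx).1]

theorem IsSmall.prod_boxes {π : SolidPartition} (h : IsSmall π) {M : Type*} [CommMonoid M]
    (f : (Σ _ : ℕ × ℕ × ℕ, ℕ) → M) :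
    ∏ x ∈ boxes π, f x = ((boxList π).map fun b => f (decode b)).prod := by
  rw [← List.prod_toFinset _ (nodup_boxList π)]
  refine Finset.prod_nbij' code decode (fun x hx => ?_) (fun b hb => ?_) (fun x hx => ?_)
    (fun b _ => code_decode b) (fun x hx => ?_)
  · exact List.mem_toFinset.mpr (h.decode_code hx).2
  · exact (mem_boxList.mp (List.mem_toFinset.mp hb)).2
  · exact (h.decode_code hx).1
  · rw [(h.decode_code hx).1]

theorem IsSmall.length_boxList {π : SolidPartition} (h : IsSmall π) :
    (boxList π).length = π.size := by
  have h1 := h.sum_boxes fun _ => 1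
  rw [Finset.sum_const, smul_eq_mul, mul_one, card_boxes] at h1
  rw [h1, List.map_const', List.sum_replicate, smul_eq_mul, mul_one]

theorem boxList_mem_enum {π : SolidPartition} (h : IsSmall π) :
    boxList π ∈ enum cand [] π.size := by
  have h0 : ∃ c : List ℕ, c.Sublist cand ∧ c.Pairwise (· < ·) ∧ boxList π = c.reverse ∧
      ∀ b, b ∈ c ↔ b ∈ cand ∧ decode b ∈ boxes π :=
    ⟨_, List.filter_sublist, pairwise_cand.filter _, rfl, fun b => by
      rw [List.mem_filter, decide_eq_true_eq, mem_boxes]⟩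
  obtain ⟨c, hs, hp, hc, hm⟩ := h0
  rw [mem_enum, hc]
  refine ⟨c, hs, ?_, grows_of_closed hp fun b hb b' hb' => Or.inr ?_, (List.append_nil _).symm⟩
  · rw [← h.length_boxList, hc, List.length_reverse]
  · rw [hm, mem_cand, mem_boxes] at hb ⊢
    simp only [decode] at hb ⊢
    have h1 : b' % 8 ≤ b % 8 ∧ b' / 8 % 8 ≤ b / 8 % 8 ∧ b' / 64 % 8 ≤ b / 64 % 8 ∧
      b' / 512 ≤ b / 512 := by
      unfold IsPred at hb'
      omega
    refine ⟨by omega, ?_⟩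
    exact (h1.2.2.2.trans_lt hb.2).trans_le (parts_anti π h1.1 h1.2.1 h1.2.2.1)

theorem boxList_injective {π ρ : SolidPartition} (hπ : IsSmall π) (hρ : IsSmall ρ)
    (h : boxList π = boxList ρ) : π = ρ := by
  have key : ∀ {π ρ : SolidPartition}, IsSmall π → boxList π = boxList ρ → ∀ p,
      π.parts p ≤ ρ.parts p := by
    intro π ρ hπ h p
    by_contra hlt
    have h1 : (⟨p, ρ.parts p⟩ : Σ _ : ℕ × ℕ × ℕ, ℕ) ∈ boxes π := mem_boxes.mpr (not_le.mp hlt)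
    obtain ⟨h2, h3⟩ := hπ.decode_code h1
    rw [h, mem_boxList, h2, mem_boxes] at h3
    exact lt_irrefl _ h3.2
  exact SolidPartition.ext (Finsupp.ext fun p => le_antisymm (key hπ h p) (key hρ h.symm p))

theorem lt_card_filter_iff {P : ℕ → Prop} [DecidablePred P] {N : ℕ} (hN : ∀ l, P l → l < N)
    (hP : ∀ l, P (l + 1) → P l) (l : ℕ) : l < ((Finset.range N).filter P).card ↔ P l := by
  have hdown : ∀ m l, l ≤ m → P m → P l := by
    intro m
    induction m with
    | zero =>
      intro l hl h
      rwa [Nat.le_zero.mp hl]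
    | succ m ih =>
      intro l hl h
      rcases Nat.lt_or_ge m l with h1 | h1
      · rwa [show l = m + 1 by omega]
      · exact ih l h1 (hP m h)
  constructor
  · intro h
    by_contra hl
    have h1 : (Finset.range N).filter P ⊆ Finset.range l := by
      intro m hm
      rw [Finset.mem_filter] at hm
      rw [Finset.mem_range]
      by_contra hml
      exact hl (hdown m l (not_lt.mp hml) hm.2)
    have h2 := Finset.card_le_card h1
    rw [Finset.card_range] at h2
    omega
  · intro h
    have h1 : Finset.range (l + 1) ⊆ (Finset.range N).filter P := by
      intro m hm
      rw [Finset.mem_range] at hm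
      have h3 := hdown l m (by omega) h
      exact Finset.mem_filter.mpr ⟨Finset.mem_range.mpr (hN m h3), h3⟩
    have h2 := Finset.card_le_card h1
    rw [Finset.card_range] at h2
    omega

/-- The part at p is defined as the number of boxes of c above p. Closure under `IsPred` makes these
boxes an initial segment of the column (`lt_card_filter_iff`) and yields the three monotonicity
conditions. -/
theorem exists_boxList_eq {n : ℕ} {A : List ℕ} (hA : A ∈ enum cand [] n) :
    ∃ π : SolidPartition, π.size = n ∧ boxList π = A := by
  obtain ⟨c, h1, h2, h3, rfl⟩ := mem_enum.mp hA
  have hcl : ∀ b ∈ c, ∀ b', IsPred b' b → b' ∈ c := fun b hb b' hp =>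
    (h3.mem_of_isPred b hb b' hp).resolve_left List.not_mem_nil
  have hc : ∀ b ∈ c, b % 8 + b / 8 % 8 + b / 64 % 8 + b / 512 ≤ 5 := fun b hb =>
    mem_cand.mp (h1.subset hb)
  let f : ℕ × ℕ × ℕ → ℕ := fun p => if p.1 < 8 ∧ p.2.1 < 8 ∧ p.2.2 < 8 then
    ((Finset.range 6).filter fun l => code ⟨p, l⟩ ∈ c).card else 0
  have hf : ∀ p l, l < f p ↔ (p.1 < 8 ∧ p.2.1 < 8 ∧ p.2.2 < 8) ∧ code ⟨p, l⟩ ∈ c := by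
    rintro ⟨i, j, k⟩ l
    simp only [f]
    split_ifs with hp
    · rw [lt_card_filter_iff, and_iff_right hp]
      · intro m hm
        have := hc _ hm
        simp only [code] at this
        omega
      · intro m hm
        refine hcl _ hm _ ?_
        simp only [IsPred, code]
        omega
    · simp [hp]
  have hmono : ∀ p q, (∀ l, l < f p → l < f q) → f p ≤ f q := by
    intro p q h
    by_contra hcon
    exact lt_irrefl _ (h _ (not_le.mp hcon))
  let π : SolidPartition :=
    { parts := Finsupp.onFinset (Finset.range 8 ×ˢ Finset.range 8 ×ˢ Finset.range 8) f (by
        intro p hp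
        have h4 := ((hf p 0).mp (Nat.pos_of_ne_zero hp)).1
        simpa [Finset.mem_product] using h4)
      anti₁ := by
        intro i j k
        refine hmono (i + 1, j, k) (i, j, k) fun l hl => ?_
        rw [hf] at hl ⊢
        refine ⟨⟨(Nat.lt_succ_self i).trans hl.1.1, hl.1.2⟩, hcl _ hl.2 _ ?_⟩
        simp only [IsPred, code] at hl ⊢
        omega
      anti₂ := by
        intro i j k
        refine hmono (i, j + 1, k) (i, j, k) fun l hl => ?_
        rw [hf] at hl ⊢
        refine ⟨⟨hl.1.1, (Nat.lt_succ_self j).trans hl.1.2.1, hl.1.2.2⟩, hcl _ hl.2 _ ?_⟩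
        simp only [IsPred, code] at hl ⊢
        omega
      anti₃ := by
        intro i j k
        refine hmono (i, j, k + 1) (i, j, k) fun l hl => ?_
        rw [hf] at hl ⊢
        refine ⟨⟨hl.1.1, hl.1.2.1, (Nat.lt_succ_self k).trans hl.1.2.2⟩, hcl _ hl.2 _ ?_⟩
        simp only [IsPred, code] at hl ⊢
        omega }
  have hπ : ∀ p l, l < π.parts p ↔ (p.1 < 8 ∧ p.2.1 < 8 ∧ p.2.2 < 8) ∧ code ⟨p, l⟩ ∈ c := hf
  have hsmall : IsSmall π := by
    intro i j k l hl
    obtain ⟨h4, h5⟩ := (hπ _ _).mp hl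
    obtain ⟨d1, d2, d3, d4⟩ := code_digits h4.1 h4.2.1 h4.2.2 (l := l)
    have := hc _ h5
    rwa [d1, d2, d3, d4] at this
  have hlist : cand.filter (fun b => decide ((decode b).2 < π.parts (decode b).1)) = c := by
    refine List.Perm.eq_of_pairwise (le := (· < ·)) (fun a b _ _ h h' => absurd h' (lt_asymm h))
      (pairwise_cand.filter _) (pairwise_cand.sublist h1) ?_
    rw [List.perm_ext_iff_of_nodup ((pairwise_cand.imp fun h => h.ne).filter _)
      ((pairwise_cand.sublist h1).imp fun h => h.ne)]
    intro b
    have h6 : code ⟨(decode b).1, (decode b).2⟩ = b := code_decode b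
    rw [List.mem_filter, decide_eq_true_eq, hπ, h6]
    constructor
    · exact fun h => h.2.2
    · refine fun h => ⟨h1.subset h, ?_, h⟩
      simp only [decode]
      omega
  have hbl : boxList π = c.reverse ++ [] := by
    rw [boxList, hlist, List.append_nil]
  refine ⟨π, ?_, hbl⟩
  rw [← hsmall.length_boxList, hbl, List.append_nil, List.length_reverse, h2]

/-- The sum over the solid partitions of size `n ≤ 6` as a sum over lists of boxes. -/
theorem sum_solidPartition {n : ℕ} (hn : n ≤ 6) {M : Type*} [AddCommMonoid M] (f : List ℕ → M) :
    ∑ π : {π : SolidPartition // π.size = n}, f (boxList π.1)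
      = ((enum cand [] n).map f).sum := by
  have hnd : (enum cand [] n).Nodup := nodup_enum (pairwise_cand.imp fun h => h.ne) _ _
  have hs : ∀ π : {π : SolidPartition // π.size = n}, IsSmall π.1 := fun π =>
    isSmall_of_size_le (π.2.trans_le hn)
  rw [← List.sum_toFinset _ hnd]
  refine Finset.sum_bij (fun π _ => boxList π.1) (fun π _ => ?_) (fun π _ ρ _ h => ?_)
    (fun A hA => ?_) (fun _ _ => rfl)
  · rw [List.mem_toFinset]
    have h1 := boxList_mem_enum (hs π)
    rwa [π.2] at h1
  · exact Subtype.ext (boxList_injective (hs π) (hs ρ) h)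
  · obtain ⟨π, h1, h2⟩ := exists_boxList_eq (List.mem_toFinset.mp hA)
    exact ⟨⟨π, h1⟩, Finset.mem_univ _, h2⟩

end VertexTable

namespace VertexTable

/-! ### The vertex of a solid partition -/

open SolidPartition

theorem wt_eq (b : ℕ) : wt b = 16912 + (b % 8) * 1024 + (b / 8 % 8) * 32 + (b / 64 % 8)
    - (b / 512) * 1057 := rfl

theorem wt_spec {b : ℕ} (hb : b ∈ cand) : InBox 5 (wt b) ∧
    dec (wt b) = ![((b % 8 : ℕ) : ℤ) - (b / 512 : ℕ), ((b / 8 % 8 : ℕ) : ℤ) - (b / 512 : ℕ),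
      ((b / 64 % 8 : ℕ) : ℤ) - (b / 512 : ℕ)] := by
  rw [mem_cand] at hb
  have h0 := wt_eq b
  generalize wt b = w at *
  generalize b % 8 = i at *
  generalize b / 8 % 8 = j at *
  generalize b / 64 % 8 = k at *
  generalize b / 512 = l at *
  have ha : |(i : ℤ) - l| ≤ 5 := abs_le.mpr (by omega)
  have hb : |(j : ℤ) - l| ≤ 5 := abs_le.mpr (by omega)
  have hc : |(k : ℤ) - l| ≤ 5 := abs_le.mpr (by omega)
  obtain ⟨h1, h2, h3⟩ := dig_of_eq (k := w) (ha.trans (by norm_num)) (hb.trans (by norm_num))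
    (hc.trans (by norm_num)) (Or.inl (by omega))
  refine ⟨⟨by rwa [h1], by rwa [h2], by rwa [h3], by omega⟩, ?_⟩
  rw [dec, h1, h2, h3]

/-- Restriction of characters to `T`. -/
noncomputable def restrict : Laurent4 →+* Laurent3 :=
  AddMonoidAlgebra.mapDomainRingHom ℤ
    { toFun := fun w (i : Fin 3) => w i.castSucc - w 3
      map_zero' := by ext; simp
      map_add' := fun a b => by ext; simp only [Pi.add_apply]; ring }

theorem toT_eq (f : Laurent4) : f.toT = restrict f := rfl

theorem restrict_mono (w : Fin 4 → ℤ) :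
    restrict (Laurent4.mono w) = mono fun i => w i.castSucc - w 3 :=
  AddMonoidAlgebra.mapDomain_single

theorem bar_sum {ι : Type*} (s : Finset ι) (f : ι → Fin 4 → ℤ) :
    Laurent4.bar (∑ x ∈ s, Laurent4.mono (f x)) = ∑ x ∈ s, Laurent4.mono (-f x) := by
  have h : Laurent4.bar = AddMonoidAlgebra.mapDomainRingHom ℤ (negAddMonoidHom (α := Fin 4 → ℤ)) :=
    rfl
  rw [h, map_sum]
  exact Finset.sum_congr rfl fun x _ => AddMonoidAlgebra.mapDomain_single

/-- The dual of a character, as a ring homomorphism. -/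
noncomputable def dualHom : Laurent3 →+* Laurent3 :=
  AddMonoidAlgebra.mapDomainRingHom ℤ (negAddMonoidHom (α := Fin 3 → ℤ))

theorem dual_eq (W : Laurent3) : dual W = dualHom W := rfl

theorem dualHom_mono (w : Fin 3 → ℤ) : dualHom (mono w) = mono (-w) :=
  AddMonoidAlgebra.mapDomain_single

theorem mono_zero : mono 0 = 1 := AddMonoidAlgebra.one_def.symm

/-- From (1 - t) t⁻¹ = -(1 - t⁻¹) for t = t₁, t₂, t₃ one gets (1-t₁)(1-t₂)(1-t₃) t₄ = -P on T, so
subtracting this product from (1-t₁)(1-t₂)(1-t₃) = P̄ adds P. -/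
theorem restrict_prod : restrict (∏ i : Fin 4, (1 - Laurent4.mono (Pi.single i 1)))
    = pChar + dualHom pChar := by
  have h1 : ∀ v w : Fin 3 → ℤ, v + w = 0 → mono v * mono w = 1 := fun v w h => by
    rw [← mono_add, h, mono_zero]
  have hx := h1 ![1, 0, 0] ![-1, 0, 0] (by ext i; fin_cases i <;> rfl)
  have hy := h1 ![0, 1, 0] ![0, -1, 0] (by ext i; fin_cases i <;> rfl)
  have hz := h1 ![0, 0, 1] ![0, 0, -1] (by ext i; fin_cases i <;> rfl)
  have h4 : mono ![-1, -1, -1] = mono ![-1, 0, 0] * mono ![0, -1, 0] * mono ![0, 0, -1] := by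
    rw [← mono_add, ← mono_add]; congr 1; ext i; fin_cases i <;> rfl
  have e0 : restrict (Laurent4.mono (Pi.single 0 1)) = mono ![1, 0, 0] := by
    rw [restrict_mono]; congr 1; ext i; fin_cases i <;> rfl
  have e1 : restrict (Laurent4.mono (Pi.single 1 1)) = mono ![0, 1, 0] := by
    rw [restrict_mono]; congr 1; ext i; fin_cases i <;> rfl
  have e2 : restrict (Laurent4.mono (Pi.single 2 1)) = mono ![0, 0, 1] := by
    rw [restrict_mono]; congr 1; ext i; fin_cases i <;> rfl
  have e3 : restrict (Laurent4.mono (Pi.single 3 1)) = mono ![-1, -1, -1] := by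
    rw [restrict_mono]; congr 1; ext i; fin_cases i <;> rfl
  have d0 : dualHom (mono ![-1, 0, 0]) = mono ![1, 0, 0] := by
    rw [dualHom_mono]; congr 1; ext i; fin_cases i <;> rfl
  have d1 : dualHom (mono ![0, -1, 0]) = mono ![0, 1, 0] := by
    rw [dualHom_mono]; congr 1; ext i; fin_cases i <;> rfl
  have d2 : dualHom (mono ![0, 0, -1]) = mono ![0, 0, 1] := by
    rw [dualHom_mono]; congr 1; ext i; fin_cases i <;> rfl
  rw [pChar, Fin.prod_univ_four]
  simp only [map_mul, map_sub, map_one, e0, e1, e2, e3, d0, d1, d2, h4]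
  generalize mono ![1, 0, 0] = x at *
  generalize mono ![0, 1, 0] = y at *
  generalize mono ![0, 0, 1] = z at *
  generalize mono ![-1, 0, 0] = x' at *
  generalize mono ![0, -1, 0] = y' at *
  generalize mono ![0, 0, -1] = z' at *
  have hx' : (1 - x) * x' = -(1 - x') := by linear_combination -hx
  have hy' : (1 - y) * y' = -(1 - y') := by linear_combination -hy
  have hz' : (1 - z) * z' = -(1 - z') := by linear_combination -hz
  have h : (1 - x) * x' * ((1 - y) * y') * ((1 - z) * z')
      = -((1 - x') * (1 - y') * (1 - z')) := by
    rw [hx', hy', hz']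
    ring
  linear_combination -h

variable {π : SolidPartition}

theorem IsSmall.inBox (_h : IsSmall π) : ∀ b ∈ boxList π, InBox 5 (wt b) := fun _ hb =>
  (wt_spec (mem_boxList.mp hb).1).1

theorem IsSmall.restrict_box (_h : IsSmall π) {b : ℕ} (hb : b ∈ boxList π) :
    (fun i : Fin 3 => box (decode b).1 (decode b).2 i.castSucc - box (decode b).1 (decode b).2 3)
      = dec (wt b) := by
  rw [(wt_spec (mem_boxList.mp hb).1).2]
  ext i
  fin_cases i <;> rfl

theorem IsSmall.restrict_charZ (h : IsSmall π) :
    restrict π.charZ = ((boxList π).map fun b => mono (dec (wt b))).sum := by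
  rw [charZ, sum_parts π fun p l => Laurent4.mono (box p l), map_sum,
    h.sum_boxes fun x => restrict (Laurent4.mono (box x.1 x.2))]
  refine congrArg List.sum (List.map_congr_left fun b hb => ?_)
  rw [restrict_mono, h.restrict_box hb]

theorem IsSmall.restrict_bar_charZ (h : IsSmall π) :
    restrict π.charZ.bar = ((boxList π).map fun b => mono (-dec (wt b))).sum := by
  rw [charZ, sum_parts π fun p l => Laurent4.mono (box p l), bar_sum, map_sum,
    h.sum_boxes fun x => restrict (Laurent4.mono (-box x.1 x.2))]
  refine congrArg List.sum (List.map_congr_left fun b hb => ?_)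
  rw [restrict_mono, ← h.restrict_box hb]
  congr 1
  ext i
  simp only [Pi.neg_apply]
  ring

/-- On T the factor 1 / (t₁t₂t₃t₄) disappears, and Z Z̄ is self-dual, so Z Z̄ (P + P̄) - Z - Z̄ is W
plus its dual. -/
theorem IsSmall.neg_vertex (h : IsSmall π) :
    -(π.vertex.toT) = ch (wL (boxList π)) + dual (ch (wL (boxList π))) := by
  have hd : dualHom ((boxList π).map fun b => mono (dec (wt b))).sum
      = ((boxList π).map fun b => mono (-dec (wt b))).sum := by
    rw [map_list_sum, List.map_map]
    exact congrArg List.sum (List.map_congr_left fun b _ => dualHom_mono _)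
  have hd' : dualHom ((boxList π).map fun b => mono (-dec (wt b))).sum
      = ((boxList π).map fun b => mono (dec (wt b))).sum := by
    rw [map_list_sum, List.map_map]
    exact congrArg List.sum (List.map_congr_left fun b _ => by
      rw [Function.comp_apply, dualHom_mono, neg_neg])
  have h1 : restrict (Laurent4.mono fun _ => -1) = 1 := by
    rw [restrict_mono, ← mono_zero]
    congr 1
  rw [(wL_spec h.inBox).2.1, dual_eq, toT_eq, vertex]
  simp only [map_add, map_sub, map_mul, map_neg, h1, restrict_prod, h.restrict_charZ,
    h.restrict_bar_charZ, hd, hd']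
  ring

/-- The value of the weight with the correct sign. -/
noncomputable def weight (π : SolidPartition) : LamField :=
  (-1) ^ mu (boxList π) * mprod chernNZ (ch (wL (boxList π)))

theorem weight_ne_zero (π : SolidPartition) : weight π ≠ 0 := by
  refine mul_ne_zero (pow_ne_zero _ (neg_ne_zero.mpr one_ne_zero)) ?_
  rw [mprod_ch chernNZ_ne_zero]
  refine List.prod_ne_zero fun h0 => ?_
  obtain ⟨p, -, h1⟩ := List.mem_map.mp h0
  exact zpow_ne_zero _ (chernNZ_ne_zero _) h1

theorem not_mem_fixed {n : ℕ} (h : checkFixed n = true) {A : List ℕ} (hA : A ∈ enum cand [] n) :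
    ∀ p ∈ wL A, p.1 ≠ 16912 := by
  rw [checkFixed, all_iff] at h
  have h1 := h A hA
  rw [all_iff] at h1
  intro p hp
  have h2 := h1 p hp
  rw [Bool.not_eq_true', ← Bool.not_eq_true, Nat.beq_eq] at h2
  exact h2

theorem IsSmall.weight_sq (h : IsSmall π) (hf : checkFixed π.size = true) :
    weight π ^ 2 = π.weightSq := by
  obtain ⟨h1, -, h2⟩ := wL_spec h.inBox
  have h3 : ∀ p ∈ wL (boxList π), dec p.1 ≠ 0 := fun p hp =>
    dec_ne_zero (h1 p hp) (not_mem_fixed hf (boxList_mem_enum h) p hp)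
  rw [h.length_boxList] at h2
  rw [weightSq, h.neg_vertex, eulerT_add_dual h3 h2, weight, mul_pow, ← pow_mul,
    mul_comm (mu _) 2, pow_mul, neg_one_sq, one_pow, one_mul]

/-- Substituting λ₄ = -(λ₁ + λ₂ + λ₃) turns the factor of the box (i, j, k, l) into s + (i-l) λ₁ +
(j-l) λ₂ + (k-l) λ₃. -/
theorem IsSmall.insertion_eq (h : IsSmall π) :
    π.insertion = ((boxList π).map fun b => form (wt b)).prod := by
  rw [insertion, prod_parts π fun p l => ∑ i : Fin 4, (dvar i + (box p l i : LamDField)) * lamD i,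
    h.prod_boxes fun x => ∑ i : Fin 4, (dvar i + (box x.1 x.2 i : LamDField)) * lamD i]
  refine congrArg List.prod (List.map_congr_left fun b hb => ?_)
  have h1 := wt_spec (mem_boxList.mp hb).1
  have h2 : lamD 3 = -(lamD 0 + lamD 1 + lamD 2) := by
    rw [lamD, lam_three, map_neg, map_add, map_add]
    rfl
  have ha : dig (wt b / 1024) = ((b % 8 : ℕ) : ℤ) - (b / 512 : ℕ) := congrFun h1.2 0
  have hb : dig (wt b / 32) = ((b / 8 % 8 : ℕ) : ℤ) - (b / 512 : ℕ) := congrFun h1.2 1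
  have hc : dig (wt b) = ((b / 64 % 8 : ℕ) : ℤ) - (b / 512 : ℕ) := congrFun h1.2 2
  rw [form, lin, if_pos h1.1.2.2.2, ha, hb, hc, sForm, Fin.sum_univ_four, Fin.sum_univ_four, h2]
  have b0 : box (decode b).1 (decode b).2 0 = (b % 8 : ℕ) := rfl
  have b1 : box (decode b).1 (decode b).2 1 = (b / 8 % 8 : ℕ) := rfl
  have b2 : box (decode b).1 (decode b).2 2 = (b / 64 % 8 : ℕ) := rfl
  have b3 : box (decode b).1 (decode b).2 3 = (b / 512 : ℕ) := rfl
  rw [b0, b1, b2, b3]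
  push_cast
  ring

theorem cast_sgn {R : Type*} [Ring R] (n : ℕ) : ((sgn n : ℤ) : R) = (-1) ^ n := by
  have h : sgn n = cond (Nat.beq (n % 2) 0) 1 (-1) := rfl
  rw [h]
  rcases Nat.even_or_odd n with hn | hn
  · rw [Nat.even_iff.mp hn, hn.neg_one_pow]
    change ((1 : ℤ) : R) = 1
    exact Int.cast_one
  · rw [Nat.odd_iff.mp hn, hn.neg_one_pow]
    change ((-1 : ℤ) : R) = -1
    rw [Int.cast_neg, Int.cast_one]

/-- The sign of the term of a list of boxes. -/
noncomputable def termSign (A : List ℕ) : ℤ := sgn (mu A + negDeg (wL A))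

theorem termSign_eq (A : List ℕ) : termSign A = 1 ∨ termSign A = -1 := by
  have h := cast_sgn (R := ℤ) (mu A + negDeg (wL A))
  rw [Int.cast_id] at h
  rw [termSign, h]
  exact neg_one_pow_eq_or ℤ _

theorem IsSmall.insertion_mul_weight (h : IsSmall π) (hf : checkFixed π.size = true) :
    π.insertion * algebraMap LamField LamDField (weight π)
      = termSign (boxList π) * ev formNZ (prodL (boxList π)) := by
  obtain ⟨h1, -, -⟩ := wL_spec h.inBox
  have h2 : ∀ p ∈ wL (boxList π), InBox 15 p.1 ∧ p.1 ≠ 16912 := fun p hp =>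
    ⟨(h1 p hp).mono (by norm_num), not_mem_fixed hf (boxList_mem_enum h) p hp⟩
  rw [h.insertion_eq, weight, map_mul, ev_canon h2, prodL, forceVL_eq, ev_sL h.inBox, termSign,
    cast_sgn, pow_add, map_pow, map_neg, map_one]
  ring

end VertexTable

namespace VertexTable

/-! ### The coefficients of the MacMahon side -/

section Truncation
variable {F : Type*} [Field F]

open PowerSeries

/-- The first seven coefficients of a power series. -/
def Coeffs (f : PowerSeries F) (l : List ℤ) : Prop :=
  ∀ j < 7, coeff j f = ((l.getD j 0 : ℤ) : F)

def conv (l l' : List ℤ) : List ℤ :=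
  (List.range 7).map fun j => ∑ i ∈ Finset.range (j + 1), l.getD i 0 * l'.getD (j - i) 0

theorem getD_map_range (a : ℕ → ℤ) {j : ℕ} (h : j < 7) :
    ((List.range 7).map a).getD j 0 = a j := by
  rw [List.getD_eq_getElem _ _ (by simpa using h)]
  simp

theorem Coeffs.mul {f g : PowerSeries F} {l l' : List ℤ} (h : Coeffs f l) (h' : Coeffs g l') :
    Coeffs (f * g) (conv l l') := by
  intro j hj
  rw [conv, getD_map_range _ hj, coeff_mul, Finset.Nat.sum_antidiagonal_eq_sum_range_succ_mk,
    Int.cast_sum]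
  refine Finset.sum_congr rfl fun i hi => ?_
  rw [Finset.mem_range] at hi
  rw [h i (by omega), h' (j - i) (by omega), Int.cast_mul]

theorem Coeffs.one : Coeffs (1 : PowerSeries F) [1] := by
  intro j _
  rw [coeff_one]
  rcases j with _ | j
  · simp
  · simp

def powL (l : List ℤ) : ℕ → List ℤ
  | 0 => [1]
  | k + 1 => conv (powL l k) l

theorem Coeffs.pow {f : PowerSeries F} {l : List ℤ} (h : Coeffs f l) (k : ℕ) :
    Coeffs (f ^ k) (powL l k) := by
  induction k with
  | zero => rw [pow_zero]; exact Coeffs.one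
  | succ k ih => rw [pow_succ]; exact ih.mul h

theorem inv_one_sub_X_pow {m : ℕ} (hm : 0 < m) :
    (1 - X ^ m : PowerSeries F)⁻¹ = mk fun j => if m ∣ j then 1 else 0 := by
  symm
  rw [eq_inv_iff_mul_eq_one (by simp [hm.ne'])]
  ext j
  rw [mul_sub, mul_one, map_sub, coeff_mul_X_pow', coeff_mk, coeff_one]
  split_ifs with h1 h2 h3 h3 h2 h3
  · omega
  · rw [coeff_mk, if_pos (Nat.dvd_sub h1 dvd_rfl), sub_self]
  · exact sub_zero _
  · exact absurd (Nat.eq_zero_of_dvd_of_lt h1 (not_le.mp h2)) h3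
  · exact absurd (h3 ▸ dvd_zero m) h1
  · rw [coeff_mk, if_neg, sub_self]
    intro h4
    exact h1 ((Nat.dvd_sub_iff_left h2 dvd_rfl).mp h4)
  · exact absurd (by rename_i h4; exact h4 ▸ dvd_zero m) h1
  · exact sub_zero _

def geoL (m : ℕ) : List ℤ := (List.range 7).map fun j => if m ∣ j then 1 else 0

theorem coeffs_geo {m : ℕ} (hm : 0 < m) : Coeffs (1 - X ^ m : PowerSeries F)⁻¹ (geoL m) := by
  intro j hj
  rw [inv_one_sub_X_pow hm, coeff_mk, geoL, getD_map_range _ hj]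
  split_ifs <;> simp

def macL : ℕ → List ℤ
  | 0 => [1]
  | m + 1 => conv (macL m) (powL (geoL (m + 1)) (m + 1))

theorem coeffs_prod (n : ℕ) :
    Coeffs (∏ m ∈ Finset.Icc 1 n, ((1 - X ^ m : PowerSeries F)⁻¹) ^ m) (macL n) := by
  induction n with
  | zero => exact Coeffs.one
  | succ n ih =>
    rw [Finset.prod_Icc_succ_top (by omega)]
    exact ih.mul ((coeffs_geo (Nat.succ_pos n)).pow _)

/-- The coefficients of `M(-q) - 1`. -/
def negMacL : List ℤ := [0, -1, 3, -6, 13, -24, 48]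

theorem coeffs_macMahon : Coeffs (evalNegHom (macMahon F) - 1) negMacL := by
  have key : ∀ j < 7, (-1 : ℤ) ^ j * (macL j).getD j 0 - (if j = 0 then 1 else 0)
      = negMacL.getD j 0 := by decide +kernel
  intro j hj
  rw [map_sub, evalNegHom, coeff_rescale, macMahon, coeff_mk, coeffs_prod j j hj, coeff_one,
    ← key j hj]
  push_cast
  split_ifs <;> simp

theorem coeff_seriesPow (c : F) {n : ℕ} (hn : n < 7) :
    coeff n (seriesPow (evalNegHom (macMahon F)) c) = ∑ k ∈ Finset.range (n + 1),
      ((∏ i ∈ Finset.range k, (c - (i : F))) / (k.factorial : F))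
        * (((powL negMacL k).getD n 0 : ℤ) : F) := by
  rw [seriesPow, coeff_mk]
  exact Finset.sum_congr rfl fun k _ => by rw [coeffs_macMahon.pow k n hn]

/-- The coefficients of `n!` times the coefficient of `q ^ n` in `M(-q) ^ c`, as a polynomial
in `-c`, up to sign. -/
def rhsCoeffs : ℕ → List ℤ
  | 1 => [-1]
  | 2 => [5, -1]
  | 3 => [-20, 15, -1]
  | 4 => [126, -155, 30, -1]
  | 5 => [-624, 1630, -575, 50, -1]
  | 6 => [6000, -17194, 9765, -1525, 75, -1]
  | _ => []

/-- `∑ c_i r ^ (k + i)` -/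
def polyVal (r : F) : List ℤ → ℕ → F
  | [], _ => 0
  | c :: cs, k => c * r ^ k + polyVal r cs (k + 1)

/-- Since M(-q) - 1 has no constant term, only its powers up to the n-th contribute, and seven
coefficients of each are enough. -/
theorem factorial_mul_coeff_seriesPow [CharZero F] (r : F) {n : ℕ} (h1 : 1 ≤ n) (h6 : n ≤ 6) :
    (n.factorial : F) * coeff n (seriesPow (evalNegHom (macMahon F)) (-r))
      = -polyVal r (rhsCoeffs n) 1 := by
  have p0 : powL negMacL 0 = [1] := rfl
  have p1 : powL negMacL 1 = [0, -1, 3, -6, 13, -24, 48] := by decide +kernel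
  have p2 : powL negMacL 2 = [0, 0, 1, -6, 21, -62, 162] := by decide +kernel
  have p3 : powL negMacL 3 = [0, 0, 0, -1, 9, -45, 174] := by decide +kernel
  have p4 : powL negMacL 4 = [0, 0, 0, 0, 1, -12, 78] := by decide +kernel
  have p5 : powL negMacL 5 = [0, 0, 0, 0, 0, -1, 15] := by decide +kernel
  have p6 : powL negMacL 6 = [0, 0, 0, 0, 0, 0, 1] := by decide +kernel
  rw [coeff_seriesPow (-r) (by omega)]
  interval_cases n <;>
    simp only [Finset.sum_range_succ, Finset.sum_range_zero, Finset.prod_range_succ,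
      Finset.prod_range_zero, p0, p1, p2, p3, p4, p5, p6, rhsCoeffs, polyVal, Nat.factorial,
      List.getD_cons_zero, List.getD_cons_succ, List.getD_nil] <;>
    push_cast <;> field_simp <;> ring

end Truncation

/-! ### The rows of the MacMahon side -/

theorem coeff_zero_macMahonSide : PowerSeries.coeff 0 macMahonSide = 1 := by
  rw [macMahonSide, coeff_seriesPow _ (by norm_num)]
  simp [powL]

/-- The element `s (x + y) (x + z) (y + z) / (x y z (x + y + z))`. -/
noncomputable def rhsBase : LamDField :=
  form 16912 * form 50736 * form 50705 * form 49713
    / (form 50704 * form 49712 * form 49681 * form 50737)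

theorem form_eq {k : ℕ} (a b c : ℤ) (ha : dig (k / 1024) = a) (hb : dig (k / 32) = b)
    (hc : dig k = c) (hk : 32768 ≤ k) : form k = a * lamD 0 + b * lamD 1 + c * lamD 2 := by
  rw [form_of_le hk, ha, hb, hc]

theorem form_values : form 16912 = sForm ∧ form 49681 = lamD 2 ∧ form 49712 = lamD 1 ∧
    form 49713 = lamD 1 + lamD 2 ∧ form 50704 = lamD 0 ∧ form 50705 = lamD 0 + lamD 2 ∧
    form 50736 = lamD 0 + lamD 1 ∧ form 50737 = lamD 0 + lamD 1 + lamD 2 := by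
  refine ⟨?_, ?_, ?_, ?_, ?_, ?_, ?_, ?_⟩
  · rw [form, lin, dig_eq, dig_eq, dig_eq]
    norm_num
  · rw [form_eq 0 0 1 (by norm_num [dig_eq]) (by norm_num [dig_eq])
      (by norm_num [dig_eq]) (by norm_num)]
    push_cast
    ring
  · rw [form_eq 0 1 0 (by norm_num [dig_eq]) (by norm_num [dig_eq])
      (by norm_num [dig_eq]) (by norm_num)]
    push_cast
    ring
  · rw [form_eq 0 1 1 (by norm_num [dig_eq]) (by norm_num [dig_eq])
      (by norm_num [dig_eq]) (by norm_num)]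
    push_cast
    ring
  · rw [form_eq 1 0 0 (by norm_num [dig_eq]) (by norm_num [dig_eq])
      (by norm_num [dig_eq]) (by norm_num)]
    push_cast
    ring
  · rw [form_eq 1 0 1 (by norm_num [dig_eq]) (by norm_num [dig_eq])
      (by norm_num [dig_eq]) (by norm_num)]
    push_cast
    ring
  · rw [form_eq 1 1 0 (by norm_num [dig_eq]) (by norm_num [dig_eq])
      (by norm_num [dig_eq]) (by norm_num)]
    push_cast
    ring
  · rw [form_eq 1 1 1 (by norm_num [dig_eq]) (by norm_num [dig_eq])
      (by norm_num [dig_eq]) (by norm_num)]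
    push_cast
    ring

theorem nonzeroForm_iff {k : ℕ} :
    nonzeroForm k = true ↔ k < 32768 ∨ k % 32768 ≠ 16912 := by
  rw [nonzeroForm, Bool.or_eq_true, Nat.blt_eq, Bool.not_eq_true', ← Bool.not_eq_true, Nat.beq_eq]
  rfl

/-- When the λ_i sum to 0, their third elementary symmetric function is -(λ₁+λ₂)(λ₁+λ₃)(λ₂+λ₃), and
λ₄ contributes -(λ₁+λ₂+λ₃) to the denominator. -/
theorem macMahonExponent_eq : macMahonExponent = -rhsBase := by
  obtain ⟨h1, h2, h3, h4, h5, h6, h7, h8⟩ := form_values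
  have n1 : form 49681 ≠ 0 := form_ne_zero (nonzeroForm_iff.mpr (by norm_num))
  have n2 : form 49712 ≠ 0 := form_ne_zero (nonzeroForm_iff.mpr (by norm_num))
  have n3 : form 50704 ≠ 0 := form_ne_zero (nonzeroForm_iff.mpr (by norm_num))
  have n4 : form 50737 ≠ 0 := form_ne_zero (nonzeroForm_iff.mpr (by norm_num))
  have hw : lamD 3 = -(lamD 0 + lamD 1 + lamD 2) := by
    rw [lamD, lam_three, map_neg, map_add, map_add]
    rfl
  rw [h2] at n1
  rw [h3] at n2
  rw [h5] at n3
  rw [h8] at n4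
  have hs : dvar 0 * lamD 0 + dvar 1 * lamD 1 + dvar 2 * lamD 2 + dvar 3 * lamD 3 = sForm := by
    rw [sForm, Fin.sum_univ_four]
  rw [macMahonExponent, rhsBase, hs, h1, h2, h3, h4, h5, h6, h7, h8, hw]
  have n5 : lamD 0 * lamD 1 * lamD 2 * -(lamD 0 + lamD 1 + lamD 2) ≠ 0 :=
    mul_ne_zero (mul_ne_zero (mul_ne_zero n3 n2) n1) (neg_ne_zero.mpr n4)
  have n6 : lamD 0 * lamD 1 * lamD 2 * (lamD 0 + lamD 1 + lamD 2) ≠ 0 :=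
    mul_ne_zero (mul_ne_zero (mul_ne_zero n3 n2) n1) n4
  rw [← neg_div, div_eq_div_iff n5 n6]
  ring

theorem ev_rhsList (k : ℕ) : ev formNZ (rhsList k) = rhsBase ^ k := by
  have hn : ∀ {m : ℕ}, (m < 32768 ∨ m % 32768 ≠ 16912) → formNZ m = form m := fun h =>
    formNZ_eq (nonzeroForm_iff.mpr h)
  rw [rhsList]
  simp only [ev_cons, ev_nil, hn (m := 16912) (by norm_num), hn (m := 49681) (by norm_num),
    hn (m := 49712) (by norm_num), hn (m := 49713) (by norm_num), hn (m := 50704) (by norm_num),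
    hn (m := 50705) (by norm_num), hn (m := 50736) (by norm_num), hn (m := 50737) (by norm_num),
    zpow_neg, zpow_natCast]
  rw [rhsBase, div_pow, mul_pow, mul_pow, mul_pow, mul_pow, mul_pow, mul_pow, div_eq_mul_inv,
    mul_inv, mul_inv, mul_inv]
  ring

theorem sum_rhsRows (cs : List ℤ) (k : ℕ) : ((rhsRows cs k).map fun r =>
    (r.1 : LamDField) * ev formNZ r.2).sum = polyVal rhsBase cs k := by
  induction cs generalizing k with
  | nil => rfl
  | cons c cs ih =>
    have h : rhsRows (c :: cs) k = (c, rhsList k) :: rhsRows cs ((k + 1 : ℕ) : ℤ) := rfl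
    rw [h, List.map_cons, List.sum_cons, ih, ev_rhsList, polyVal]

theorem factorial_mul_coeff_macMahonSide {n : ℕ} (h1 : 1 ≤ n) (h6 : n ≤ 6) :
    (n.factorial : LamDField) * PowerSeries.coeff n macMahonSide
      = -((rhsRows (rhsCoeffs n) 1).map fun r => (r.1 : LamDField) * ev formNZ r.2).sum := by
  have := sum_rhsRows (rhsCoeffs n) 1
  rw [Nat.cast_one] at this
  rw [this, macMahonSide, macMahonExponent_eq]
  exact factorial_mul_coeff_seriesPow rhsBase h1 h6

end VertexTable

namespace VertexTable

/-! ### The identity and the uniqueness of the signs -/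

open SolidPartition

theorem checkFixed_of_le {n : ℕ} (hn : n ≤ 6) : checkFixed n = true := by
  have h := (all_iff _ _).mp checkFixed_le
  interval_cases n <;> exact h _ (by simp)

theorem exists_checkIndep {n : ℕ} (hn : n ≤ 6) : ∃ ps, checkIndep n ps = true := by
  interval_cases n
  exacts [⟨_, checkIndep_zero⟩, ⟨_, checkIndep_one⟩, ⟨_, checkIndep_two⟩, ⟨_, checkIndep_three⟩,
    ⟨_, checkIndep_four⟩, ⟨_, checkIndep_five⟩, ⟨_, checkIndep_six⟩]

theorem lamD_two_ne_zero : lamD 2 ≠ 0 := by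
  rw [← form_values.2.1]
  exact form_ne_zero (nonzeroForm_iff.mpr (by norm_num))

theorem sum_allRows {n : ℕ} (h1 : 1 ≤ n) (h6 : n ≤ 6) :
    ((allRows n (rhsCoeffs n)).map fun r => (r.1 : LamDField) * ev formNZ r.2).sum = 0 := by
  have hz := lamD_two_ne_zero
  have hl : ∀ k, nonzeroForm k = true → lin (lamD 0) (lamD 1) (lamD 2) sForm k ≠ 0 := fun k hk =>
    form_ne_zero hk
  have hv : ∀ k, nonzeroForm k = true → formNZ k = lin (lamD 0) (lamD 1) (lamD 2) sForm k :=
    fun k hk => formNZ_eq hk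
  interval_cases n
  · exact sum_rows_eq_zero checkTable_one checkRoots_one hz hl hv
  · exact sum_rows_eq_zero checkTable_two checkRoots_two hz hl hv
  · exact sum_rows_eq_zero checkTable_three checkRoots_three hz hl hv
  · exact sum_rows_eq_zero checkTable_four checkRoots_four hz hl hv
  · exact sum_rows_eq_zero checkTable_five checkRoots_five hz hl hv
  · exact sum_rows_eq_zero_of_three checkTable_six checkRoots_six_low checkRoots_six_mid
      checkRoots_six_high (by norm_num) (by norm_num) hz hl hv

theorem sum_boxRows (n : ℕ) : ((boxRows n).map fun r => (r.1 : LamDField) * ev formNZ r.2).sum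
    = (n.factorial : LamDField)
      * ((enum cand [] n).map fun A => (termSign A : LamDField) * ev formNZ (prodL A)).sum := by
  rw [boxRows, mapR_eq, List.map_map, ← List.sum_map_mul_left]
  refine congrArg List.sum (List.map_congr_left fun A _ => ?_)
  have h : term (Int.ofNat n.factorial) A = ((n.factorial : ℤ) * termSign A, prodL A) := rfl
  rw [Function.comp_apply, h, Int.cast_mul, Int.cast_natCast, mul_assoc]

theorem sum_terms {n : ℕ} (h6 : n ≤ 6) :
    ((enum cand [] n).map fun A => (termSign A : LamDField) * ev formNZ (prodL A)).sum
      = PowerSeries.coeff n macMahonSide := by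
  rcases Nat.eq_zero_or_pos n with rfl | h1
  · have h : ∀ bs, enum bs [] 0 = [[]] := fun bs => by cases bs <;> rfl
    have h2 : termSign [] = 1 := rfl
    have h3 : prodL [] = [] := rfl
    rw [h, List.map_singleton, List.sum_singleton, h2, h3, ev_nil, coeff_zero_macMahonSide]
    simp
  · have h2 := sum_allRows h1 h6
    rw [allRows, app_eq, List.map_append, List.sum_append, sum_boxRows] at h2
    have h3 := factorial_mul_coeff_macMahonSide h1 h6
    have h4 : (n.factorial : LamDField) ≠ 0 := Nat.cast_ne_zero.mpr n.factorial_ne_zero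
    refine mul_left_cancel₀ h4 ?_
    rw [h3]
    linear_combination h2

/-- The coefficients of the generating series for the weights `σ π * weight π`. -/
theorem coeff_genSeries {n : ℕ} (h6 : n ≤ 6) {w : SolidPartition → LamField} {τ : List ℕ → ℤ}
    (hw : ∀ π : SolidPartition, π.size = n → w π = (τ (boxList π) : LamField) * weight π) :
    PowerSeries.coeff n (genSeries w) = ((enum cand [] n).map fun A =>
      (τ A : LamDField) * ((termSign A : LamDField) * ev formNZ (prodL A))).sum := by
  rw [genSeries, PowerSeries.coeff_mk, ← sum_solidPartition h6]
  refine Finset.sum_congr rfl fun π _ => ?_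
  have hs : IsSmall π.1 := isSmall_of_size_le (π.2.trans_le h6)
  have hf : checkFixed π.1.size = true := checkFixed_of_le (π.2.trans_le h6)
  rw [hw π.1 π.2, map_mul, map_intCast, ← hs.insertion_mul_weight hf]
  ring

theorem coeff_genSeries_weight {n : ℕ} (h6 : n ≤ 6) {w : SolidPartition → LamField}
    (hw : ∀ π : SolidPartition, π.size = n → w π = weight π) :
    PowerSeries.coeff n (genSeries w) = PowerSeries.coeff n macMahonSide := by
  rw [coeff_genSeries h6 (τ := fun _ => 1) fun π hπ => by
    rw [hw π hπ, Int.cast_one, one_mul], ← sum_terms h6]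
  simp only [Int.cast_one, one_mul]

theorem signsWork_iff {w : SolidPartition → LamField} {ε : SolidPartition → ℤˣ} :
    SignsWork 7 w ε ↔ ∀ n < 7, PowerSeries.coeff n (genSeries fun π => ((ε π : ℤ) : LamField) * w π)
      = PowerSeries.coeff n macMahonSide := by
  rw [SignsWork, PowerSeries.X_pow_dvd_iff]
  simp only [map_sub, sub_eq_zero]

/-- The signed weights of the solid partitions of size `n` are determined by the identity. -/
theorem eq_weight_of_coeff_eq {n : ℕ} (h6 : n ≤ 6) {w : SolidPartition → LamField}
    (hw : ∀ π : SolidPartition, π.size = n → w π = weight π ∨ w π = -weight π)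
    (h : PowerSeries.coeff n (genSeries w) = PowerSeries.coeff n macMahonSide)
    {π : SolidPartition} (hπ : π.size = n) : w π = weight π := by
  classical
  obtain ⟨ps, hc⟩ := exists_checkIndep h6
  let bad : List ℕ → Prop := fun A =>
    ∃ ρ : SolidPartition, ρ.size = n ∧ boxList ρ = A ∧ w ρ ≠ weight ρ
  have hbad : ∀ ρ : SolidPartition, ρ.size = n → bad (boxList ρ) → w ρ ≠ weight ρ := by
    rintro ρ hρ ⟨ρ', h1, h2, h3⟩
    rwa [← boxList_injective (isSmall_of_size_le (h1.trans_le h6))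
      (isSmall_of_size_le (hρ.trans_le h6)) h2]
  -- Half the difference between the correct sum and the given one: a wrong sign changes a term by
  -- twice its value. Halving puts the coefficients into {0, 1, -1}, as the elimination requires.
  let δ : URow → ℤ := fun r => if bad r.1 then termSign r.1 else 0
  have hδ : ∀ r, δ r = -1 ∨ δ r = 0 ∨ δ r = 1 := by
    intro r
    simp only [δ]
    split_ifs
    · rcases termSign_eq r.1 with h1 | h1 <;> simp [h1]
    · simp
  have h1 := coeff_genSeries h6 (w := w) (τ := fun A => if bad A then -1 else 1) fun ρ hρ => by
    split_ifs with hb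
    · rw [Int.cast_neg, Int.cast_one, neg_one_mul]
      exact (hw ρ hρ).resolve_left (hbad ρ hρ hb)
    · rw [Int.cast_one, one_mul]
      by_contra hne
      exact hb ⟨ρ, hρ, rfl, hne⟩
  rw [h, ← sum_terms h6] at h1
  have h2 : ((uRows n).map fun r => (δ r : LamDField) * ev formNZ r.2).sum = 0 := by
    rw [uRows, mapR_eq, List.map_map]
    have h3 : ∀ l : List (List ℕ), 2 * (l.map ((fun r : URow => (δ r : LamDField) * ev formNZ r.2) ∘
        fun A => (A, prodL A))).sum
        = (l.map fun A => (termSign A : LamDField) * ev formNZ (prodL A)).sum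
          - (l.map fun A => (((if bad A then -1 else 1 : ℤ)) : LamDField)
            * ((termSign A : LamDField) * ev formNZ (prodL A))).sum := by
      intro l
      induction l with
      | nil => simp
      | cons A l ih =>
        rw [List.map_cons, List.map_cons, List.map_cons, List.sum_cons, List.sum_cons,
          List.sum_cons, mul_add, ih, Function.comp_apply]
        simp only [δ]
        split_ifs <;> push_cast <;> ring
    have h4 := h3 (enum cand [] n)
    rw [← h1, sub_self] at h4
    exact (mul_eq_zero.mp h4).resolve_left two_ne_zero
  have h5 := eq_zero_of_sum_eq_zero hc hδ (fun k hk => formNZ_eq hk) h2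
    (boxList π, prodL (boxList π)) (by
      rw [uRows, mapR_eq]
      have := boxList_mem_enum (isSmall_of_size_le (hπ.trans_le h6))
      rw [hπ] at this
      exact List.mem_map_of_mem this)
  by_contra hne
  have hb : bad (boxList π) := ⟨π, hπ, rfl, hne⟩
  simp only [δ, if_pos hb] at h5
  rcases termSign_eq (boxList π) with h6 | h6 <;> rw [h6] at h5 <;> norm_num at h5

theorem weight_sq_of_size_lt {π : SolidPartition} (h : π.size < 7) : weight π ^ 2 = π.weightSq :=
  (isSmall_of_size_le (Nat.lt_succ_iff.mp h)).weight_sq (checkFixed_of_le (Nat.lt_succ_iff.mp h))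

end VertexTable

open VertexTable in
theorem theorem3p15 :
    (∀ π : SolidPartition, π.size < 7 → ∃ w : LamField, w ^ 2 = π.weightSq) ∧
    ∀ w : SolidPartition → LamField, (∀ π, π.size < 7 → w π ^ 2 = π.weightSq) →
      ∃ ε : SolidPartition → ℤˣ, SignsWork 7 w ε ∧
        ∀ ε' : SolidPartition → ℤˣ, SignsWork 7 w ε' → ∀ π, π.size < 7 → ε' π = ε π := by
  classical
  refine ⟨fun π hπ => ⟨weight π, weight_sq_of_size_lt hπ⟩, fun w hw => ?_⟩
  have hw' : ∀ π : SolidPartition, π.size < 7 → w π = weight π ∨ w π = -weight π := fun π hπ =>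
    sq_eq_sq_iff_eq_or_eq_neg.mp ((hw π hπ).trans (weight_sq_of_size_lt hπ).symm)
  -- For sizes below 7 this is the sign carrying w π to `weight π`; larger sizes do not affect the
  -- identity modulo q⁷.
  let ε : SolidPartition → ℤˣ := fun π => if w π = weight π then 1 else -1
  have hε : ∀ π : SolidPartition, π.size < 7 → ((ε π : ℤ) : LamField) * w π = weight π := by
    intro π hπ
    simp only [ε]
    split_ifs with h
    · simpa using h
    · simp [(hw' π hπ).resolve_left h]
  refine ⟨ε, signsWork_iff.mpr fun n hn => coeff_genSeries_weight (Nat.lt_succ_iff.mp hn)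
    fun π hπ => hε π (hπ.trans_lt hn), fun ε' hε' π hπ => ?_⟩
  have h1 := eq_weight_of_coeff_eq (Nat.lt_succ_iff.mp hπ) (fun ρ hρ => ?_)
    (signsWork_iff.mp hε' π.size hπ) rfl
  · have h2 : ((ε' π : ℤ) : LamField) * w π = ((ε π : ℤ) : LamField) * w π :=
      h1.trans (hε π hπ).symm
    -- Nonvanishing is what lets the signed weight determine the sign itself.
    have h3 : w π ≠ 0 := by
      intro h0
      have := hε π hπ
      rw [h0, mul_zero] at this
      exact weight_ne_zero π this.symm
    exact Units.ext (Int.cast_injective (mul_right_cancel₀ h3 h2))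
  · rcases Int.units_eq_one_or (ε' ρ) with h | h <;>
      rcases hw' ρ (hρ.trans_lt hπ) with h' | h' <;> simp [h, h']
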